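/- **Setting.** There are $n\ge 1$ agents. Agent $i$ has sample losses $f_i(x,y;\xi)$, $g_i(x,y;\xi)$ on $\mathbb R^{d_x}\times\mathbb R^{d_y}$ and sample distributions for $\xi_{f,i}$, $\xi_{g,i}$; put $f_i=\mathbb E f_i(\cdot;\xi_{f,i})$, $g_i=\mathbb E g_i(\cdot;\xi_{g,i})$, $F=\frac1n\sum_i f_i$, $G=\frac1n\sum_i g_i$. For $\gamma,\mu>0$ let $$V_\gamma(x,y)=\min_\theta\Big\{G(x,\theta)+\tfrac1{2\gamma}\|\theta-y\|^2\Big\},\qquad \Psi_\mu=\mu F+G-V_\gamma,$$ and let $\theta^*_\gamma(x,y)$ be the minimizer defining $V_\gamma(x,y)$. **Assumptions.** (1) $f_i$, $g_i$ are $C^1$ with $L_1$- resp. $L_2$-Lipschitz gradients ($L_1\ge0$, $L_2>0$). (2) The stochastic gradients $\nabla f_i(\cdot;\xi_{f,i})$, $\nabla g_i(\cdot;\xi_{g,i})$ are unbiased with variances at most $\delta_f^2$, $\delta_g^2$ at every point. (3) The weight matrix $\mathbf W=(w_{ij})\in\mathbb R^{n\times n}$ is non-negative, symmetric and doubly stochastic,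 with eigenvalues $1=\lambda_1\ge\lambda_2\ge\dots\ge\lambda_n$ and $\rho=\max\{|\lambda_2|,|\lambda_n|\}<1$ ($\rho=0$ if $n=1$). (4) $\frac1n\sum_i\|\nabla f_i-\nabla F\|^2\le\sigma_f^2$ and $\frac1n\sum_i\|\nabla g_i-\nabla G\|^2\le\sigma_g^2$ everywhere. Moreover $F\ge\underline F$. **Algorithm (SUN-DSBO-SE).** A run of $K$ iterations starts at deterministic $(\theta_i^0,x_i^0,y_i^0)$ and for $k=0,\dots,K-1$ draws samples $\xi_{f,i}^k,\xi_{g,i}^k$ with the above distributions, the pairs $(\xi_{f,i}^k,\xi_{g,i}^k)$ being independent over $k$ and $i$, sets $$\begin{aligned}\hat D_{\theta,i}^k&=\nabla_y g_i(x_i^k,\theta_i^k;\xi_{g,i}^k)+\tfrac1\gamma(\theta_i^k-y_i^k),\\ \hat D_{x,i}^k&=\mu_k\nabla_x f_i(x_i^k,y_i^k;\xi_{f,i}^k)+\nabla_x g_i(x_i^k,y_i^k;\xi_{g,i}^k)-\nabla_x g_i(x_i^k,\theta_i^k;\xi_{g,i}^k),\\ \hat D_{y,i}^k&=\mu_k\nabla_y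 f_i(x_i^k,y_i^k;\xi_{f,i}^k)+\nabla_y g_i(x_i^k,y_i^k;\xi_{g,i}^k)-\tfrac1\gamma(y_i^k-\theta_i^k),\end{aligned}$$ and updates $(\theta_i^{k+1},x_i^{k+1},y_i^{k+1})=\sum_j w_{ij}\big(\theta_j^k-\lambda_\theta\hat D_{\theta,j}^k,\;x_j^k-\lambda_x\hat D_{x,j}^k,\;y_j^k-\lambda_y\hat D_{y,j}^k\big)$. Bars denote averages over agents. The parameters are $\mu_k=\mu_0(k+1)^{-p}$ with $\mu_0>0$, $p\in(0,\frac14)$; $\gamma\in(0,\frac1{2L_2})$; $\lambda_\theta=c_\theta n^{1/2}K^{-1/2}$ and $\lambda_x=\lambda_y=c_\lambda\lambda_\theta$ with constants $c_\theta,c_\lambda>0$, where $c_\lambda\le \eta/(32a_1L_\theta^2)$ for $\eta=\frac1\gamma-L_2$, $a_1=\frac1{2L_\theta}\sqrt{L_2^2+\gamma^{-2}}$ and some Lipschitz constant $L_\theta>0$ of $\theta^*_\gamma$. **Complexities.** Each iteration costs $3n$ stochastic gradient evaluations (per agent: $\nabla f_i$ at $(x_i,y_i)$, and $\nabla g_i$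 at $(x_i,y_i)$ and $(x_i,\theta_i)$). For $\varepsilon>0$ the *sample complexity* $N(\varepsilon)$ is $3nK$ for the least $K$ such that every run of $K'\ge K$ iterations has some $k<K'$ with $\mathbb E\|\nabla\Psi_{\mu_k}(\bar x^k,\bar y^k)\|^2\le\varepsilon$ ($\infty$ if there is none). For $A>0$ the *transient iteration complexity* $T_A$ is the least $K_0$ such that the linear-speedup rate $$\frac1K\sum_{k=0}^{K-1}\mathbb E\|\nabla\Psi_{\mu_k}(\bar x^k,\bar y^k)\|^2\le\frac{A}{\sqrt{nK}}$$ holds for all $K\ge K_0$ ($\infty$ if there is none). **Statement.** Let $T=\max\Big\{\dfrac{n^3}{(1-\rho)^4},\dfrac{n^3(\sigma_f^2+\sigma_g^2)^2}{(1-\rho)^4}\Big\}$. For given $L_1,L_2,\delta_f,\delta_g,\gamma,\mu_0,p,c_\theta,c_\lambda$ and $B$ there are constants $A,C>0$, hence independent of $n$, $\rho$, $\sigma_f$, $\sigma_g$, of the dimensions and of the problem, such that, whenever the above assumptions hold and the initial error satisfies $$\mu_0\big(F(\bar x^0,\bar y^0)-\underline F\big)+G(\bar x^0,\bar y^0)-V_\gamma(\bar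 x^0,\bar y^0)+\|\bar\theta^0-\theta^*_\gamma(\bar x^0,\bar y^0)\|^2+\frac1n\sum_{i=1}^n\big(\|x_i^0-\bar x^0\|^2+\|y_i^0-\bar y^0\|^2+\|\theta_i^0-\bar\theta^0\|^2\big)\le B,$$ the functions $\Psi_\mu$ $(\mu>0)$ are differentiable and 1. $N(\varepsilon)\le C\,\varepsilon^{-2}$ for every $\varepsilon>0$ with $\varepsilon^2\,nT\le1$; that is, the sample complexity is $O(\varepsilon^{-2})$; 2. $T_A\le C\,T$; that is, the transient iteration complexity is $O\Big(\max\Big\{\dfrac{n^3}{(1-\rho)^4},\dfrac{n^3(\sigma_f^2+\sigma_g^2)^2}{(1-\rho)^4}\Big\}\Big)$. -/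

import Mathlib

open MeasureTheory ProbabilityTheory
open scoped ENNReal

noncomputable section

namespace SunDSBO

universe u v w

/-- `ℝ^d` with the Euclidean norm. -/
abbrev Vec (d : ℕ) : Type := EuclideanSpace ℝ (Fin d)

/-- `ℝ^{d_x} × ℝ^{d_y}` with the Euclidean norm `‖(x, y)‖² = ‖x‖² + ‖y‖²`. -/
abbrev Pair (dx dy : ℕ) : Type := WithLp 2 (Vec dx × Vec dy)

/-- The point `(x, y)`. -/
def pt {dx dy : ℕ} (x : Vec dx) (y : Vec dy) : Pair dx dy := WithLp.toLp 2 (x, y)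

/-- The local variables `(θ_i, x_i, y_i)` of one agent. -/
abbrev AgentState (dx dy : ℕ) : Type := Vec dy × Vec dx × Vec dy

/-- The average `(1/n) ∑ i, v i` over the agents. -/
def mean {E : Type*} [AddCommGroup E] [Module ℝ E] {n : ℕ} (v : Fin n → E) : E :=
  (n : ℝ)⁻¹ • ∑ i, v i

/-! ### The bilevel problem -/

/-- Data of the decentralized stochastic bilevel problem with `n` agents: the sample losses
`f_i(x, y; ξ)` and `g_i(x, y; ξ)`, and the distributions of `ξ_{f,i}` and `ξ_{g,i}`. -/
structure Problem (Ξf : Type u) (Ξg : Type v) [MeasurableSpace Ξf] [MeasurableSpace Ξg]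
    (dx dy n : ℕ) where
  lossF : Fin n → Pair dx dy → Ξf → ℝ
  lossG : Fin n → Pair dx dy → Ξg → ℝ
  lawF : Fin n → Measure Ξf
  lawG : Fin n → Measure Ξg

namespace Problem

variable {Ξf : Type u} {Ξg : Type v} [MeasurableSpace Ξf] [MeasurableSpace Ξg] {dx dy n : ℕ}
variable (P : Problem Ξf Ξg dx dy n)

/-- `f_i(x, y) = 𝔼[f_i(x, y; ξ_{f,i})]`. -/
def f (i : Fin n) (z : Pair dx dy) : ℝ := ∫ ξ, P.lossF i z ξ ∂P.lawF i

/-- `g_i(x, y) = 𝔼[g_i(x, y; ξ_{g,i})]`. -/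
def g (i : Fin n) (z : Pair dx dy) : ℝ := ∫ ξ, P.lossG i z ξ ∂P.lawG i

/-- The upper-level objective `F = (1/n) ∑ f_i`. -/
def F (z : Pair dx dy) : ℝ := mean fun i => P.f i z

/-- The lower-level objective `G = (1/n) ∑ g_i`. -/
def G (z : Pair dx dy) : ℝ := mean fun i => P.g i z

/-- The stochastic gradient `∇f_i(x, y; ξ)`, with respect to `(x, y)`. -/
def sgradF (i : Fin n) (z : Pair dx dy) (ξ : Ξf) : Pair dx dy :=
  gradient (fun z' => P.lossF i z' ξ) z

/-- The stochastic gradient `∇g_i(x, y; ξ)`, with respect to `(x, y)`. -/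
def sgradG (i : Fin n) (z : Pair dx dy) (ξ : Ξg) : Pair dx dy :=
  gradient (fun z' => P.lossG i z' ξ) z

/-- `G(x, θ) + ‖θ - y‖² / (2γ)`, as a function of `θ`. -/
def proxObjective (γ : ℝ) (z : Pair dx dy) (θ : Vec dy) : ℝ :=
  P.G (pt z.fst θ) + 1 / (2 * γ) * ‖θ - z.snd‖ ^ 2

/-- The Moreau envelope `V_γ(x, y)`. -/
def moreau (γ : ℝ) (z : Pair dx dy) : ℝ := ⨅ θ : Vec dy, P.proxObjective γ z θ

/-- The minimizer `θ*_γ(x, y)` of `θ ↦ G(x, θ) + ‖θ - y‖² / (2γ)`. -/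
def thetaStar (γ : ℝ) (z : Pair dx dy) : Vec dy :=
  Classical.epsilon fun θ => ∀ θ', P.proxObjective γ z θ ≤ P.proxObjective γ z θ'

/-- The penalty function `Ψ_μ = μ F + G - V_γ`. -/
def Psi (γ μ : ℝ) (z : Pair dx dy) : ℝ := μ * P.F z + P.G z - P.moreau γ z

/-- The standing assumptions on the problem: smoothness, stochastic oracle, bounded gradient
dissimilarity, and the lower bound `Flow` of `F`. -/
structure Assumptions (L1 L2 δf δg σf σg Flow : ℝ) : Prop where
  probF : ∀ i, IsProbabilityMeasure (P.lawF i)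
  probG : ∀ i, IsProbabilityMeasure (P.lawG i)
  integrableF : ∀ i z, Integrable (P.lossF i z) (P.lawF i)
  integrableG : ∀ i z, Integrable (P.lossG i z) (P.lawG i)
  diffSampleF : ∀ i z, ∀ᵐ ξ ∂P.lawF i, DifferentiableAt ℝ (fun z' => P.lossF i z' ξ) z
  diffSampleG : ∀ i z, ∀ᵐ ξ ∂P.lawG i, DifferentiableAt ℝ (fun z' => P.lossG i z' ξ) z
  measurableF : ∀ i, Measurable fun q : Pair dx dy × Ξf => P.sgradF i q.1 q.2
  measurableG : ∀ i, Measurable fun q : Pair dx dy × Ξg => P.sgradG i q.1 q.2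
  contDiffF : ∀ i, ContDiff ℝ 1 (P.f i)
  contDiffG : ∀ i, ContDiff ℝ 1 (P.g i)
  smoothF : ∀ i z z', ‖gradient (P.f i) z - gradient (P.f i) z'‖ ≤ L1 * ‖z - z'‖
  smoothG : ∀ i z z', ‖gradient (P.g i) z - gradient (P.g i) z'‖ ≤ L2 * ‖z - z'‖
  unbiasedF : ∀ i z, ∫ ξ, P.sgradF i z ξ ∂P.lawF i = gradient (P.f i) z
  unbiasedG : ∀ i z, ∫ ξ, P.sgradG i z ξ ∂P.lawG i = gradient (P.g i) z
  varianceF : ∀ i z,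
    ∫⁻ ξ, ‖gradient (P.f i) z - P.sgradF i z ξ‖ₑ ^ 2 ∂P.lawF i ≤ ENNReal.ofReal (δf ^ 2)
  varianceG : ∀ i z,
    ∫⁻ ξ, ‖gradient (P.g i) z - P.sgradG i z ξ‖ₑ ^ 2 ∂P.lawG i ≤ ENNReal.ofReal (δg ^ 2)
  dissimF : ∀ z, mean (fun i => ‖gradient (P.f i) z - gradient P.F z‖ ^ 2) ≤ σf ^ 2
  dissimG : ∀ z, mean (fun i => ‖gradient (P.g i) z - gradient P.G z‖ ^ 2) ≤ σg ^ 2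
  lowerBound : ∀ z, Flow ≤ P.F z

end Problem

/-! ### The communication network -/

/-- The eigenvalues `λ_1 ≥ ⋯ ≥ λ_n` of a symmetric matrix (`λ_{j+1}` at index `j`). -/
def sortedEigenvalue {n : ℕ} {W : Matrix (Fin n) (Fin n) ℝ} (hW : W.IsHermitian)
    (j : Fin n) : ℝ :=
  hW.eigenvalues₀ (Fin.cast (Fintype.card_fin n).symm j)

/-- The connectivity parameter `ρ = max {|λ_2|, |λ_n|}` (for a single agent there is no `λ_2`,
and `ρ = 0`). -/
def connectivity {n : ℕ} {W : Matrix (Fin n) (Fin n) ℝ} (hW : W.IsHermitian) : ℝ :=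
  if h : 2 ≤ n then
    max |sortedEigenvalue hW ⟨1, by omega⟩| |sortedEigenvalue hW ⟨n - 1, by omega⟩|
  else 0

/-! ### The algorithm SUN-DSBO-SE -/

/-- Parameters of the algorithm: the envelope parameter `γ`, the penalty schedule
`μ_k = μ0 (k+1)^{-p}`, and the step-size constants `c_θ`, `c_λ`. -/
structure Params where
  γ : ℝ
  μ0 : ℝ
  p : ℝ
  cθ : ℝ
  cl : ℝ

namespace Params

/-- `μ_k = μ0 (k+1)^{-p}`. -/
def μ (q : Params) (k : ℕ) : ℝ := q.μ0 * ((k : ℝ) + 1) ^ (-q.p)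

/-- `λ_θ = c_θ n^{1/2} K^{-1/2}` in a run of `K` iterations with `n` agents. -/
def stepθ (q : Params) (n K : ℕ) : ℝ := q.cθ * (√(n : ℝ) / √(K : ℝ))

/-- `λ_x = λ_y = c_λ λ_θ`. -/
def stepxy (q : Params) (n K : ℕ) : ℝ := q.cl * q.stepθ n K

end Params

/-- Everything that determines an execution: the problem, the weight matrix, the (deterministic)
initial variables, and the samples `ξ_{f,i}^k`, `ξ_{g,i}^k` drawn at agent `i` in iteration `k`. -/
structure Run (Ω : Type w) (Ξf : Type u) (Ξg : Type v) [MeasurableSpace Ω]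
    [MeasurableSpace Ξf] [MeasurableSpace Ξg] (dx dy n : ℕ) where
  prob : Problem Ξf Ξg dx dy n
  W : Matrix (Fin n) (Fin n) ℝ
  init : Fin n → AgentState dx dy
  measure : Measure Ω
  ξf : ℕ → Fin n → Ω → Ξf
  ξg : ℕ → Fin n → Ω → Ξg

namespace Run

variable {Ω : Type w} {Ξf : Type u} {Ξg : Type v} [MeasurableSpace Ω] [MeasurableSpace Ξf]
  [MeasurableSpace Ξg] {dx dy n : ℕ}
variable (R : Run Ω Ξf Ξg dx dy n)

/-- The samples are measurable, `ξ_{f,i}^k` and `ξ_{g,i}^k` have the prescribed distributions, and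
the pairs `(ξ_{f,i}^k, ξ_{g,i}^k)` are independent over all iterations `k` and agents `i`. -/
structure IndependentSampling : Prop where
  isProb : IsProbabilityMeasure R.measure
  measurableF : ∀ k i, Measurable (R.ξf k i)
  measurableG : ∀ k i, Measurable (R.ξg k i)
  lawF : ∀ k i, R.measure.map (R.ξf k i) = R.prob.lawF i
  lawG : ∀ k i, R.measure.map (R.ξg k i) = R.prob.lawG i
  indep : iIndepFun (fun (a : ℕ × Fin n) (ω : Ω) => (R.ξf a.1 a.2 ω, R.ξg a.1 a.2 ω)) R.measure

/-- The stochastic directions `(D̂_θ, D̂_x, D̂_y)` of agent `i` at the local variables `s`, with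
penalty parameter `μ` and samples `ξ`, `ζ` of the upper and lower level. -/
def direction (γ μ : ℝ) (i : Fin n) (s : AgentState dx dy) (ξ : Ξf) (ζ : Ξg) :
    AgentState dx dy :=
  let θ := s.1
  let x := s.2.1
  let y := s.2.2
  ((R.prob.sgradG i (pt x θ) ζ).snd + (1 / γ) • (θ - y),
   μ • (R.prob.sgradF i (pt x y) ξ).fst + (R.prob.sgradG i (pt x y) ζ).fst
      - (R.prob.sgradG i (pt x θ) ζ).fst,
   μ • (R.prob.sgradF i (pt x y) ξ).snd + (R.prob.sgradG i (pt x y) ζ).snd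
      - (1 / γ) • (y - θ))

/-- The iterates `(θ_i^k, x_i^k, y_i^k)` of SUN-DSBO-SE in a run of `K` iterations: every agent
takes a stochastic step and then averages with its neighbours through `W`. -/
def iterate (q : Params) (K : ℕ) : ℕ → Ω → Fin n → AgentState dx dy
  | 0 => fun _ => R.init
  | k + 1 => fun ω i => ∑ j, R.W i j •
      (let s := iterate q K k ω j
       let D := R.direction q.γ (q.μ k) j s (R.ξf k j ω) (R.ξg k j ω)
       (s.1 - q.stepθ n K • D.1, s.2.1 - q.stepxy n K • D.2.1, s.2.2 - q.stepxy n K • D.2.2))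

/-- The averaged iterate `(x̄^k, ȳ^k)` in a run of `K` iterations. -/
def meanPoint (q : Params) (K k : ℕ) (ω : Ω) : Pair dx dy :=
  pt (mean fun i => (R.iterate q K k ω i).2.1) (mean fun i => (R.iterate q K k ω i).2.2)

/-- `𝔼‖∇Ψ_{μ_k}(x̄^k, ȳ^k)‖²` in a run of `K` iterations. -/
def stationarity (q : Params) (K k : ℕ) : ℝ≥0∞ :=
  ∫⁻ ω, ‖gradient (R.prob.Psi q.γ (q.μ k)) (R.meanPoint q K k ω)‖ₑ ^ 2 ∂(R.measure)

/-- `(1/K) ∑_{k < K} 𝔼‖∇Ψ_{μ_k}(x̄^k, ȳ^k)‖²`. -/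
def averageStationarity (q : Params) (K : ℕ) : ℝ≥0∞ :=
  (K : ℝ≥0∞)⁻¹ * ∑ k ∈ Finset.range K, R.stationarity q K k

/-- The number of stochastic gradients evaluated by the `n` agents in `K` iterations: in every
iteration each agent evaluates `∇f_i(x_i, y_i; ξ_f)`, `∇g_i(x_i, y_i; ξ_g)`, `∇g_i(x_i, θ_i; ξ_g)`. -/
def gradientEvaluations (n K : ℕ) : ℕ := 3 * n * K

/-- The sample complexity: the number of stochastic gradient evaluations after which an
`ε`-stationary point is reached, that is, the number of evaluations in `K` iterations for the least
`K` such that every run of `K' ≥ K` iterations has an iterate with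
`𝔼‖∇Ψ_{μ_k}(x̄^k, ȳ^k)‖² ≤ ε` (`⊤` if there is no such `K`). -/
def sampleComplexity (q : Params) (ε : ℝ) : ℕ∞ :=
  ⨅ K ∈ {K : ℕ | ∀ K' ≥ K, ∃ k < K', R.stationarity q K' k ≤ ENNReal.ofReal ε},
    (gradientEvaluations n K : ℕ∞)

/-- The transient iteration complexity at level `A`: the least `K₀` such that all runs of
`K ≥ K₀` iterations obey the linear-speedup rate
`(1/K) ∑_{k < K} 𝔼‖∇Ψ_{μ_k}(x̄^k, ȳ^k)‖² ≤ A / √(n K)` (`⊤` if there is no such `K₀`). -/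
def transientComplexity (q : Params) (A : ℝ) : ℕ∞ :=
  ⨅ K₀ ∈ {K₀ : ℕ | ∀ K ≥ K₀,
      R.averageStationarity q K ≤ ENNReal.ofReal (A / √((n : ℝ) * K))},
    (K₀ : ℕ∞)

/-- The condition on the ratio `c_λ` of the step sizes:
`c_λ ≤ η / (32 a₁ L_θ²)` with `η = 1/γ - L2`, `a₁ = √(L2² + 1/γ²) / (2 L_θ)`, and `L_θ > 0` a
Lipschitz constant of `θ*_γ`. -/
def RatioCondition (q : Params) (L2 : ℝ) : Prop :=
  ∃ Lθ : ℝ, 0 < Lθ ∧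
    (∀ z z', ‖R.prob.thetaStar q.γ z - R.prob.thetaStar q.γ z'‖ ≤ Lθ * ‖z - z'‖) ∧
    q.cl ≤ (1 / q.γ - L2) / (32 * (√(L2 ^ 2 + 1 / q.γ ^ 2) / (2 * Lθ)) * Lθ ^ 2)

/-- The initial error
`μ₀ (F(x̄⁰, ȳ⁰) - Flow) + G(x̄⁰, ȳ⁰) - V_γ(x̄⁰, ȳ⁰) + ‖θ̄⁰ - θ*_γ(x̄⁰, ȳ⁰)‖²
+ (1/n) ∑ (‖x_i⁰ - x̄⁰‖² + ‖y_i⁰ - ȳ⁰‖² + ‖θ_i⁰ - θ̄⁰‖²)`. -/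
def initialError (q : Params) (Flow : ℝ) : ℝ :=
  let θ := mean fun i => (R.init i).1
  let x := mean fun i => (R.init i).2.1
  let y := mean fun i => (R.init i).2.2
  q.μ0 * (R.prob.F (pt x y) - Flow) + R.prob.G (pt x y) - R.prob.moreau q.γ (pt x y)
    + ‖θ - R.prob.thetaStar q.γ (pt x y)‖ ^ 2
    + mean fun i => ‖(R.init i).2.1 - x‖ ^ 2 + ‖(R.init i).2.2 - y‖ ^ 2 + ‖(R.init i).1 - θ‖ ^ 2

end Run

/-- `max {n³ / (1-ρ)⁴, n³ (σ_f² + σ_g²)² / (1-ρ)⁴}`. -/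
def transientOrder (n : ℕ) (ρ σf σg : ℝ) : ℝ :=
  max ((n : ℝ) ^ 3 / (1 - ρ) ^ 4) ((n : ℝ) ^ 3 * (σf ^ 2 + σg ^ 2) ^ 2 / (1 - ρ) ^ 4)

end SunDSBO

end

/-! Collect the variables of an agent into `s = (θ, z)` with `z = (x, y)`, and write `H(z, θ)` for
the proximal objective. The algorithm is then decentralized stochastic descent on the potential
`Φ_k(s) = μ_k (F(z) - Flow) + (G(z) - V_γ(z)) + (H(z, θ) - V_γ(z))`, the shifted penalty plus the
optimality gap of `θ`. Put `u = ∇_θ H`, `p = ∇Ψ_{μ_k}`, `w = ∇_z H(z, θ) - ∇V_γ(z)`. The gradient of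
`Φ_k` is `(u, p + w)`, while the averaged update direction is `(u, c_λ (p - w))`. In their inner
product the cross terms cancel, leaving `A = ‖u‖² + c_λ (‖p‖² - ‖w‖²)`. Strong convexity in `θ`
bounds `‖w‖` by a multiple of `‖θ - θ*‖`, hence of `‖u‖`, and the ratio condition turns this into
`c_λ ‖w‖² ≤ ‖u‖² / 4`. So `A` controls the squared norms of the gradient, of the direction and of
`p` (`Problem.align_ge`). The potential is non-negative, smooth, and decreasing in `k` because `μ_k`
decreases and `F ≥ Flow`.

These properties are axiomatized in `PotentialFlow`. In one step with step size `λ` the potential at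
the average loses `λA / 2`, up to the disagreement of the agents and noise; `W` contracts the
disagreement by `ρ`. A weighted sum of the two is a Lyapunov function
(`PotentialFlow.lyapunov_step_le`). The inequality is pathwise, with noise entering linearly and
quadratically. In expectation the linear part vanishes, since the samples are independent of the
current iterate, and the averaged noise has variance at most `v / n`.

Summing over `K` steps bounds the average of `𝔼‖∇Ψ‖²`, up to constants, by `1/(λK) + λ/n +
1/((1-ρ)K) + λ² (σ_f² + σ_g²)/(1-ρ)² + λ²/(1-ρ)`. For `λ` of order `√(n/K)` the first two terms have
order `1/√(nK)`, and the others are no larger as soon as `√K ≥ n^{3/2} (1-ρ)⁻² max {1, σ_f² +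
σ_g²}`, that is, `K ≥ T` (`rate_le`). This gives the transient complexity; a run of order `T +
1/(nε²)` iterations gives the sample complexity. -/

namespace SunDSBO

open scoped InnerProductSpace

/-! ### Quadratic Taylor bounds and gradients -/

section Smooth

variable {E : Type*} [NormedAddCommGroup E] [InnerProductSpace ℝ E] [CompleteSpace E]

/-- The descent lemma: a function with `L`-Lipschitz gradient has quadratic Taylor bounds. -/
theorem abs_sub_sub_inner_gradient_le {f : E → ℝ} {L : ℝ} (hf : Differentiable ℝ f)
    (hL : ∀ z z', ‖gradient f z - gradient f z'‖ ≤ L * ‖z - z'‖) (x h : E) :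
    |f (x + h) - f x - ⟪gradient f x, h⟫_ℝ| ≤ L / 2 * ‖h‖ ^ 2 := by
  have hline : ∀ t : ℝ, HasDerivAt (fun t : ℝ => x + t • h) h t := fun t => by
    simpa using ((hasDerivAt_id t).smul_const h).const_add x
  have hder : ∀ t : ℝ, HasDerivAt (fun t : ℝ => f (x + t • h) - f x - t * ⟪gradient f x, h⟫_ℝ)
      (⟪gradient f (x + t • h), h⟫_ℝ - ⟪gradient f x, h⟫_ℝ) t := fun t => by
    have h1 := ((hf (x + t • h)).hasGradientAt.hasFDerivAt).comp_hasDerivAt t (hline t)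
    have h2 := (h1.sub_const (f x)).sub ((hasDerivAt_id t).mul_const ⟪gradient f x, h⟫_ℝ)
    exact h2.congr_deriv (by simp)
  have hB : ∀ t : ℝ, HasDerivAt (fun t : ℝ => L / 2 * ‖h‖ ^ 2 * t ^ 2) (L * t * ‖h‖ ^ 2) t :=
    fun t => ((hasDerivAt_pow 2 t).const_mul (L / 2 * ‖h‖ ^ 2)).congr_deriv (by push_cast; ring)
  -- The Taylor remainder along `t ↦ x + t • h` is compared with `L / 2 * ‖h‖ ^ 2 * t ^ 2`, whose
  -- derivative dominates that of the remainder in absolute value.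
  have key := image_norm_le_of_norm_deriv_right_le_deriv_boundary (a := 0) (b := 1)
    (fun t _ => (hder t).continuousAt.continuousWithinAt)
    (fun t _ => (hder t).hasDerivWithinAt) (by simp) hB
    (fun t ht => by
      rw [← inner_sub_left, Real.norm_eq_abs]
      calc |⟪gradient f (x + t • h) - gradient f x, h⟫_ℝ|
          ≤ ‖gradient f (x + t • h) - gradient f x‖ * ‖h‖ := abs_real_inner_le_norm _ _
        _ ≤ L * ‖x + t • h - x‖ * ‖h‖ := by gcongr; exact hL _ _
        _ = L * t * ‖h‖ ^ 2 := by
            rw [add_sub_cancel_left, norm_smul, Real.norm_of_nonneg ht.1]; ring)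
    (x := 1) (by simp)
  simpa using key

/-- A function squeezed between quadratic Taylor bounds is differentiable. -/
theorem hasGradientAt_of_abs_sub_le {f : E → ℝ} {x q : E} {C : ℝ}
    (h : ∀ h : E, |f (x + h) - f x - ⟪q, h⟫_ℝ| ≤ C * ‖h‖ ^ 2) : HasGradientAt f q x := by
  rw [hasGradientAt_iff_hasFDerivAt, hasFDerivAt_iff_isLittleO_nhds_zero]
  refine Asymptotics.IsBigO.trans_isLittleO (g := fun h : E => ‖h‖ ^ 2) ?_ ?_
  · refine Asymptotics.IsBigO.of_bound C (Filter.Eventually.of_forall fun v => ?_)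
    simpa using h v
  · simpa using (Asymptotics.isLittleO_norm_pow_id (E' := E) one_lt_two)

end Smooth

/-! ### Averages over the agents -/

section Mean

variable {E : Type*} [NormedAddCommGroup E] [InnerProductSpace ℝ E] {n : ℕ}

theorem mean_const (hn : 0 < n) (x : E) : mean (fun _ : Fin n => x) = x := by
  have : (n : ℝ) ≠ 0 := by positivity
  simp [mean, ← Nat.cast_smul_eq_nsmul ℝ, smul_smul, this]

theorem mean_add (u v : Fin n → E) : mean (fun i => u i + v i) = mean u + mean v := by
  simp [mean, Finset.sum_add_distrib]

theorem mean_sub (u v : Fin n → E) : mean (fun i => u i - v i) = mean u - mean v := by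
  simp [mean, Finset.sum_sub_distrib, smul_sub]

theorem mean_smul (c : ℝ) (u : Fin n → E) : mean (fun i => c • u i) = c • mean u := by
  simp [mean, ← Finset.smul_sum, smul_comm c]

theorem mean_map {M F : Type*} [AddCommGroup M] [Module ℝ M] [AddCommGroup F] [Module ℝ F]
    (T : M →ₗ[ℝ] F) (u : Fin n → M) :
    mean (fun i => T (u i)) = T (mean u) := by
  simp [mean]

theorem mean_mono {a b : Fin n → ℝ} (h : ∀ i, a i ≤ b i) : mean a ≤ mean b := by
  simp only [mean, smul_eq_mul]
  gcongr with i
  exact h i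

theorem mean_nonneg {a : Fin n → ℝ} (h : ∀ i, 0 ≤ a i) : 0 ≤ mean a :=
  smul_nonneg (by positivity) (Finset.sum_nonneg fun i _ => h i)

theorem mean_inner (w : E) (v : Fin n → E) : mean (fun i => ⟪w, v i⟫_ℝ) = ⟪w, mean v⟫_ℝ := by
  simp [mean, inner_smul_right, inner_sum]

theorem sum_sub_mean (hn : 0 < n) (v : Fin n → E) : ∑ i, (v i - mean v) = 0 := by
  have : (n : ℝ) ≠ 0 := by positivity
  simp [mean, ← Nat.cast_smul_eq_nsmul ℝ, smul_smul, this]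

/-- The variance decomposition. -/
theorem mean_norm_sub_mean_sq (hn : 0 < n) (v : Fin n → E) :
    mean (fun i => ‖v i - mean v‖ ^ 2) = mean (fun i => ‖v i‖ ^ 2) - ‖mean v‖ ^ 2 := by
  have h : ∀ i, ‖v i - mean v‖ ^ 2 = ‖v i‖ ^ 2 - 2 * ⟪mean v, v i⟫_ℝ + ‖mean v‖ ^ 2 := fun i => by
    rw [norm_sub_sq_real, real_inner_comm]
  simp_rw [h]
  rw [mean_add, mean_sub, mean_const hn]
  have h2 := mean_smul (n := n) 2 (fun i => ⟪mean v, v i⟫_ℝ)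
  simp only [smul_eq_mul] at h2
  rw [h2, mean_inner, real_inner_self_eq_norm_sq]
  ring

theorem norm_mean_sq_le (hn : 0 < n) (v : Fin n → E) :
    ‖mean v‖ ^ 2 ≤ mean (fun i => ‖v i‖ ^ 2) := by
  have := mean_norm_sub_mean_sq hn v
  have h2 : 0 ≤ mean (fun i => ‖v i - mean v‖ ^ 2) := mean_nonneg fun i => by positivity
  linarith

theorem mean_norm_sub_mean_sq_le (hn : 0 < n) (v : Fin n → E) :
    mean (fun i => ‖v i - mean v‖ ^ 2) ≤ mean (fun i => ‖v i‖ ^ 2) := by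
  have := mean_norm_sub_mean_sq hn v
  have := sq_nonneg ‖mean v‖
  linarith

end Mean

/-! ### Spectral contraction of the disagreement -/

section Consensus

variable {n : ℕ} {W : Matrix (Fin n) (Fin n) ℝ}

theorem connectivity_nonneg (hW : W.IsHermitian) : 0 ≤ connectivity hW := by
  unfold connectivity
  split_ifs
  · exact le_max_of_le_left (abs_nonneg _)
  · exact le_rfl

/-- Take for `i₀` the index of `λ_1`; every other eigenvalue lies between `λ_n` and `λ_2`. A second
index exists only if `n ≥ 2`, so the convention for `n = 1` does no harm. -/
theorem exists_forall_ne_abs_eigenvalues_le (hW : W.IsHermitian) (hn : 0 < n) :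
    ∃ i₀, ∀ i, i ≠ i₀ → |hW.eigenvalues i| ≤ connectivity hW := by
  -- The reindexing by which `eigenvalues` is defined from the sorted `eigenvalues₀`; hence `he` is
  -- definitional.
  let e : Fin (Fintype.card (Fin n)) ≃ Fin n := Fintype.equivOfCardEq (Fintype.card_fin _)
  have he : ∀ i, hW.eigenvalues i = hW.eigenvalues₀ (e.symm i) := fun i => rfl
  refine ⟨e (Fin.cast (Fintype.card_fin n).symm ⟨0, hn⟩), fun i hi => ?_⟩
  set j := e.symm i with hj
  have hj0 : (j : ℕ) ≠ 0 := fun h0 => hi <| by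
    rw [← e.apply_symm_apply i, ← hj]
    congr 1
    ext
    simpa using h0
  have hjn : (j : ℕ) < n := by simpa using j.2
  have h2 : 2 ≤ n := by omega
  rw [he, connectivity, dif_pos h2, sortedEigenvalue, sortedEigenvalue]
  have hlo := hW.eigenvalues₀_antitone
    (show j ≤ Fin.cast (Fintype.card_fin n).symm ⟨n - 1, by omega⟩ by
      rw [Fin.le_def]; simp; omega)
  have hhi := hW.eigenvalues₀_antitone
    (show Fin.cast (Fintype.card_fin n).symm ⟨1, by omega⟩ ≤ j by
      rw [Fin.le_def]; simp; omega)
  rw [← hj, abs_le']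
  constructor
  · exact le_max_of_le_left (hhi.trans (le_abs_self _))
  · exact le_max_of_le_right ((neg_le_neg hlo).trans (neg_le_abs _))

/-- The all-ones vector is fixed by `W`, whereas each eigenvector other than `b i₀` has an
eigenvalue of modulus at most `ρ < 1` and is therefore orthogonal to it. So the all-ones vector is a
nonzero multiple of `b i₀`, a vector of sum zero has no component along `b i₀`, and its other
coordinates shrink by `ρ`. No separate argument on the simplicity of the eigenvalue `1` is needed.
-/
theorem sum_sq_mulVec_le (hW : W.IsHermitian) (hD : W ∈ doublyStochastic ℝ (Fin n))
    (hρ : connectivity hW < 1) (v : Fin n → ℝ) (hv : ∑ i, v i = 0) :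
    ∑ i, (∑ j, W i j * v j) ^ 2 ≤ connectivity hW ^ 2 * ∑ i, v i ^ 2 := by
  rcases Nat.eq_zero_or_pos n with rfl | hn
  · simp
  obtain ⟨i₀, hi₀⟩ := exists_forall_ne_abs_eigenvalues_le hW hn
  set b := hW.eigenvectorBasis with hb
  have hT : W.transpose = W := by rw [← Matrix.conjTranspose_eq_transpose_of_trivial]; exact hW
  have hsym : ∀ (i : Fin n) (w : Fin n → ℝ),
      ⟪b i, WithLp.toLp 2 (W.mulVec w)⟫_ℝ = hW.eigenvalues i * ⟪b i, WithLp.toLp 2 w⟫_ℝ := by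
    intro i w
    have h1 := hW.mulVec_eigenvectorBasis i
    rw [EuclideanSpace.inner_eq_star_dotProduct, EuclideanSpace.inner_eq_star_dotProduct]
    simp only [star_trivial]
    rw [dotProduct_comm, Matrix.dotProduct_mulVec, ← Matrix.mulVec_transpose, hT, h1,
      smul_dotProduct, smul_eq_mul, dotProduct_comm]
  set o : EuclideanSpace ℝ (Fin n) := WithLp.toLp 2 (fun _ => (1 : ℝ)) with ho
  have hWo : W.mulVec (fun _ => (1 : ℝ)) = fun _ => 1 := by
    ext i
    simpa [Matrix.mulVec, dotProduct] using sum_row_of_mem_doublyStochastic hD i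
  have hbo : ∀ i, i ≠ i₀ → ⟪b i, o⟫_ℝ = 0 := by
    intro i hi
    have h1 := hsym i (fun _ => 1)
    rw [hWo] at h1
    have h2 := abs_le.1 (hi₀ i hi)
    have h3 : (1 - hW.eigenvalues i) * ⟪b i, o⟫_ℝ = 0 := by rw [ho]; linarith
    rcases mul_eq_zero.1 h3 with h | h
    · linarith
    · exact h
  have ho0 : ⟪b i₀, o⟫_ℝ ≠ 0 := by
    intro h0
    have : o = 0 := by
      have h1 := b.sum_sq_norm_inner_right o
      rw [Finset.sum_eq_zero fun i _ => ?_] at h1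
      · simpa using h1.symm
      · by_cases hi : i = i₀
        · rw [hi, h0]; simp
        · rw [hbo i hi]; simp
    have h1 := congrArg (fun w : EuclideanSpace ℝ (Fin n) => w ⟨0, hn⟩) this
    simp [ho] at h1
  have hv0 : ⟪b i₀, WithLp.toLp 2 v⟫_ℝ = 0 := by
    have h1 : ⟪o, WithLp.toLp 2 v⟫_ℝ = 0 := by
      rw [EuclideanSpace.inner_eq_star_dotProduct]
      simpa [ho, dotProduct] using hv
    rw [← b.sum_inner_mul_inner, Finset.sum_eq_single i₀] at h1
    · rcases mul_eq_zero.1 h1 with h | h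
      · rw [real_inner_comm] at h; exact absurd h ho0
      · exact h
    · intro i _ hi
      rw [real_inner_comm, hbo i hi, zero_mul]
    · simp
  have e1 : ∀ w : Fin n → ℝ, ∑ i, w i ^ 2 = ∑ i, ⟪b i, WithLp.toLp 2 w⟫_ℝ ^ 2 := by
    intro w
    have := b.sum_sq_norm_inner_right (WithLp.toLp 2 w)
    simp only [Real.norm_eq_abs, sq_abs] at this
    rw [this, EuclideanSpace.norm_sq_eq]
    simp
  have e2 := e1 (W.mulVec v)
  simp only [Matrix.mulVec, dotProduct] at e2
  rw [e2, e1 v, Finset.mul_sum]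
  refine Finset.sum_le_sum fun i _ => ?_
  rw [hsym i v, mul_pow]
  by_cases hi : i = i₀
  · rw [hi, hv0]; simp
  · gcongr 1
    rw [← sq_abs]
    gcongr
    exact hi₀ i hi

/-- Averaging through `W` contracts disagreement by the factor `ρ`. -/
theorem mean_norm_sum_smul_sq_le {E : Type*} [NormedAddCommGroup E] [InnerProductSpace ℝ E]
    [FiniteDimensional ℝ E] (hW : W.IsHermitian) (hD : W ∈ doublyStochastic ℝ (Fin n))
    (hρ : connectivity hW < 1) (v : Fin n → E) (hv : ∑ i, v i = 0) :
    mean (fun i => ‖∑ j, W i j • v j‖ ^ 2) ≤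
      connectivity hW ^ 2 * mean (fun i => ‖v i‖ ^ 2) := by
  -- The scalar contraction is applied to each coordinate in an orthonormal basis.
  let e := stdOrthonormalBasis ℝ E
  have hnorm : ∀ x : E, ‖x‖ ^ 2 = ∑ a, ⟪e a, x⟫_ℝ ^ 2 := fun x => by
    have := e.sum_sq_norm_inner_right x
    simpa only [Real.norm_eq_abs, sq_abs] using this.symm
  simp only [mean, smul_eq_mul]
  rw [mul_left_comm]
  gcongr
  simp_rw [hnorm]
  rw [Finset.sum_comm, Finset.sum_comm (s := Finset.univ (α := Fin n)), Finset.mul_sum]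
  refine Finset.sum_le_sum fun a _ => ?_
  have := sum_sq_mulVec_le hW hD hρ (fun i => ⟪e a, v i⟫_ℝ) (by rw [← inner_sum, hv, inner_zero_right])
  simpa [inner_sum, inner_smul_right] using this

theorem mean_sum_smul {E : Type*} [NormedAddCommGroup E] [InnerProductSpace ℝ E]
    (hD : W ∈ doublyStochastic ℝ (Fin n)) (v : Fin n → E) :
    mean (fun i => ∑ j, W i j • v j) = mean v := by
  simp only [mean]
  rw [Finset.sum_comm]
  simp_rw [← Finset.sum_smul, sum_col_of_mem_doublyStochastic hD, one_smul]

end Consensus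

/-! ### Elementary inequalities for squared norms -/

theorem norm_add_three_sq_le {E : Type*} [SeminormedAddCommGroup E] (a b c : E) :
    ‖a + b + c‖ ^ 2 ≤ 3 * (‖a‖ ^ 2 + ‖b‖ ^ 2 + ‖c‖ ^ 2) := by
  have h := (norm_add_le (a + b) c).trans (add_le_add_left (norm_add_le a b) ‖c‖)
  calc ‖a + b + c‖ ^ 2 ≤ (‖a‖ + ‖b‖ + ‖c‖) ^ 2 := by gcongr
    _ ≤ _ := by nlinarith [sq_nonneg (‖a‖ - ‖b‖), sq_nonneg (‖b‖ - ‖c‖), sq_nonneg (‖a‖ - ‖c‖)]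

theorem norm_add_sq_le_two {E : Type*} [SeminormedAddCommGroup E] (a b : E) : ‖a + b‖ ^ 2 ≤ 2 * (‖a‖ ^ 2 + ‖b‖ ^ 2) := by
  calc ‖a + b‖ ^ 2 ≤ (‖a‖ + ‖b‖) ^ 2 := by gcongr; exact norm_add_le _ _
    _ ≤ _ := by nlinarith [sq_nonneg (‖a‖ - ‖b‖)]

/-- Young's inequality with weights `ρ` and `1 - ρ`. Giving up one factor `ρ` on `a` leaves the
contraction gap `1 - ρ`, at the price `1 / (1 - ρ)` on `b`. The completed square in `h4` avoids
dividing by `ρ`, which may be zero. -/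
theorem mul_norm_add_sq_le {E : Type*} [SeminormedAddCommGroup E] {ρ : ℝ} (h0 : 0 ≤ ρ) (h1 : ρ < 1) (a b : E) :
    ρ ^ 2 * ‖a + b‖ ^ 2 ≤ ρ * ‖a‖ ^ 2 + ‖b‖ ^ 2 / (1 - ρ) := by
  have h2 : 0 < 1 - ρ := by linarith
  have h3 : ρ ^ 2 * ‖a + b‖ ^ 2 ≤ ρ ^ 2 * (‖a‖ + ‖b‖) ^ 2 := by gcongr; exact norm_add_le _ _
  refine h3.trans ?_
  have h4 : ρ * ‖a‖ ^ 2 + ‖b‖ ^ 2 / (1 - ρ) - ρ ^ 2 * (‖a‖ + ‖b‖) ^ 2 =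
      (ρ * ((1 - ρ) * ‖a‖ - ρ * ‖b‖) ^ 2 + (1 - ρ) * (1 + ρ) * ‖b‖ ^ 2 * 1 +
        ρ ^ 2 * (1 - ρ) * ‖b‖ ^ 2 * 0 + 0) / (1 - ρ) := by
    field_simp; ring
  have h5 : 0 ≤ ρ * ‖a‖ ^ 2 + ‖b‖ ^ 2 / (1 - ρ) - ρ ^ 2 * (‖a‖ + ‖b‖) ^ 2 := by
    rw [h4]; positivity
  linarith

/-! ### One step of decentralized descent, pathwise in the noise -/

section OneStep

variable {E : Type*} [NormedAddCommGroup E] [InnerProductSpace ℝ E] {n : ℕ}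

/-- The disagreement `(1/n) ∑ ‖s_i - s̄‖²` of the agents. -/
noncomputable def dispersion (s : Fin n → E) : ℝ := mean fun i => ‖s i - mean s‖ ^ 2

/-- A step along the directions `D`, followed by averaging with the neighbours. -/
def mixStep (W : Matrix (Fin n) (Fin n) ℝ) (lam : ℝ) (s D : Fin n → E) (i : Fin n) : E :=
  ∑ j, W i j • (s j - lam • D j)

/-- A sequence of potentials `Φ k` with quadratic upper bounds, decreasing in `k`, and local
directions `d k i` that are Lipschitz, similar to each other, and whose average is aligned with the
gradient `q k` of the potential. -/
structure PotentialFlow (Φ : ℕ → E → ℝ) (q : ℕ → E → E) (d : ℕ → Fin n → E → E)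
    (L C l σ2 : ℝ) : Prop where
  L_nonneg : 0 ≤ L
  one_le_C : 1 ≤ C
  l_nonneg : 0 ≤ l
  σ2_nonneg : 0 ≤ σ2
  nonneg : ∀ k s, 0 ≤ Φ k s
  anti : ∀ k s, Φ (k + 1) s ≤ Φ k s
  smooth : ∀ k s h, Φ k (s + h) ≤ Φ k s + ⟪q k s, h⟫_ℝ + L / 2 * ‖h‖ ^ 2
  lip : ∀ k i s s', ‖d k i s - d k i s'‖ ≤ l * ‖s - s'‖
  dissim : ∀ k s, mean (fun i => ‖d k i s - mean (fun j => d k j s)‖ ^ 2) ≤ σ2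
  align_q : ∀ k s, ‖q k s‖ ^ 2 ≤ C * ⟪q k s, mean fun i => d k i s⟫_ℝ
  align_d : ∀ k s, ‖mean fun i => d k i s‖ ^ 2 ≤ C * ⟪q k s, mean fun i => d k i s⟫_ℝ

theorem dispersion_nonneg (s : Fin n → E) : 0 ≤ dispersion s :=
  mean_nonneg fun _ => by positivity

theorem mean_mixStep {W : Matrix (Fin n) (Fin n) ℝ} (hD : W ∈ doublyStochastic ℝ (Fin n))
    (lam : ℝ) (s D : Fin n → E) : mean (mixStep W lam s D) = mean s - lam • mean D := by
  have := mean_sum_smul hD (fun j => s j - lam • D j)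
  rw [mean_sub, mean_smul] at this
  exact this

namespace PotentialFlow

variable {Φ : ℕ → E → ℝ} {q : ℕ → E → E} {d : ℕ → Fin n → E → E} {L C l σ2 : ℝ}

theorem align_nonneg (hP : PotentialFlow Φ q d L C l σ2) (k : ℕ) (s : E) :
    0 ≤ ⟪q k s, mean fun i => d k i s⟫_ℝ := by
  have h1 := hP.align_q k s
  have h2 := hP.one_le_C
  by_contra! h
  nlinarith [sq_nonneg ‖q k s‖]

theorem mean_norm_lip_sq_le (hP : PotentialFlow Φ q d L C l σ2) (k : ℕ) (s : Fin n → E) :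
    mean (fun i => ‖d k i (s i) - d k i (mean s)‖ ^ 2) ≤ l ^ 2 * dispersion s := by
  rw [dispersion, ← smul_eq_mul, ← mean_smul]
  refine mean_mono fun i => ?_
  rw [smul_eq_mul, ← mul_pow]
  gcongr
  exact hP.lip k i _ _

/-- The average moves along `b + r + mean N`: the averaged direction at the mean, the error of
evaluating at scattered points, and the noise. Of the gain `lam * P` one quarter pays for `⟪Q, r⟫`
by Young's inequality and one quarter for the second-order term, by `6 * L * C * lam ≤ 1`; each also
costs at most `lam * C * ‖r‖ ^ 2`. -/
theorem potential_step_le (hP : PotentialFlow Φ q d L C l σ2) (hn : 0 < n) {lam : ℝ}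
    (hlam : 0 ≤ lam) (hlam1 : 6 * L * C * lam ≤ 1) (k : ℕ) (s N : Fin n → E) :
    Φ (k + 1) (mean s - lam • mean fun i => d k i (s i) + N i) ≤
      Φ k (mean s) - lam / 2 * ⟪q k (mean s), mean fun i => d k i (mean s)⟫_ℝ
        + 2 * C * l ^ 2 * lam * dispersion s - lam * ⟪q k (mean s), mean N⟫_ℝ
        + 3 / 2 * L * lam ^ 2 * ‖mean N‖ ^ 2 := by
  have hC := hP.one_le_C
  have hL := hP.L_nonneg
  set m := mean s with hm
  set Q := q k m
  set b := mean fun i => d k i m with hb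
  set r := mean fun i => d k i (s i) - d k i m with hr
  set P := ⟪Q, b⟫_ℝ with hPdef
  have hsum : (mean fun i => d k i (s i) + N i) = b + r + mean N := by
    rw [hb, hr, mean_add, mean_sub]; abel
  have hr2 : ‖r‖ ^ 2 ≤ l ^ 2 * dispersion s :=
    (norm_mean_sq_le hn _).trans (hP.mean_norm_lip_sq_le k s)
  have hq2 : ‖Q‖ ^ 2 ≤ C * P := hP.align_q k m
  have hd2 : ‖b‖ ^ 2 ≤ C * P := hP.align_d k m
  have h1 := (hP.anti k (m - lam • (b + r + mean N))).trans
    ((congrArg _ (sub_eq_add_neg _ _)).trans_le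
      (hP.smooth k m (-(lam • (b + r + mean N)))))
  rw [hsum]
  refine h1.trans ?_
  have h2 : ⟪Q, lam • (b + r + mean N)⟫_ℝ = lam * (P + ⟪Q, r⟫_ℝ + ⟪Q, mean N⟫_ℝ) := by
    rw [inner_smul_right, inner_add_right, inner_add_right]
  have h3 : ‖lam • (b + r + mean N)‖ ^ 2 ≤
      lam ^ 2 * (3 * (C * P + ‖r‖ ^ 2 + ‖mean N‖ ^ 2)) := by
    rw [norm_smul, mul_pow, Real.norm_eq_abs, sq_abs]
    gcongr
    exact (norm_add_three_sq_le _ _ _).trans (by gcongr)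
  have h4 : -⟪Q, r⟫_ℝ ≤ P / 4 + C * ‖r‖ ^ 2 := by
    have h5 : -⟪Q, r⟫_ℝ ≤ ‖Q‖ * ‖r‖ := (neg_le_abs _).trans (abs_real_inner_le_norm _ _)
    have h6 : C * (‖Q‖ * ‖r‖) ≤ C * (P / 4 + C * ‖r‖ ^ 2) := by
      nlinarith [sq_nonneg (‖Q‖ / 2 - C * ‖r‖)]
    exact h5.trans (le_of_mul_le_mul_left h6 (by linarith))
  have hPn : 0 ≤ P := hP.align_nonneg k m
  have h7 : L / 2 * ‖lam • (b + r + mean N)‖ ^ 2 ≤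
      lam / 4 * P + lam * C * ‖r‖ ^ 2 + 3 / 2 * L * lam ^ 2 * ‖mean N‖ ^ 2 := by
    have h8 : L / 2 * ‖lam • (b + r + mean N)‖ ^ 2 ≤
      L / 2 * (lam ^ 2 * (3 * (C * P + ‖r‖ ^ 2 + ‖mean N‖ ^ 2))) := by gcongr
    have h9 : (6 * L * C * lam) * (lam / 4 * P) ≤ 1 * (lam / 4 * P) := by gcongr
    have h11 : L * lam * 6 ≤ C := by nlinarith [mul_nonneg hL hlam]
    have h10 : (L * lam * 6) * (lam / 4 * ‖r‖ ^ 2) ≤ C * (lam / 4 * ‖r‖ ^ 2) := by gcongr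
    have : 0 ≤ C * lam * ‖r‖ ^ 2 := by positivity
    nlinarith
  have h8 : lam * C * ‖r‖ ^ 2 ≤ lam * C * (l ^ 2 * dispersion s) := by gcongr
  have h9 : lam * -⟪Q, r⟫_ℝ ≤ lam * (P / 4 + C * ‖r‖ ^ 2) := by gcongr
  rw [inner_neg_right, norm_neg, h2]
  linarith

/-- Only the noise-free displacement `a` pays the factor `1 / (1 - ρ)` of Young's inequality; the
noise is expanded exactly. The coefficients `c` are chosen before `N` and depend on the state alone,
so that the linear term has zero expectation for centred noise. -/
theorem dispersion_step_le [FiniteDimensional ℝ E] (hP : PotentialFlow Φ q d L C l σ2)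
    (hn : 0 < n) {W : Matrix (Fin n) (Fin n) ℝ} (hW : W.IsHermitian)
    (hD : W ∈ doublyStochastic ℝ (Fin n)) (hρ : connectivity hW < 1) {lam : ℝ}
    (k : ℕ) (s : Fin n → E) :
    ∃ c : Fin n → E, ∀ N : Fin n → E,
      dispersion (mixStep W lam s fun i => d k i (s i) + N i) ≤
        connectivity hW * dispersion s
          + 2 * lam ^ 2 / (1 - connectivity hW) * (l ^ 2 * dispersion s + σ2)
          + mean (fun i => ⟪c i, N i⟫_ℝ) + lam ^ 2 * mean (fun i => ‖N i‖ ^ 2) := by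
  set ρ := connectivity hW with hρdef
  have hρ0 : 0 ≤ ρ := connectivity_nonneg hW
  set dm := mean fun i => d k i (s i) with hdm
  set a : Fin n → E := fun i => (s i - mean s) - lam • (d k i (s i) - dm) with ha
  -- The cross term of `‖a i - lam • (N i - mean N)‖ ^ 2`, multiplied by `ρ ^ 2`; after averaging,
  -- the centring moves from `N` to `a`.
  refine ⟨fun i => (-(2 * ρ ^ 2 * lam)) • (a i - mean a), fun N => ?_⟩
  set v : Fin n → E := fun i => a i - lam • (N i - mean N) with hv
  have hstep : ∀ i, mixStep W lam s (fun i => d k i (s i) + N i) i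
      - mean (mixStep W lam s fun i => d k i (s i) + N i) = ∑ j, W i j • v j := by
    intro i
    have h1 : ∀ j, v j = (s j - lam • (d k j (s j) + N j))
        - (mean s - lam • (dm + mean N)) := fun j => by
      simp only [hv, ha, smul_sub, smul_add]; abel
    simp_rw [h1, smul_sub, Finset.sum_sub_distrib, ← Finset.sum_smul,
      sum_row_of_mem_doublyStochastic hD, one_smul]
    rw [mean_mixStep hD, mean_add]
    simp [mixStep, smul_sub, Finset.sum_sub_distrib]
    rfl
  have hv0 : ∑ i, v i = 0 := by
    simp only [hv, ha, Finset.sum_sub_distrib, ← Finset.smul_sum]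
    have h1 := sum_sub_mean hn s
    have h2 := sum_sub_mean hn N
    have h3 := sum_sub_mean hn (fun i => d k i (s i))
    simp only [Finset.sum_sub_distrib] at h1 h2 h3
    rw [← hdm] at h3
    rw [h1, h2, h3]; simp
  have h1 : dispersion (mixStep W lam s fun i => d k i (s i) + N i) ≤
      ρ ^ 2 * mean (fun i => ‖v i‖ ^ 2) := by
    rw [dispersion]
    simp_rw [hstep]
    exact mean_norm_sum_smul_sq_le hW hD hρ v hv0
  have hexp : mean (fun i => ‖v i‖ ^ 2) = mean (fun i => ‖a i‖ ^ 2)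
      - 2 * lam * mean (fun i => ⟪a i - mean a, N i⟫_ℝ)
      + lam ^ 2 * mean (fun i => ‖N i - mean N‖ ^ 2) := by
    have e1 : ∀ i, ‖v i‖ ^ 2 = ‖a i‖ ^ 2 - (2 * lam) • ⟪a i, N i - mean N⟫_ℝ
        + (lam ^ 2) • ‖N i - mean N‖ ^ 2 := fun i => by
      rw [hv, norm_sub_sq_real, inner_smul_right, norm_smul, mul_pow, Real.norm_eq_abs, sq_abs,
        smul_eq_mul, smul_eq_mul]
      ring
    simp_rw [e1]
    rw [mean_add, mean_sub, mean_smul, mean_smul]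
    simp only [smul_eq_mul, inner_sub_right, inner_sub_left]
    rw [mean_sub, mean_sub, mean_inner]
    have e2 : mean (fun i => ⟪a i, mean N⟫_ℝ) = ⟪mean a, mean N⟫_ℝ := by
      simp_rw [real_inner_comm (mean N)]
      rw [mean_inner, real_inner_comm]
    rw [e2]
  have hvar := mean_norm_sub_mean_sq_le hn N
  -- Directions differ because they are evaluated at different points (Lipschitz part `e`) and
  -- because the agents differ at the common point `mean s` (`σ2`).
  have hda : mean (fun i => ‖d k i (s i) - dm‖ ^ 2) ≤ 2 * (l ^ 2 * dispersion s + σ2) := by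
    set b := mean fun i => d k i (mean s)
    set e : Fin n → E := fun i => d k i (s i) - d k i (mean s) with he
    have e1 : ∀ i, d k i (s i) - dm = (e i - mean e) + (d k i (mean s) - b) := fun i => by
      rw [he, mean_sub]; simp only [hdm]; abel
    simp_rw [e1]
    calc mean (fun i => ‖(e i - mean e) + (d k i (mean s) - b)‖ ^ 2)
        ≤ mean (fun i => (2 : ℝ) • (‖e i - mean e‖ ^ 2 + ‖d k i (mean s) - b‖ ^ 2)) :=
          mean_mono fun i => by rw [smul_eq_mul]; exact norm_add_sq_le_two _ _
      _ = 2 * (mean (fun i => ‖e i - mean e‖ ^ 2) + mean (fun i => ‖d k i (mean s) - b‖ ^ 2)) := by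
          rw [mean_smul, mean_add, smul_eq_mul]
      _ ≤ _ := by
          gcongr
          · exact (mean_norm_sub_mean_sq_le hn e).trans (hP.mean_norm_lip_sq_le k s)
          · exact hP.dissim k _
  have h1ρ : 0 < 1 - ρ := by linarith
  have ha2 : ρ ^ 2 * mean (fun i => ‖a i‖ ^ 2) ≤ ρ * dispersion s
      + 2 * lam ^ 2 / (1 - ρ) * (l ^ 2 * dispersion s + σ2) := by
    calc ρ ^ 2 * mean (fun i => ‖a i‖ ^ 2)
        = mean (fun i => ρ ^ 2 • ‖a i‖ ^ 2) := by rw [mean_smul, smul_eq_mul]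
      _ ≤ mean (fun i => ρ • ‖s i - mean s‖ ^ 2 + (lam ^ 2 / (1 - ρ)) • ‖d k i (s i) - dm‖ ^ 2) := by
          refine mean_mono fun i => ?_
          have := mul_norm_add_sq_le hρ0 hρ (s i - mean s) (-(lam • (d k i (s i) - dm)))
          rw [← sub_eq_add_neg, norm_neg, norm_smul, mul_pow, Real.norm_eq_abs, sq_abs] at this
          simp only [smul_eq_mul, ha]
          rw [div_mul_eq_mul_div]
          exact this
      _ = ρ * dispersion s + lam ^ 2 / (1 - ρ) * mean (fun i => ‖d k i (s i) - dm‖ ^ 2) := by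
          rw [mean_add, mean_smul, mean_smul]; rfl
      _ ≤ ρ * dispersion s + lam ^ 2 / (1 - ρ) * (2 * (l ^ 2 * dispersion s + σ2)) := by gcongr
      _ = _ := by ring
  have hlin : mean (fun i => ⟪(-(2 * ρ ^ 2 * lam)) • (a i - mean a), N i⟫_ℝ)
      = -(2 * ρ ^ 2 * lam) * mean (fun i => ⟪a i - mean a, N i⟫_ℝ) := by
    simp_rw [real_inner_smul_left, ← smul_eq_mul]
    rw [mean_smul]
  have hρ1 : ρ ^ 2 ≤ 1 := by nlinarith
  have hN0 : 0 ≤ mean (fun i => ‖N i‖ ^ 2) := mean_nonneg fun i => by positivity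
  have hlast : ρ ^ 2 * (lam ^ 2 * mean (fun i => ‖N i - mean N‖ ^ 2)) ≤
      1 * (lam ^ 2 * mean (fun i => ‖N i‖ ^ 2)) :=
    mul_le_mul hρ1 (by gcongr)
      (mul_nonneg (sq_nonneg _) (mean_nonneg fun i => by positivity)) zero_le_one
  rw [hlin]
  rw [hexp] at h1
  nlinarith

/-- The Lyapunov function: the potential at the average, plus the weighted disagreement. -/
noncomputable def lyapunov (Φ : ℕ → E → ℝ) (w : ℝ) (k : ℕ) (s : Fin n → E) : ℝ :=
  Φ k (mean s) + w * dispersion s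

/-- The weight `4 C l² lam / (1 - ρ)` turns the contraction gap into a decrease of `4 C l² lam`
times the dispersion. Half of it cancels the dispersion term of `potential_step_le`; the other half
absorbs the growth `w * 2 lam² l² / (1 - ρ)`, which is that half times `(2 l lam / (1 - ρ))² ≤ 1`.
-/
theorem lyapunov_step_le [FiniteDimensional ℝ E] (hP : PotentialFlow Φ q d L C l σ2)
    (hn : 0 < n) {W : Matrix (Fin n) (Fin n) ℝ} (hW : W.IsHermitian)
    (hD : W ∈ doublyStochastic ℝ (Fin n)) (hρ : connectivity hW < 1) {lam : ℝ}
    (hlam : 0 ≤ lam) (hlam1 : 6 * L * C * lam ≤ 1) (hlam2 : 2 * l * lam ≤ 1 - connectivity hW)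
    (k : ℕ) (s : Fin n → E) :
    ∃ c : Fin n → E, ∀ N : Fin n → E,
      lyapunov Φ (4 * C * l ^ 2 * lam / (1 - connectivity hW)) (k + 1)
          (mixStep W lam s fun i => d k i (s i) + N i) ≤
        lyapunov Φ (4 * C * l ^ 2 * lam / (1 - connectivity hW)) k s
          - lam / 2 * ⟪q k (mean s), mean fun i => d k i (mean s)⟫_ℝ
          + 8 * C * l ^ 2 * lam ^ 3 * σ2 / (1 - connectivity hW) ^ 2
          + mean (fun i => ⟪c i, N i⟫_ℝ) + 3 / 2 * L * lam ^ 2 * ‖mean N‖ ^ 2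
          + 4 * C * l ^ 2 * lam ^ 3 / (1 - connectivity hW) * mean (fun i => ‖N i‖ ^ 2) := by
  obtain ⟨c, hc⟩ := hP.dispersion_step_le hn hW hD hρ (lam := lam) k s
  set ρ := connectivity hW with hρdef
  have hC := hP.one_le_C
  have h1ρ : 0 < 1 - ρ := by linarith
  set w := 4 * C * l ^ 2 * lam / (1 - ρ) with hw
  have hw0 : 0 ≤ w := by positivity
  refine ⟨fun i => w • c i - lam • q k (mean s), fun N => ?_⟩
  have h1 := hP.potential_step_le hn hlam hlam1 k s N
  have h2 := mul_le_mul_of_nonneg_left (hc N) hw0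
  have hlin : mean (fun i => ⟪w • c i - lam • q k (mean s), N i⟫_ℝ)
      = w * mean (fun i => ⟪c i, N i⟫_ℝ) - lam * ⟪q k (mean s), mean N⟫_ℝ := by
    simp_rw [inner_sub_left, real_inner_smul_left, ← smul_eq_mul]
    rw [mean_sub, mean_smul, mean_smul, mean_inner]
  rw [lyapunov, lyapunov, mean_mixStep hD, hlin]
  have hΔ := dispersion_nonneg s
  have e1 : w * (ρ * dispersion s) = w * dispersion s - 4 * C * l ^ 2 * lam * dispersion s := by
    rw [hw]; field_simp; ring
  have e2 : w * (2 * lam ^ 2 / (1 - ρ) * (l ^ 2 * dispersion s)) ≤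
      2 * C * l ^ 2 * lam * dispersion s := by
    have e3 : w * (2 * lam ^ 2 / (1 - ρ) * (l ^ 2 * dispersion s)) =
        2 * C * l ^ 2 * lam * dispersion s * (2 * l * lam / (1 - ρ)) ^ 2 := by
      rw [hw]; field_simp; ring
    rw [e3]
    have hl := hP.l_nonneg
    have e4 : 2 * l * lam / (1 - ρ) ≤ 1 := (div_le_one h1ρ).2 hlam2
    have e5 : (2 * l * lam / (1 - ρ)) ^ 2 ≤ 1 := pow_le_one₀ (by positivity) e4
    exact mul_le_of_le_one_right (by positivity) e5
  have e6 : w * (2 * lam ^ 2 / (1 - ρ) * σ2) = 8 * C * l ^ 2 * lam ^ 3 * σ2 / (1 - ρ) ^ 2 := by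
    rw [hw]; field_simp; ring
  have e7 : w * (lam ^ 2 * mean fun i => ‖N i‖ ^ 2) =
      4 * C * l ^ 2 * lam ^ 3 / (1 - ρ) * mean fun i => ‖N i‖ ^ 2 := by
    rw [hw]; ring
  rw [mul_add, mul_add, mul_add, mul_add, mul_add, e1, e6, e7] at h2
  linarith

end PotentialFlow

end OneStep

/-! ### Moments of independent centred noise -/

section Expectation

variable {E : Type*} [NormedAddCommGroup E] [InnerProductSpace ℝ E] [FiniteDimensional ℝ E]
  [MeasurableSpace E] [BorelSpace E] {n : ℕ} {Ω : Type*} [MeasurableSpace Ω] {P : Measure Ω}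

theorem memLp_two_of_lintegral_le {F : Type*} [NormedAddCommGroup F] {f : Ω → F} {v : ℝ}
    (hf : AEStronglyMeasurable f P) (hv : ∫⁻ ω, ‖f ω‖ₑ ^ 2 ∂P ≤ ENNReal.ofReal v) :
    MemLp f 2 P := by
  refine ⟨hf, ?_⟩
  rw [eLpNorm_lt_top_iff_lintegral_rpow_enorm_lt_top (by simp) (by simp)]
  simpa using hv.trans_lt ENNReal.ofReal_lt_top

theorem integral_norm_sq_le_of_lintegral_le {F : Type*} [NormedAddCommGroup F] {f : Ω → F} {v : ℝ}
    (hv0 : 0 ≤ v) (hf : AEStronglyMeasurable f P)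
    (hv : ∫⁻ ω, ‖f ω‖ₑ ^ 2 ∂P ≤ ENNReal.ofReal v) : ∫ ω, ‖f ω‖ ^ 2 ∂P ≤ v := by
  rw [integral_eq_lintegral_of_nonneg_ae (f := fun ω => ‖f ω‖ ^ 2)
    (Filter.Eventually.of_forall fun ω => by positivity) (hf.norm.pow 2)]
  refine ENNReal.toReal_le_of_le_ofReal hv0 (le_trans (le_of_eq ?_) hv)
  refine lintegral_congr fun ω => ?_
  rw [ENNReal.ofReal_pow (norm_nonneg _), ofReal_norm]

theorem integrable_inner_of_memLp_two {F : Type*} [NormedAddCommGroup F] [InnerProductSpace ℝ F]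
    {X Y : Ω → F} (hX : MemLp X 2 P) (hY : MemLp Y 2 P) :
    Integrable (fun ω => ⟪X ω, Y ω⟫_ℝ) P :=
  (hX.norm.integrable_mul hY.norm).mono' (hX.1.inner hY.1)
    (Filter.Eventually.of_forall fun _ => norm_inner_le_norm _ _)

theorem integral_inner_eq_zero_of_indepFun {X Y : Ω → E} (hX : Integrable X P)
    (hY : Integrable Y P) (hXY : IndepFun X Y P) (hX0 : ∫ ω, X ω ∂P = 0) :
    ∫ ω, ⟪X ω, Y ω⟫_ℝ ∂P = 0 := by
  have := hXY.integral_bilin hX hY (innerSL ℝ)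
  rw [hX0, map_zero] at this
  exact this

/-- The mean of independent centred noises has its variance reduced by the factor `n`. -/
theorem integral_norm_mean_sq_le (hn : 0 < n) {N : Fin n → Ω → E} {v : ℝ}
    (hN : ∀ i, MemLp (N i) 2 P) [IsFiniteMeasure P] (h0 : ∀ i, ∫ ω, N i ω ∂P = 0)
    (hind : ∀ i j, i ≠ j → IndepFun (N i) (N j) P) (hv : ∀ i, ∫ ω, ‖N i ω‖ ^ 2 ∂P ≤ v) :
    ∫ ω, ‖mean fun i => N i ω‖ ^ 2 ∂P ≤ v / n := by
  have hi : ∀ i, Integrable (N i) P := fun i => (hN i).integrable one_le_two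
  have hexp : ∀ ω, ‖mean fun i => N i ω‖ ^ 2 =
      ((n : ℝ)⁻¹) ^ 2 * ∑ i, ∑ j, ⟪N i ω, N j ω⟫_ℝ := fun ω => by
    rw [mean, norm_smul, mul_pow, ← real_inner_self_eq_norm_sq (∑ i, N i ω), sum_inner]
    simp_rw [inner_sum]
    rw [norm_inv, Real.norm_natCast]
  simp_rw [hexp]
  rw [integral_const_mul, integral_finsetSum _ fun i _ => integrable_finsetSum _ fun j _ =>
    integrable_inner_of_memLp_two (hN i) (hN j)]
  -- Independence and centring kill the off-diagonal terms, so each row of the double sum keeps one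
  -- variance; this is the source of the linear speedup.
  have h1 : ∀ i, ∫ ω, ∑ j, ⟪N i ω, N j ω⟫_ℝ ∂P ≤ v := fun i => by
    rw [integral_finsetSum _ fun j _ => integrable_inner_of_memLp_two (hN i) (hN j),
      Finset.sum_eq_single i]
    · simpa [real_inner_self_eq_norm_sq] using hv i
    · exact fun j _ hj =>
        integral_inner_eq_zero_of_indepFun (hi i) (hi j) (hind i j hj.symm) (h0 i)
    · simp
  have hn' : (0 : ℝ) < n := by exact_mod_cast hn
  calc ((n : ℝ)⁻¹) ^ 2 * ∑ i, ∫ ω, ∑ j, ⟪N i ω, N j ω⟫_ℝ ∂P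
      ≤ ((n : ℝ)⁻¹) ^ 2 * ∑ _i : Fin n, v := by gcongr with i; exact h1 i
    _ = v / n := by simp; field_simp

end Expectation

/-! ### The Lyapunov recursion in expectation -/

section Recursion

variable {E : Type*} [NormedAddCommGroup E] [InnerProductSpace ℝ E] [FiniteDimensional ℝ E]
  [MeasurableSpace E] [BorelSpace E] {n : ℕ} {Ω Ξ : Type*} [MeasurableSpace Ω] [MeasurableSpace Ξ]

/-- Independent samples `X (k, i)`, and unbiased stochastic directions `D k i` with mean `d k i` and
variance at most `v`. -/
structure StochasticOracle (P : Measure Ω) (X : ℕ × Fin n → Ω → Ξ) (D : ℕ → Fin n → E → Ξ → E)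
    (d : ℕ → Fin n → E → E) (v : ℝ) : Prop where
  isProb : IsProbabilityMeasure P
  v_nonneg : 0 ≤ v
  measurable_sample : ∀ a, Measurable (X a)
  indep : iIndepFun X P
  measurable_dir : ∀ k i, Measurable fun p : E × Ξ => D k i p.1 p.2
  integrable : ∀ k i s, Integrable (fun ω => D k i s (X (k, i) ω)) P
  unbiased : ∀ k i s, ∫ ω, D k i s (X (k, i) ω) ∂P = d k i s
  variance : ∀ k i s, ∫⁻ ω, ‖D k i s (X (k, i) ω) - d k i s‖ₑ ^ 2 ∂P ≤ ENNReal.ofReal v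

/-- The noise level of one step in the Lyapunov inequality. -/
noncomputable def noiseLevel (n : ℕ) (ρ lam L C l σ2 v : ℝ) : ℝ :=
  8 * C * l ^ 2 * lam ^ 3 * σ2 / (1 - ρ) ^ 2 + 3 / 2 * L * lam ^ 2 * (v / n)
    + 4 * C * l ^ 2 * lam ^ 3 / (1 - ρ) * v

variable {Φ : ℕ → E → ℝ} {q : ℕ → E → E} {d : ℕ → Fin n → E → E} {L C l σ2 v : ℝ}
  {P : Measure Ω} {X : ℕ × Fin n → Ω → Ξ} {D : ℕ → Fin n → E → Ξ → E}

/-- The state `s` is frozen here; randomness enters only through the samples of step `k`. Working in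
`ℝ≥0∞` with the gain on the left avoids subtraction and any integrability claim about the potential.
-/
theorem lintegral_lyapunov_step_le (hP : PotentialFlow Φ q d L C l σ2)
    (hO : StochasticOracle P X D d v)
    (hn : 0 < n) {W : Matrix (Fin n) (Fin n) ℝ} (hW : W.IsHermitian)
    (hD : W ∈ doublyStochastic ℝ (Fin n)) (hρ : connectivity hW < 1) {lam : ℝ}
    (hlam : 0 ≤ lam) (hlam1 : 6 * L * C * lam ≤ 1) (hlam2 : 2 * l * lam ≤ 1 - connectivity hW)
    (k : ℕ) (s : Fin n → E) :
    (∫⁻ ω, ENNReal.ofReal (PotentialFlow.lyapunov Φ (4 * C * l ^ 2 * lam / (1 - connectivity hW))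
        (k + 1) (mixStep W lam s fun i => D k i (s i) (X (k, i) ω))) ∂P)
      + ENNReal.ofReal (lam / 2 * ⟪q k (mean s), mean fun i => d k i (mean s)⟫_ℝ) ≤
      ENNReal.ofReal (PotentialFlow.lyapunov Φ (4 * C * l ^ 2 * lam / (1 - connectivity hW)) k s)
        + ENNReal.ofReal (noiseLevel n (connectivity hW) lam L C l σ2 v) := by
  obtain ⟨c, hc⟩ := hP.lyapunov_step_le hn hW hD hρ hlam hlam1 hlam2 k s
  have := hO.isProb
  set ρ := connectivity hW with hρdef
  set w := 4 * C * l ^ 2 * lam / (1 - ρ) with hw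
  have h1ρ : 0 < 1 - ρ := by linarith
  have hC := hP.one_le_C
  have hL := hP.L_nonneg
  have hσ := hP.σ2_nonneg
  have hv0 := hO.v_nonneg
  have hw0 : 0 ≤ w := by positivity
  have hly : ∀ k (s : Fin n → E), 0 ≤ PotentialFlow.lyapunov Φ w k s := fun k s =>
    add_nonneg (hP.nonneg _ _) (mul_nonneg hw0 (dispersion_nonneg _))
  have hal := hP.align_nonneg k (mean s)
  set p := ⟪q k (mean s), mean fun i => d k i (mean s)⟫_ℝ with hp
  let N : Fin n → Ω → E := fun i ω => D k i (s i) (X (k, i) ω) - d k i (s i)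
  have hNi : ∀ i, Integrable (N i) P := fun i => (hO.integrable k i (s i)).sub (integrable_const _)
  have hN2 : ∀ i, MemLp (N i) 2 P := fun i =>
    memLp_two_of_lintegral_le (hNi i).1 (hO.variance k i (s i))
  have hNv : ∀ i, ∫ ω, ‖N i ω‖ ^ 2 ∂P ≤ v := fun i =>
    integral_norm_sq_le_of_lintegral_le hv0 (hNi i).1 (hO.variance k i (s i))
  have hN0 : ∀ i, ∫ ω, N i ω ∂P = 0 := fun i => by
    simp only [N]
    rw [integral_sub (hO.integrable k i (s i)) (integrable_const _), hO.unbiased]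
    simp
  have hNind : ∀ i j, i ≠ j → IndepFun (N i) (N j) P := fun i j hij => by
    have hm : ∀ i, Measurable fun x => D k i (s i) x - d k i (s i) := fun i =>
      ((hO.measurable_dir k i).comp measurable_prodMk_left).sub_const _
    exact (hO.indep.indepFun (i := (k, i)) (j := (k, j)) (by simpa using hij)).comp (hm i) (hm j)
  have hmean := integral_norm_mean_sq_le hn hN2 hN0 hNind hNv
  set c0 := PotentialFlow.lyapunov Φ w k s - lam / 2 * p
    + 8 * C * l ^ 2 * lam ^ 3 * σ2 / (1 - ρ) ^ 2 with hc0
  -- An integrable majorant: a constant, a linear part of zero mean, and quadratic parts with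
  -- expectations controlled by `v / n` and `v`.
  let R : Ω → ℝ := fun ω => c0 + mean (fun i => ⟪c i, N i ω⟫_ℝ)
    + 3 / 2 * L * lam ^ 2 * ‖mean fun i => N i ω‖ ^ 2
    + 4 * C * l ^ 2 * lam ^ 3 / (1 - ρ) * mean (fun i => ‖N i ω‖ ^ 2)
  have hle : ∀ ω, PotentialFlow.lyapunov Φ w (k + 1)
      (mixStep W lam s fun i => D k i (s i) (X (k, i) ω)) ≤ R ω := fun ω => by
    have := hc fun i => N i ω
    simpa [N] using this
  have i1 : Integrable (fun ω => mean (fun i => ⟪c i, N i ω⟫_ℝ)) P := by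
    simp only [mean, smul_eq_mul]
    exact (integrable_finsetSum _ fun i _ => (hNi i).const_inner (c i)).const_mul _
  have i2 : Integrable (fun ω => ‖mean fun i => N i ω‖ ^ 2) P := by
    have : MemLp (fun ω => mean fun i => N i ω) 2 P :=
      (memLp_finsetSum _ fun i _ => hN2 i).const_smul _
    exact this.integrable_norm_pow two_ne_zero
  have i3 : Integrable (fun ω => mean fun i => ‖N i ω‖ ^ 2) P := by
    simp only [mean, smul_eq_mul]
    exact (integrable_finsetSum _ fun i _ =>
      (hN2 i).integrable_norm_pow two_ne_zero).const_mul _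
  have i12 : Integrable (fun ω => c0 + mean (fun i => ⟪c i, N i ω⟫_ℝ)) P :=
    (integrable_const _).add i1
  have i123 : Integrable (fun ω => c0 + mean (fun i => ⟪c i, N i ω⟫_ℝ)
      + 3 / 2 * L * lam ^ 2 * ‖mean fun i => N i ω‖ ^ 2) P := i12.add (i2.const_mul _)
  have hRi : Integrable R P := i123.add (i3.const_mul _)
  have e1 : ∫ ω, mean (fun i => ⟪c i, N i ω⟫_ℝ) ∂P = 0 := by
    simp only [mean, smul_eq_mul]
    rw [integral_const_mul, integral_finsetSum _ fun i _ => (hNi i).const_inner (c i)]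
    simp [integral_inner (hNi _), hN0]
  have e3 : ∫ ω, mean (fun i => ‖N i ω‖ ^ 2) ∂P ≤ v := by
    simp only [mean, smul_eq_mul]
    rw [integral_const_mul,
      integral_finsetSum _ fun i _ => (hN2 i).integrable_norm_pow two_ne_zero]
    have := mean_mono hNv
    rw [mean_const hn] at this
    exact this
  have hR : ∫ ω, R ω ∂P ≤ c0 + 3 / 2 * L * lam ^ 2 * (v / n)
      + 4 * C * l ^ 2 * lam ^ 3 / (1 - ρ) * v := by
    simp only [R]
    rw [integral_add i123 (i3.const_mul _), integral_add i12 (i2.const_mul _),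
      integral_add (integrable_const _) i1, integral_const_mul, integral_const_mul, e1]
    simp only [integral_const, probReal_univ, one_smul, add_zero]
    gcongr
  have hlint : ∫⁻ ω, ENNReal.ofReal (PotentialFlow.lyapunov Φ w (k + 1)
      (mixStep W lam s fun i => D k i (s i) (X (k, i) ω))) ∂P ≤ ENNReal.ofReal (∫ ω, R ω ∂P) := by
    rw [ofReal_integral_eq_lintegral_ofReal hRi
      (Filter.Eventually.of_forall fun ω => (hly _ _).trans (hle ω))]
    exact lintegral_mono fun ω => ENNReal.ofReal_le_ofReal (hle ω)
  have hRnn : 0 ≤ ∫ ω, R ω ∂P := integral_nonneg fun ω => (hly _ _).trans (hle ω)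
  have hnl : 0 ≤ noiseLevel n ρ lam L C l σ2 v := by
    unfold noiseLevel; positivity
  calc _ ≤ ENNReal.ofReal (∫ ω, R ω ∂P) + ENNReal.ofReal (lam / 2 * p) := by gcongr
    _ = ENNReal.ofReal (∫ ω, R ω ∂P + lam / 2 * p) :=
        (ENNReal.ofReal_add hRnn (by positivity)).symm
    _ ≤ ENNReal.ofReal (PotentialFlow.lyapunov Φ w k s + noiseLevel n ρ lam L C l σ2 v) := by
        refine ENNReal.ofReal_le_ofReal ?_
        unfold noiseLevel
        linarith
    _ = _ := ENNReal.ofReal_add (hly _ _) hnl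

theorem measurable_mixStep {W : Matrix (Fin n) (Fin n) ℝ} {lam : ℝ} :
    Measurable fun p : (Fin n → E) × (Fin n → E) => mixStep W lam p.1 p.2 := by
  refine Continuous.measurable (continuous_pi fun i => ?_)
  unfold mixStep
  fun_prop

theorem StochasticOracle.measurable_update (hO : StochasticOracle P X D d v)
    {W : Matrix (Fin n) (Fin n) ℝ} {lam : ℝ} (k : ℕ) :
    Measurable fun p : (Fin n → E) × (Fin n → Ξ) =>
      mixStep W lam p.1 fun i => D k i (p.1 i) (p.2 i) := by
  refine measurable_mixStep.comp (measurable_fst.prodMk (measurable_pi_lambda _ fun i => ?_))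
  have : Measurable fun p : (Fin n → E) × (Fin n → Ξ) => (p.1 i, p.2 i) :=
    ((measurable_pi_apply i).comp measurable_fst).prodMk
      ((measurable_pi_apply i).comp measurable_snd)
  exact (hO.measurable_dir k i).comp this

/-- The iterate of step `k` is independent of the samples of step `k`. -/
theorem StochasticOracle.indepFun_iterate (hO : StochasticOracle P X D d v)
    {W : Matrix (Fin n) (Fin n) ℝ} {lam : ℝ} {S : ℕ → Ω → Fin n → E} {s0 : Fin n → E}
    (h0 : ∀ ω, S 0 ω = s0)
    (hS : ∀ k ω, S (k + 1) ω = mixStep W lam (S k ω) fun i => D k i (S k ω i) (X (k, i) ω))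
    (k : ℕ) : Measurable (S k) ∧ IndepFun (S k) (fun ω i => X (k, i) ω) P := by
  let m : ℕ × Fin n → MeasurableSpace Ω := fun a => MeasurableSpace.comap (X a) inferInstance
  have hm : ∀ a, m a ≤ ‹MeasurableSpace Ω› := fun a => (hO.measurable_sample a).comap_le
  -- The information in the samples of iterations before `k`. The iterate is measurable with respect
  -- to it, and it shares no sample index with iteration `k`.
  let past : ℕ → MeasurableSpace Ω := fun k => ⨆ a ∈ {a : ℕ × Fin n | a.1 < k}, m a
  have hmX : ∀ (T : Set (ℕ × Fin n)) a, a ∈ T → Measurable[⨆ a ∈ T, m a] (X a) := fun T a ha =>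
    (comap_measurable (X a)).mono (le_iSup₂_of_le a ha le_rfl) le_rfl
  have hmeas : ∀ k, Measurable[past k] (S k) := by
    intro k
    induction k with
    | zero =>
      have : S 0 = fun _ => s0 := funext h0
      rw [this]
      exact @measurable_const _ _ _ (past 0) _
    | succ k ih =>
      have hle : past k ≤ past (k + 1) := by
        refine iSup₂_le fun a ha => le_iSup₂_of_le a ?_ le_rfl
        simp only [Set.mem_ofPred_eq] at ha ⊢
        omega
      have h1 : Measurable[past (k + 1)] (S k) := ih.mono hle le_rfl
      have h2 : Measurable[past (k + 1)] (fun ω i => X (k, i) ω) :=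
        @measurable_pi_lambda _ _ _ (past (k + 1)) _ _ fun i => hmX _ (k, i) (by simp)
      have h3 : S (k + 1) = (fun p : (Fin n → E) × (Fin n → Ξ) =>
          mixStep W lam p.1 fun i => D k i (p.1 i) (p.2 i)) ∘
          fun ω => (S k ω, fun i => X (k, i) ω) := funext (hS k)
      rw [h3]
      exact hO.measurable_update k |>.comp (Measurable.prodMk h1 h2)
  have hpast : past k ≤ ‹MeasurableSpace Ω› := iSup₂_le fun a _ => hm a
  refine ⟨(hmeas k).mono hpast le_rfl, ?_⟩
  have hind : Indep (past k) (⨆ a ∈ {a : ℕ × Fin n | a.1 = k}, m a) P := by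
    refine indep_iSup_of_disjoint hm hO.indep ?_
    rw [Set.disjoint_left]
    intro a ha hb
    simp only [Set.mem_ofPred_eq] at ha hb
    omega
  have h2 : Measurable[⨆ a ∈ {a : ℕ × Fin n | a.1 = k}, m a] (fun ω i => X (k, i) ω) :=
    @measurable_pi_lambda _ _ _ (⨆ a ∈ {a : ℕ × Fin n | a.1 = k}, m a) _ _
      fun i => hmX _ (k, i) (by simp)
  exact indep_of_indep_of_le_left (indep_of_indep_of_le_right hind h2.comap_le) (hmeas k).comap_le

/-- The law of an independent pair is a product, so Tonelli allows `U` to be frozen while `V` is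
integrated out. This passes from a deterministic state to the random iterate. -/
theorem lintegral_comp_indepFun {α β : Type*} [MeasurableSpace α] [MeasurableSpace β]
    [IsProbabilityMeasure P] {U : Ω → α} {V : Ω → β} (hU : Measurable U) (hV : Measurable V)
    (hUV : IndepFun U V P) {ψ : α × β → ℝ≥0∞} (hψ : Measurable ψ) :
    ∫⁻ ω, ψ (U ω, V ω) ∂P = ∫⁻ ω, ∫⁻ ω', ψ (U ω, V ω') ∂P ∂P := by
  have h1 := (indepFun_iff_map_prod_eq_prod_map_map hU.aemeasurable hV.aemeasurable).1 hUV
  have := Measure.isProbabilityMeasure_map (μ := P) hV.aemeasurable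
  rw [← lintegral_map hψ (hU.prodMk hV), h1, lintegral_prod _ hψ.aemeasurable,
    lintegral_map hψ.lintegral_prod_right' hU]
  refine lintegral_congr fun ω => ?_
  exact lintegral_map (hψ.comp measurable_prodMk_left) hV

theorem add_sum_le_of_step_le {a b : ℕ → ℝ≥0∞} {c : ℝ≥0∞} (h : ∀ k, a (k + 1) + b k ≤ a k + c)
    (K : ℕ) : a K + ∑ k ∈ Finset.range K, b k ≤ a 0 + K * c := by
  induction K with
  | zero => simp
  | succ K ih =>
    rw [Finset.sum_range_succ]
    calc a (K + 1) + (∑ k ∈ Finset.range K, b k + b K)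
        = (a (K + 1) + b K) + ∑ k ∈ Finset.range K, b k := by ring
      _ ≤ (a K + c) + ∑ k ∈ Finset.range K, b k := add_le_add_left (h K) _
      _ = (a K + ∑ k ∈ Finset.range K, b k) + c := by ring
      _ ≤ (a 0 + K * c) + c := by gcongr
      _ = _ := by push_cast; ring

/-- The convergence estimate for decentralized stochastic descent on a potential. -/
theorem sum_lintegral_align_le (hP : PotentialFlow Φ q d L C l σ2)
    (hO : StochasticOracle P X D d v) (hΦ : ∀ k, Measurable (Φ k))
    (hn : 0 < n) {W : Matrix (Fin n) (Fin n) ℝ} (hW : W.IsHermitian)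
    (hD : W ∈ doublyStochastic ℝ (Fin n)) (hρ : connectivity hW < 1) {lam : ℝ}
    (hlam : 0 ≤ lam) (hlam1 : 6 * L * C * lam ≤ 1) (hlam2 : 2 * l * lam ≤ 1 - connectivity hW)
    {S : ℕ → Ω → Fin n → E} {s0 : Fin n → E} (h0 : ∀ ω, S 0 ω = s0)
    (hS : ∀ k ω, S (k + 1) ω = mixStep W lam (S k ω) fun i => D k i (S k ω i) (X (k, i) ω))
    (K : ℕ) :
    ∑ k ∈ Finset.range K, ∫⁻ ω, ENNReal.ofReal
        (lam / 2 * ⟪q k (mean (S k ω)), mean fun i => d k i (mean (S k ω))⟫_ℝ) ∂P ≤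
      ENNReal.ofReal (PotentialFlow.lyapunov Φ (4 * C * l ^ 2 * lam / (1 - connectivity hW)) 0 s0)
        + K * ENNReal.ofReal (noiseLevel n (connectivity hW) lam L C l σ2 v) := by
  have := hO.isProb
  set w := 4 * C * l ^ 2 * lam / (1 - connectivity hW) with hw
  have hly : ∀ k, Measurable fun s : Fin n → E =>
      ENNReal.ofReal (PotentialFlow.lyapunov Φ w k s) := fun k => by
    have hmean : Measurable fun s : Fin n → E => mean s := by
      refine Continuous.measurable ?_
      unfold mean
      fun_prop
    have hdis : Measurable fun s : Fin n → E => dispersion s := by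
      refine Continuous.measurable ?_
      unfold dispersion mean
      fun_prop
    exact (((hΦ k).comp hmean).add (hdis.const_mul w)).ennreal_ofReal
  have hstep := add_sum_le_of_step_le
    (a := fun k => ∫⁻ ω, ENNReal.ofReal (PotentialFlow.lyapunov Φ w k (S k ω)) ∂P)
    (b := fun k => ∫⁻ ω, ENNReal.ofReal
        (lam / 2 * ⟪q k (mean (S k ω)), mean fun i => d k i (mean (S k ω))⟫_ℝ) ∂P)
    (c := ENNReal.ofReal (noiseLevel n (connectivity hW) lam L C l σ2 v)) (fun k => ?_) K
  · refine (le_add_self).trans (hstep.trans ?_)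
    simp [h0]
  · obtain ⟨hSm, hSi⟩ := hO.indepFun_iterate h0 hS k
    let ψ : (Fin n → E) × (Fin n → Ξ) → ℝ≥0∞ := fun p => ENNReal.ofReal
      (PotentialFlow.lyapunov Φ w (k + 1) (mixStep W lam p.1 fun i => D k i (p.1 i) (p.2 i)))
    have hψ : Measurable ψ := (hly (k + 1)).comp (hO.measurable_update k)
    have hXm : Measurable fun ω i => X (k, i) ω :=
      measurable_pi_lambda _ fun i => hO.measurable_sample (k, i)
    have e1 : ∫⁻ ω, ENNReal.ofReal (PotentialFlow.lyapunov Φ w (k + 1) (S (k + 1) ω)) ∂P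
        = ∫⁻ ω, ∫⁻ ω', ψ (S k ω, fun i => X (k, i) ω') ∂P ∂P := by
      rw [← lintegral_comp_indepFun hSm hXm hSi hψ]
      refine lintegral_congr fun ω => ?_
      rw [hS]
    have hmeas : Measurable fun ω => ∫⁻ ω', ψ (S k ω, fun i => X (k, i) ω') ∂P :=
      Measurable.lintegral_prod_right'
        (f := fun p : Ω × Ω => ψ (S k p.1, fun i => X (k, i) p.2))
        (hψ.comp ((hSm.comp measurable_fst).prodMk (hXm.comp measurable_snd)))
    -- Additivity asks for measurability of the Lyapunov part only; none is required of the
    -- alignment term.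
    rw [e1, ← lintegral_add_left hmeas]
    have e2 : (∫⁻ ω, ENNReal.ofReal (PotentialFlow.lyapunov Φ w k (S k ω)) ∂P)
        + ENNReal.ofReal (noiseLevel n (connectivity hW) lam L C l σ2 v)
        = ∫⁻ ω, (ENNReal.ofReal (PotentialFlow.lyapunov Φ w k (S k ω))
          + ENNReal.ofReal (noiseLevel n (connectivity hW) lam L C l σ2 v)) ∂P := by
      rw [lintegral_add_right _ measurable_const]; simp
    rw [e2]
    exact lintegral_mono fun ω =>
      lintegral_lyapunov_step_le hP hO hn hW hD hρ hlam hlam1 hlam2 k (S k ω)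

end Recursion

theorem continuous_of_differentiable {E : Type*} [NormedAddCommGroup E] [InnerProductSpace ℝ E]
    {f : E → ℝ} (hf : Differentiable ℝ f) : Continuous f :=
  hf.continuous

/-! ### Coordinates on the product space -/

section PairAPI

variable {dx dy : ℕ}

@[simp] theorem pt_fst (x : Vec dx) (y : Vec dy) : (pt x y).fst = x := rfl

@[simp] theorem pt_snd (x : Vec dx) (y : Vec dy) : (pt x y).snd = y := rfl

theorem pt_eta (z : Pair dx dy) : pt z.fst z.snd = z := rfl

theorem pt_add (x x' : Vec dx) (y y' : Vec dy) : pt x y + pt x' y' = pt (x + x') (y + y') := rfl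

theorem pt_sub (x x' : Vec dx) (y y' : Vec dy) : pt x y - pt x' y' = pt (x - x') (y - y') := rfl

theorem norm_pt_sq (x : Vec dx) (y : Vec dy) : ‖pt x y‖ ^ 2 = ‖x‖ ^ 2 + ‖y‖ ^ 2 :=
  WithLp.prod_norm_sq_eq_of_L2 _

theorem norm_pair_sq (z : Pair dx dy) : ‖z‖ ^ 2 = ‖z.fst‖ ^ 2 + ‖z.snd‖ ^ 2 :=
  WithLp.prod_norm_sq_eq_of_L2 z

theorem inner_pair (z w : Pair dx dy) : ⟪z, w⟫_ℝ = ⟪z.fst, w.fst⟫_ℝ + ⟪z.snd, w.snd⟫_ℝ :=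
  WithLp.prod_inner_apply z w

end PairAPI

/-! ### The proximal problem and the Moreau envelope -/

namespace Problem

variable {Ξf Ξg : Type*} [MeasurableSpace Ξf] [MeasurableSpace Ξg] {dx dy n : ℕ}
variable (P : Problem Ξf Ξg dx dy n)

/-- The partial gradient in `θ` of the proximal objective. -/
noncomputable def proxGradθ (γ : ℝ) (z : Pair dx dy) (θ : Vec dy) : Vec dy :=
  (gradient P.G (pt z.fst θ)).snd + (1 / γ) • (θ - z.snd)

/-- The partial gradient in `(x, y)` of the proximal objective. -/
noncomputable def proxGradZ (γ : ℝ) (z : Pair dx dy) (θ : Vec dy) : Pair dx dy :=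
  pt (gradient P.G (pt z.fst θ)).fst ((1 / γ) • (z.snd - θ))

/-- The gradient of the Moreau envelope. -/
noncomputable def gradMoreau (γ : ℝ) (z : Pair dx dy) : Pair dx dy :=
  P.proxGradZ γ z (P.thetaStar γ z)

/-- The lower-level objective is smooth, and `γ` is small compared to its smoothness. -/
structure SmoothLower (L2 γ : ℝ) : Prop where
  L2_pos : 0 < L2
  γ_pos : 0 < γ
  γ_lt : 2 * L2 < 1 / γ
  diff : Differentiable ℝ P.G
  smooth : ∀ z z', ‖gradient P.G z - gradient P.G z'‖ ≤ L2 * ‖z - z'‖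

namespace SmoothLower

variable {P} {L2 γ : ℝ} (hS : P.SmoothLower L2 γ)
include hS

/-- The quadratic coupling is expanded exactly and only `G` contributes an error. Keeping the square
`‖t - h.snd‖ ^ 2` on the left preserves the curvature that gives strong convexity in `θ` and the
lower bound for the envelope. -/
theorem abs_prox_taylor_le (z h : Pair dx dy) (θ t : Vec dy) :
    |P.proxObjective γ (z + h) (θ + t) - P.proxObjective γ z θ - ⟪P.proxGradθ γ z θ, t⟫_ℝ
      - ⟪P.proxGradZ γ z θ, h⟫_ℝ - 1 / (2 * γ) * ‖t - h.snd‖ ^ 2| ≤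
      L2 / 2 * (‖h.fst‖ ^ 2 + ‖t‖ ^ 2) := by
  have h1 := abs_sub_sub_inner_gradient_le hS.diff hS.smooth (pt z.fst θ) (pt h.fst t)
  rw [norm_pt_sq, pt_add, inner_pair] at h1
  refine (congrArg _ ?_).trans_le h1
  have hγ := hS.γ_pos
  have e1 : ‖(θ + t) - (z + h).snd‖ ^ 2 = ‖θ - z.snd‖ ^ 2 + 2 * ⟪θ - z.snd, t - h.snd⟫_ℝ
      + ‖t - h.snd‖ ^ 2 := by
    rw [← norm_add_sq_real]; congr 2; simp; abel
  have e2 : ⟪θ - z.snd, t - h.snd⟫_ℝ = ⟪θ - z.snd, t⟫_ℝ + ⟪z.snd - θ, h.snd⟫_ℝ := by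
    rw [inner_sub_right, ← neg_sub θ z.snd, inner_neg_left]; ring
  simp only [proxObjective, proxGradθ, proxGradZ]
  rw [e1, e2, inner_pair, inner_add_left, real_inner_smul_left]
  simp only [pt_fst, pt_snd, real_inner_smul_left, WithLp.add_fst]
  field_simp
  ring

theorem prox_taylor_le (z h : Pair dx dy) (θ t : Vec dy) :
    P.proxObjective γ (z + h) (θ + t) ≤ P.proxObjective γ z θ + ⟪P.proxGradθ γ z θ, t⟫_ℝ
      + ⟪P.proxGradZ γ z θ, h⟫_ℝ + 1 / (2 * γ) * ‖t - h.snd‖ ^ 2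
      + L2 / 2 * (‖h.fst‖ ^ 2 + ‖t‖ ^ 2) := by
  have := (abs_le.1 (hS.abs_prox_taylor_le z h θ t)).2
  linarith

theorem le_prox_taylor (z h : Pair dx dy) (θ t : Vec dy) :
    P.proxObjective γ z θ + ⟪P.proxGradθ γ z θ, t⟫_ℝ
      + ⟪P.proxGradZ γ z θ, h⟫_ℝ + 1 / (2 * γ) * ‖t - h.snd‖ ^ 2
      - L2 / 2 * (‖h.fst‖ ^ 2 + ‖t‖ ^ 2) ≤ P.proxObjective γ (z + h) (θ + t) := by
  have := (abs_le.1 (hS.abs_prox_taylor_le z h θ t)).1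
  linarith

theorem prox_le (z : Pair dx dy) (θ θ' : Vec dy) :
    P.proxObjective γ z θ' ≤ P.proxObjective γ z θ + ⟪P.proxGradθ γ z θ, θ' - θ⟫_ℝ
      + (L2 + 1 / γ) / 2 * ‖θ' - θ‖ ^ 2 := by
  have := hS.prox_taylor_le z 0 θ (θ' - θ)
  simp only [add_zero, add_sub_cancel, inner_zero_right, WithLp.zero_snd, WithLp.zero_fst,
    sub_zero, norm_zero] at this
  refine this.trans (le_of_eq ?_)
  have hγ := hS.γ_pos
  field_simp
  ring

theorem le_prox (z : Pair dx dy) (θ θ' : Vec dy) :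
    P.proxObjective γ z θ + ⟪P.proxGradθ γ z θ, θ' - θ⟫_ℝ
      + (1 / γ - L2) / 2 * ‖θ' - θ‖ ^ 2 ≤ P.proxObjective γ z θ' := by
  have := hS.le_prox_taylor z 0 θ (θ' - θ)
  simp only [add_zero, add_sub_cancel, inner_zero_right, WithLp.zero_snd, WithLp.zero_fst,
    sub_zero, norm_zero] at this
  refine (le_of_eq ?_).trans this
  have hγ := hS.γ_pos
  field_simp
  ring

/-- Strong convexity with modulus `η = 1 / γ - L2` beats the linear term, so the objective is at
least `‖θ‖` plus a constant and hence coercive. -/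
theorem exists_prox_min (z : Pair dx dy) :
    ∃ θ, ∀ θ', P.proxObjective γ z θ ≤ P.proxObjective γ z θ' := by
  have hη : 0 < 1 / γ - L2 := by linarith [hS.γ_lt, hS.L2_pos]
  set η := 1 / γ - L2 with hηdef
  refine Continuous.exists_forall_le ?_ ?_
  · have hpt : Continuous fun θ : Vec dy => pt z.fst θ :=
      (WithLp.prod_continuous_toLp 2 _ _).comp (continuous_const.prodMk continuous_id)
    have h1 : Continuous fun θ : Vec dy => P.G (pt z.fst θ) := (continuous_of_differentiable hS.diff).comp hpt
    have h2 : ∀ y : Vec dy, Continuous fun θ : Vec dy => 1 / (2 * γ) * ‖θ - y‖ ^ 2 :=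
      fun y => by fun_prop
    exact h1.add (h2 z.snd)
  · set u := P.proxGradθ γ z 0
    refine Filter.tendsto_atTop_mono (f := fun θ : Vec dy =>
      ‖θ‖ + (P.proxObjective γ z 0 - (‖u‖ + 1) ^ 2 / (2 * η))) (fun θ => ?_)
      (Filter.tendsto_atTop_add_const_right _ _ tendsto_norm_cocompact_atTop)
    have h1 := hS.le_prox z 0 θ
    rw [sub_zero] at h1
    have h2 : -(‖u‖ * ‖θ‖) ≤ ⟪u, θ⟫_ℝ := (abs_le.1 (abs_real_inner_le_norm u θ)).1
    have h3 : (‖u‖ + 1) * ‖θ‖ ≤ η / 2 * ‖θ‖ ^ 2 + (‖u‖ + 1) ^ 2 / (2 * η) := by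
      have : η / 2 * ‖θ‖ ^ 2 + (‖u‖ + 1) ^ 2 / (2 * η) - (‖u‖ + 1) * ‖θ‖
          = (η * ‖θ‖ - (‖u‖ + 1)) ^ 2 / (2 * η) := by field_simp; ring
      have : 0 ≤ (η * ‖θ‖ - (‖u‖ + 1)) ^ 2 / (2 * η) := by positivity
      linarith
    linarith

theorem prox_thetaStar_le (z : Pair dx dy) (θ : Vec dy) :
    P.proxObjective γ z (P.thetaStar γ z) ≤ P.proxObjective γ z θ :=
  Classical.epsilon_spec (p := fun θ => ∀ θ', P.proxObjective γ z θ ≤ P.proxObjective γ z θ')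
    (hS.exists_prox_min z) θ

theorem moreau_eq (z : Pair dx dy) : P.moreau γ z = P.proxObjective γ z (P.thetaStar γ z) :=
  le_antisymm
    (ciInf_le ⟨_, by rintro _ ⟨θ, rfl⟩; exact hS.prox_thetaStar_le z θ⟩ _)
    (le_ciInf fun θ => hS.prox_thetaStar_le z θ)

theorem moreau_le_prox (z : Pair dx dy) (θ : Vec dy) : P.moreau γ z ≤ P.proxObjective γ z θ := by
  rw [hS.moreau_eq]; exact hS.prox_thetaStar_le z θ

theorem moreau_le (z : Pair dx dy) : P.moreau γ z ≤ P.G z := by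
  simpa [proxObjective, pt_eta] using hS.moreau_le_prox z z.snd

/-- A gradient step of length `1 / c` from the minimizer would lower the objective by at least `‖u‖
^ 2 / (2 * c)`. -/
theorem proxGradθ_thetaStar (z : Pair dx dy) : P.proxGradθ γ z (P.thetaStar γ z) = 0 := by
  have hγ := hS.γ_pos
  have hc : 0 < L2 + 1 / γ := by have := hS.L2_pos; positivity
  set c := L2 + 1 / γ
  set θ := P.thetaStar γ z
  set u := P.proxGradθ γ z θ
  have h1 := hS.prox_le z θ (θ + (-(1 / c)) • u)
  have h2 := hS.prox_thetaStar_le z (θ + (-(1 / c)) • u)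
  rw [add_sub_cancel_left, inner_smul_right, real_inner_self_eq_norm_sq, norm_smul, mul_pow,
    Real.norm_eq_abs, sq_abs] at h1
  have h3 : -(1 / c) * ‖u‖ ^ 2 + c / 2 * ((-(1 / c)) ^ 2 * ‖u‖ ^ 2) = -(‖u‖ ^ 2 / (2 * c)) := by
    field_simp; ring
  have h4 : ‖u‖ ^ 2 / (2 * c) ≤ 0 := by linarith
  have h5 : ‖u‖ ^ 2 ≤ 0 := by
    by_contra! h
    have : 0 < ‖u‖ ^ 2 / (2 * c) := by positivity
    linarith
  simpa using le_antisymm h5 (by positivity)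

theorem prox_sub_moreau_le (z : Pair dx dy) (θ : Vec dy) :
    P.proxObjective γ z θ - P.moreau γ z ≤ (L2 + 1 / γ) / 2 * ‖θ - P.thetaStar γ z‖ ^ 2 := by
  have := hS.prox_le z (P.thetaStar γ z) θ
  rw [hS.proxGradθ_thetaStar, inner_zero_left, ← hS.moreau_eq] at this
  linarith

/-- Adding the strong convexity inequalities from `θ` to the minimizer and back gives `η ‖e‖² ≤ ⟪∇,
e⟫ ≤ ‖∇‖ ‖e‖`. -/
theorem norm_proxGradθ_sq_ge (z : Pair dx dy) (θ : Vec dy) :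
    (1 / γ - L2) ^ 2 * ‖θ - P.thetaStar γ z‖ ^ 2 ≤ ‖P.proxGradθ γ z θ‖ ^ 2 := by
  have hη : 0 < 1 / γ - L2 := by linarith [hS.γ_lt, hS.L2_pos]
  have h1 := hS.le_prox z θ (P.thetaStar γ z)
  have h2 := hS.le_prox z (P.thetaStar γ z) θ
  rw [hS.proxGradθ_thetaStar, inner_zero_left] at h2
  rw [← neg_sub θ, inner_neg_right, norm_neg] at h1
  set e := θ - P.thetaStar γ z
  have h3 : ⟪P.proxGradθ γ z θ, e⟫_ℝ ≤ ‖P.proxGradθ γ z θ‖ * ‖e‖ := real_inner_le_norm _ _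
  have h4 : (1 / γ - L2) * ‖e‖ ≤ ‖P.proxGradθ γ z θ‖ := by
    rcases (norm_nonneg e).eq_or_lt with h | h
    · rw [← h]; simp
    · refine le_of_mul_le_mul_right ?_ h
      nlinarith
  rw [← mul_pow]
  gcongr

theorem norm_proxGradZ_sub_sq_le (z : Pair dx dy) (θ θ' : Vec dy) :
    ‖P.proxGradZ γ z θ - P.proxGradZ γ z θ'‖ ^ 2 ≤ (L2 ^ 2 + 1 / γ ^ 2) * ‖θ - θ'‖ ^ 2 := by
  have h1 := hS.smooth (pt z.fst θ) (pt z.fst θ')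
  have h2 : ‖pt z.fst θ - pt z.fst θ'‖ = ‖θ - θ'‖ := by
    rw [← sq_eq_sq₀ (norm_nonneg _) (norm_nonneg _), pt_sub, norm_pt_sq]; simp
  rw [h2] at h1
  have h3 : ‖(gradient P.G (pt z.fst θ)).fst - (gradient P.G (pt z.fst θ')).fst‖ ^ 2 ≤
      (L2 * ‖θ - θ'‖) ^ 2 := by
    refine le_trans ?_ (pow_le_pow_left₀ (norm_nonneg _) h1 2)
    rw [norm_pair_sq]
    simp only [WithLp.sub_fst]
    nlinarith [sq_nonneg ‖(gradient P.G (pt z.fst θ) - gradient P.G (pt z.fst θ')).snd‖]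
  rw [proxGradZ, proxGradZ, pt_sub, norm_pt_sq, ← smul_sub, sub_sub_sub_cancel_left, norm_smul,
    mul_pow, Real.norm_eq_abs, sq_abs, norm_sub_rev θ' θ]
  rw [mul_pow] at h3
  rw [add_mul, one_div_pow]
  gcongr

/-- Envelope theorem without differentiating the minimizer. Above, the old minimizer is a competitor
at `z + h`. Below, the objective is expanded around the old minimizer, where the `θ`-gradient
vanishes; the displacement `t` of the minimizer is then harmless, since `2 * L2 < 1 / γ` lets the
exact square absorb it. -/
theorem abs_moreau_taylor_le (z h : Pair dx dy) :
    P.moreau γ z + ⟪P.gradMoreau γ z, h⟫_ℝ - L2 * ‖h‖ ^ 2 ≤ P.moreau γ (z + h) ∧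
    P.moreau γ (z + h) ≤ P.moreau γ z + ⟪P.gradMoreau γ z, h⟫_ℝ + 1 / γ * ‖h‖ ^ 2 := by
  have hγ := hS.γ_pos
  have hL := hS.L2_pos
  have hlt := hS.γ_lt
  have e1 : 1 / (2 * γ) = 1 / γ / 2 := by field_simp
  rw [norm_pair_sq h]
  constructor
  · have h1 := hS.le_prox_taylor z h (P.thetaStar γ z) (P.thetaStar γ (z + h) - P.thetaStar γ z)
    rw [add_sub_cancel, ← hS.moreau_eq, ← hS.moreau_eq, hS.proxGradθ_thetaStar, inner_zero_left,
      e1] at h1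
    set t := P.thetaStar γ (z + h) - P.thetaStar γ z
    have h2 : ‖t‖ ^ 2 ≤ 2 * (‖t - h.snd‖ ^ 2 + ‖h.snd‖ ^ 2) := by
      simpa using norm_add_sq_le_two (t - h.snd) h.snd
    have h3 : L2 * ‖t - h.snd‖ ^ 2 ≤ 1 / γ / 2 * ‖t - h.snd‖ ^ 2 := by
      gcongr; linarith
    have h4 := mul_le_mul_of_nonneg_left h2 hL.le
    have h5 : 0 ≤ L2 * ‖h.fst‖ ^ 2 := by positivity
    rw [gradMoreau]
    linarith
  · have h1 := (hS.moreau_le_prox (z + h) (P.thetaStar γ z + 0)).trans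
      (hS.prox_taylor_le z h (P.thetaStar γ z) 0)
    rw [← hS.moreau_eq, inner_zero_right, zero_sub, norm_neg, norm_zero, e1] at h1
    have h3 : L2 * ‖h.fst‖ ^ 2 ≤ 1 / γ / 2 * ‖h.fst‖ ^ 2 := by
      gcongr; linarith
    have h5 : 0 ≤ 1 / γ * ‖h.fst‖ ^ 2 := by positivity
    have h6 : 0 ≤ 1 / γ * ‖h.snd‖ ^ 2 := by positivity
    rw [gradMoreau]
    linarith

theorem hasGradientAt_moreau (z : Pair dx dy) :
    HasGradientAt (P.moreau γ) (P.gradMoreau γ z) z := by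
  refine hasGradientAt_of_abs_sub_le (C := L2 + 1 / γ) fun h => ?_
  obtain ⟨h1, h2⟩ := hS.abs_moreau_taylor_le z h
  have h3 : 0 ≤ L2 * ‖h‖ ^ 2 := by have := hS.L2_pos; positivity
  have h4 : 0 ≤ 1 / γ * ‖h‖ ^ 2 := by have := hS.γ_pos; positivity
  rw [abs_le]
  constructor <;> linarith

/-- A Lipschitz constant of the minimizer is at least `1 / (1 + γ L2)`. -/
theorem one_le_mul_lipschitz [NeZero dy] {K : ℝ}
    (hK : ∀ z z', ‖P.thetaStar γ z - P.thetaStar γ z'‖ ≤ K * ‖z - z'‖) :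
    1 ≤ (1 + γ * L2) * K := by
  have hγ := hS.γ_pos
  have hL := hS.L2_pos
  obtain ⟨v, hv⟩ := exists_ne (0 : Vec dy)
  have hv' : 0 < ‖v‖ := norm_pos_iff.2 hv
  set z : Pair dx dy := pt 0 v
  set z' : Pair dx dy := pt 0 0
  have hzz : ‖z - z'‖ = ‖v‖ := by
    rw [← sq_eq_sq₀ (norm_nonneg _) (norm_nonneg _), pt_sub, norm_pt_sq]; simp
  have h1 := hS.proxGradθ_thetaStar z
  have h2 := hS.proxGradθ_thetaStar z'
  have h3 := hK z z'
  set θ := P.thetaStar γ z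
  set θ' := P.thetaStar γ z'
  rw [proxGradθ] at h1 h2
  simp only [z, z', pt_fst, pt_snd] at h1 h2
  set a := gradient P.G (pt 0 θ)
  set b := gradient P.G (pt 0 θ')
  -- Optimality reads `y = θ + γ ∇_θ G(x, θ)`: the minimizer determines `y` in a Lipschitz way, so
  -- it cannot move much more slowly than `y`.
  have h4 : v = (θ - θ') + γ • (a - b).snd := by
    have h5 : (1 / γ) • (θ - v) - (1 / γ) • (θ' - 0) = - (a - b).snd := by
      rw [eq_neg_of_add_eq_zero_right h1, eq_neg_of_add_eq_zero_right h2, WithLp.sub_snd]; abel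
    have h6 : γ • ((1 / γ) • (θ - v) - (1 / γ) • (θ' - 0)) = (θ - v) - θ' := by
      rw [← smul_sub, smul_smul, mul_one_div_cancel hγ.ne', one_smul, sub_zero]
    rw [h5, smul_neg] at h6
    rw [neg_eq_iff_eq_neg.1 h6]
    abel
  have h5 : ‖(a - b).snd‖ ≤ L2 * ‖θ - θ'‖ := by
    have h6 := hS.smooth (pt (0 : Vec dx) θ) (pt 0 θ')
    have h7 : ‖pt (0 : Vec dx) θ - pt 0 θ'‖ = ‖θ - θ'‖ := by
      rw [← sq_eq_sq₀ (norm_nonneg _) (norm_nonneg _), pt_sub, norm_pt_sq]; simp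
    rw [h7] at h6
    exact (WithLp.norm_snd_le _ _).trans h6
  have h6 : ‖v‖ ≤ (1 + γ * L2) * ‖θ - θ'‖ := by
    calc ‖v‖ = ‖(θ - θ') + γ • (a - b).snd‖ := by rw [← h4]
      _ ≤ ‖θ - θ'‖ + ‖γ • (a - b).snd‖ := norm_add_le _ _
      _ ≤ ‖θ - θ'‖ + γ * (L2 * ‖θ - θ'‖) := by
          rw [norm_smul, Real.norm_of_nonneg hγ.le]; gcongr
      _ = _ := by ring
  rw [hzz] at h3
  have h7 : 1 * ‖v‖ ≤ (1 + γ * L2) * K * ‖v‖ := by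
    rw [one_mul, mul_assoc]
    exact h6.trans (by gcongr)
  exact le_of_mul_le_mul_right h7 hv'

end SmoothLower

end Problem

/-! ### The joint variable and the linear structure of the direction -/

section JointState

/-- The variables `(θ, (x, y))` of one agent, with the Euclidean norm. -/
abbrev JointState (dx dy : ℕ) : Type := WithLp 2 (Vec dy × Pair dx dy)

variable {dx dy : ℕ}

/-- The joint variable `(θ, z)`. -/
def js (θ : Vec dy) (z : Pair dx dy) : JointState dx dy := WithLp.toLp 2 (θ, z)

@[simp] theorem js_fst (θ : Vec dy) (z : Pair dx dy) : (js θ z).fst = θ := rfl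

@[simp] theorem js_snd (θ : Vec dy) (z : Pair dx dy) : (js θ z).snd = z := rfl

theorem norm_js_sq (θ : Vec dy) (z : Pair dx dy) : ‖js θ z‖ ^ 2 = ‖θ‖ ^ 2 + ‖z‖ ^ 2 :=
  WithLp.prod_norm_sq_eq_of_L2 _

theorem norm_joint_sq (s : JointState dx dy) : ‖s‖ ^ 2 = ‖s.fst‖ ^ 2 + ‖s.snd‖ ^ 2 :=
  WithLp.prod_norm_sq_eq_of_L2 s

theorem inner_joint (s t : JointState dx dy) : ⟪s, t⟫_ℝ = ⟪s.fst, t.fst⟫_ℝ + ⟪s.snd, t.snd⟫_ℝ :=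
  WithLp.prod_inner_apply s t

/-- The point `(x, θ)`. -/
def lowerPt (s : JointState dx dy) : Pair dx dy := pt s.snd.fst s.fst

theorem norm_lowerPt_sub_le (s t : JointState dx dy) : ‖lowerPt s - lowerPt t‖ ≤ ‖s - t‖ := by
  rw [← sq_le_sq₀ (norm_nonneg _) (norm_nonneg _), lowerPt, lowerPt, pt_sub, norm_pt_sq,
    norm_joint_sq, norm_pair_sq]
  have := sq_nonneg ‖(s - t).snd.snd‖
  simp only [WithLp.sub_fst, WithLp.sub_snd] at this ⊢
  linarith

theorem norm_joint_snd_le (s : JointState dx dy) : ‖s.snd‖ ≤ ‖s‖ := WithLp.norm_snd_le _ _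

/-- The variables of an agent as a joint variable. -/
def toJoint (dx dy : ℕ) : AgentState dx dy →ₗ[ℝ] JointState dx dy where
  toFun s := js s.1 (pt s.2.1 s.2.2)
  map_add' _ _ := rfl
  map_smul' _ _ := rfl

/-- The part of the update direction that depends linearly on the gradients of `f` at `(x, y)`, of
`g` at `(x, y)` and of `g` at `(x, θ)`. -/
def gradPart (dx dy : ℕ) (cl μ : ℝ) :
    Pair dx dy × Pair dx dy × Pair dx dy →ₗ[ℝ] JointState dx dy where
  toFun g := js g.2.2.snd (cl • (μ • g.1 + g.2.1 - pt g.2.2.fst 0))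
  map_add' g h := by
    have : pt (g + h).2.2.fst (0 : Vec dy) = pt g.2.2.fst 0 + pt h.2.2.fst 0 := by
      rw [pt_add, add_zero]; rfl
    rw [this]
    refine WithLp.ofLp_injective 2 (Prod.ext rfl ?_)
    change cl • (μ • (g.1 + h.1) + (g.2.1 + h.2.1) - _) = cl • _ + cl • _
    rw [← smul_add, smul_add]
    congr 1
    abel
  map_smul' c g := by
    have : pt (c • g).2.2.fst (0 : Vec dy) = c • pt g.2.2.fst 0 := by
      refine WithLp.ofLp_injective 2 (Prod.ext rfl (smul_zero c).symm)
    rw [this]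
    refine WithLp.ofLp_injective 2 (Prod.ext rfl ?_)
    change cl • (μ • (c • g.1) + (c • g.2.1) - _) = c • cl • _
    rw [smul_comm μ c, ← smul_add, ← smul_sub, smul_comm cl c]

/-- The part of the update direction that comes from the proximal term. -/
noncomputable def proxPart (dx dy : ℕ) (γ cl : ℝ) : JointState dx dy →ₗ[ℝ] JointState dx dy where
  toFun s := js ((1 / γ) • (s.fst - s.snd.snd)) (cl • pt 0 ((1 / γ) • (s.fst - s.snd.snd)))
  map_add' s t := by
    have : (1 / γ) • ((s + t).fst - (s + t).snd.snd) =
        (1 / γ) • (s.fst - s.snd.snd) + (1 / γ) • (t.fst - t.snd.snd) := by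
      rw [← smul_add]; congr 1; simp only [WithLp.add_fst, WithLp.add_snd]; abel
    rw [this]
    refine WithLp.ofLp_injective 2 (Prod.ext rfl ?_)
    change cl • pt 0 (_ + _) = cl • pt 0 _ + cl • pt 0 _
    rw [← smul_add cl, pt_add, add_zero]
  map_smul' c s := by
    have : (1 / γ) • ((c • s).fst - (c • s).snd.snd) = c • (1 / γ) • (s.fst - s.snd.snd) := by
      rw [smul_comm c, smul_sub c]; rfl
    rw [this]
    refine WithLp.ofLp_injective 2 (Prod.ext rfl ?_)
    change cl • pt 0 (c • _) = c • cl • pt 0 _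
    rw [smul_comm c cl]
    exact congrArg (cl • ·) (WithLp.ofLp_injective 2 (Prod.ext (smul_zero c).symm rfl))

/-- By linearity this one bound serves for differences between points (Lipschitz), between agents
(dissimilarity) and between samples and means (variance). The gradient `c` at `(x, θ)` enters twice:
in the `θ`-component and in the `x`-component. -/
theorem norm_gradPart_sq_le (cl μ : ℝ) (a b c : Pair dx dy) :
    ‖gradPart dx dy cl μ (a, b, c)‖ ^ 2 ≤
      ‖c‖ ^ 2 + 3 * cl ^ 2 * (μ ^ 2 * ‖a‖ ^ 2 + ‖b‖ ^ 2 + ‖c‖ ^ 2) := by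
  have h1 : ‖c.snd‖ ^ 2 ≤ ‖c‖ ^ 2 := by rw [norm_pair_sq c]; nlinarith [sq_nonneg ‖c.fst‖]
  have h2 : ‖pt c.fst (0 : Vec dy)‖ ^ 2 ≤ ‖c‖ ^ 2 := by
    rw [norm_pair_sq c, norm_pt_sq, norm_zero]; nlinarith [sq_nonneg ‖c.snd‖]
  have h3 := norm_add_three_sq_le (μ • a) b (-pt c.fst (0 : Vec dy))
  rw [norm_neg, norm_smul, mul_pow, Real.norm_eq_abs, sq_abs, ← sub_eq_add_neg] at h3
  change ‖js c.snd (cl • (μ • a + b - pt c.fst 0))‖ ^ 2 ≤ _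
  rw [norm_js_sq, norm_smul, mul_pow, Real.norm_eq_abs, sq_abs]
  calc _ ≤ ‖c‖ ^ 2 + cl ^ 2 * (3 * (μ ^ 2 * ‖a‖ ^ 2 + ‖b‖ ^ 2 + ‖c‖ ^ 2)) := by
        gcongr; exact h3.trans (by gcongr)
    _ = _ := by ring

theorem norm_proxPart_sq_le (γ cl : ℝ) (s : JointState dx dy) :
    ‖proxPart dx dy γ cl s‖ ^ 2 ≤ 2 * (1 + cl ^ 2) / γ ^ 2 * ‖s‖ ^ 2 := by
  change ‖js ((1 / γ) • (s.fst - s.snd.snd)) (cl • pt 0 ((1 / γ) • (s.fst - s.snd.snd)))‖ ^ 2 ≤ _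
  have h1 := norm_add_sq_le_two s.fst (-s.snd.snd)
  rw [← sub_eq_add_neg, norm_neg] at h1
  have h2 : ‖s.fst - s.snd.snd‖ ^ 2 ≤ 2 * ‖s‖ ^ 2 := by
    rw [norm_joint_sq, norm_pair_sq s.snd]
    nlinarith [sq_nonneg ‖s.snd.fst‖]
  rw [norm_js_sq, norm_smul cl, mul_pow, norm_pt_sq, norm_zero, norm_smul, mul_pow,
    Real.norm_eq_abs, Real.norm_eq_abs, sq_abs, sq_abs]
  calc _ = (1 + cl ^ 2) / γ ^ 2 * ‖s.fst - s.snd.snd‖ ^ 2 := by ring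
    _ ≤ (1 + cl ^ 2) / γ ^ 2 * (2 * ‖s‖ ^ 2) := by gcongr
    _ = _ := by ring

end JointState

/-! ### Penalty schedule and averaged objectives -/

namespace Params

variable {q : Params}

theorem μ_pos (hμ : 0 < q.μ0) (k : ℕ) : 0 < q.μ k := by
  unfold μ; positivity

theorem μ_zero : q.μ 0 = q.μ0 := by simp [μ]

theorem μ_anti (hμ : 0 < q.μ0) (hp : 0 < q.p) (k : ℕ) : q.μ (k + 1) ≤ q.μ k := by
  unfold μ
  gcongr ?_ * ?_
  refine Real.rpow_le_rpow_of_nonpos (by positivity) ?_ (by linarith)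
  push_cast; linarith

theorem μ_le (hμ : 0 < q.μ0) (hp : 0 < q.p) (k : ℕ) : q.μ k ≤ q.μ0 := by
  induction k with
  | zero => exact μ_zero.le
  | succ k ih => exact (μ_anti hμ hp k).trans ih

end Params

theorem hasGradientAt_mean {E : Type*} [NormedAddCommGroup E] [InnerProductSpace ℝ E]
    [CompleteSpace E] {n : ℕ} {f : Fin n → E → ℝ} (hf : ∀ i, Differentiable ℝ (f i)) (z : E) :
    HasGradientAt (fun z => mean fun i => f i z) (mean fun i => gradient (f i) z) z := by
  rw [hasGradientAt_iff_hasFDerivAt]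
  have h := (HasFDerivAt.fun_sum (u := Finset.univ)
    (fun i _ => ((hf i) z).hasGradientAt.hasFDerivAt)).const_smul ((n : ℝ)⁻¹)
  refine HasFDerivAt.congr_fderiv (f := fun z => mean fun i => f i z) h ?_
  simp [mean]

theorem norm_mean_sub_le {E : Type*} [NormedAddCommGroup E] [InnerProductSpace ℝ E] {n : ℕ}
    (hn : 0 < n) {u v : Fin n → E} {C : ℝ} (h : ∀ i, ‖u i - v i‖ ≤ C) :
    ‖mean u - mean v‖ ≤ C := by
  have hn' : (0 : ℝ) < n := by exact_mod_cast hn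
  rw [← mean_sub, mean, norm_smul, norm_inv, Real.norm_natCast, inv_mul_le_iff₀ hn']
  refine (norm_sum_le _ _).trans ((Finset.sum_le_sum fun i _ => h i).trans ?_)
  simp

namespace Problem.Assumptions

variable {Ξf Ξg : Type*} [MeasurableSpace Ξf] [MeasurableSpace Ξg] {dx dy n : ℕ}
  {P : Problem Ξf Ξg dx dy n} {L1 L2 δf δg σf σg Flow : ℝ}

theorem hasGradientAt_F (hA : P.Assumptions L1 L2 δf δg σf σg Flow) (z : Pair dx dy) :
    HasGradientAt P.F (mean fun i => gradient (P.f i) z) z :=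
  hasGradientAt_mean (fun i => (hA.contDiffF i).differentiable one_ne_zero) z

theorem hasGradientAt_G (hA : P.Assumptions L1 L2 δf δg σf σg Flow) (z : Pair dx dy) :
    HasGradientAt P.G (mean fun i => gradient (P.g i) z) z :=
  hasGradientAt_mean (fun i => (hA.contDiffG i).differentiable one_ne_zero) z

theorem differentiable_F (hA : P.Assumptions L1 L2 δf δg σf σg Flow) : Differentiable ℝ P.F :=
  fun z => (hA.hasGradientAt_F z).hasFDerivAt.differentiableAt

theorem differentiable_G (hA : P.Assumptions L1 L2 δf δg σf σg Flow) : Differentiable ℝ P.G :=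
  fun z => (hA.hasGradientAt_G z).hasFDerivAt.differentiableAt

theorem smooth_mean_F (hA : P.Assumptions L1 L2 δf δg σf σg Flow) (hn : 0 < n)
    (z z' : Pair dx dy) : ‖gradient P.F z - gradient P.F z'‖ ≤ L1 * ‖z - z'‖ := by
  rw [(hA.hasGradientAt_F z).gradient, (hA.hasGradientAt_F z').gradient]
  exact norm_mean_sub_le hn fun i => hA.smoothF i z z'

theorem smooth_mean_G (hA : P.Assumptions L1 L2 δf δg σf σg Flow) (hn : 0 < n)
    (z z' : Pair dx dy) : ‖gradient P.G z - gradient P.G z'‖ ≤ L2 * ‖z - z'‖ := by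
  rw [(hA.hasGradientAt_G z).gradient, (hA.hasGradientAt_G z').gradient]
  exact norm_mean_sub_le hn fun i => hA.smoothG i z z'

theorem smoothLower (hA : P.Assumptions L1 L2 δf δg σf σg Flow) (hn : 0 < n) {γ : ℝ}
    (hL2 : 0 < L2) (hγ : 0 < γ) (hγL : γ < 1 / (2 * L2)) : P.SmoothLower L2 γ where
  L2_pos := hL2
  γ_pos := hγ
  γ_lt := by rw [lt_div_iff₀ hγ]; rw [lt_div_iff₀ (by positivity)] at hγL; linarith
  diff := hA.differentiable_G
  smooth := hA.smooth_mean_G hn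

end Problem.Assumptions

/-! ### The bilevel penalty as a potential flow -/

namespace Params

/-- Smoothness constant of the potential. -/
noncomputable def flowL (q : Params) (L1 L2 : ℝ) : ℝ := q.μ0 * L1 + 6 * L2 + 2 / q.γ

/-- Alignment constant between the potential and the average direction. -/
noncomputable def flowC (q : Params) : ℝ := 2 + 3 / q.cl + 3 * q.cl

/-- Lipschitz constant of the local directions. -/
noncomputable def flowLip (q : Params) (L1 L2 : ℝ) : ℝ :=
  √(2 * (L2 ^ 2 + 3 * q.cl ^ 2 * (q.μ0 ^ 2 * L1 ^ 2 + L2 ^ 2 + L2 ^ 2)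
    + 2 * (1 + q.cl ^ 2) / q.γ ^ 2))

/-- Ratio between the dissimilarity of the local directions and that of the gradients. -/
noncomputable def flowσ (q : Params) : ℝ := 1 + 3 * q.cl ^ 2 * (q.μ0 ^ 2 + 2)

/-- Variance bound of the stochastic directions. -/
noncomputable def flowVar (q : Params) (δf δg : ℝ) : ℝ :=
  δg ^ 2 + 3 * q.cl ^ 2 * (q.μ0 ^ 2 * δf ^ 2 + δg ^ 2 + δg ^ 2)

end Params

namespace Problem

variable {Ξf Ξg : Type*} [MeasurableSpace Ξf] [MeasurableSpace Ξg] {dx dy n : ℕ}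

/-- The gradient of the penalty function. -/
noncomputable def gradPsi (P : Problem Ξf Ξg dx dy n) (γ μ : ℝ) (z : Pair dx dy) : Pair dx dy :=
  μ • gradient P.F z + gradient P.G z - P.gradMoreau γ z

/-- The penalty function, shifted to be non-negative, plus the optimality gap of the proximal
problem. -/
noncomputable def potential (P : Problem Ξf Ξg dx dy n) (q : Params) (Flow : ℝ) (k : ℕ)
    (s : JointState dx dy) : ℝ :=
  q.μ k * (P.F s.snd - Flow) + (P.G s.snd - P.moreau q.γ s.snd)
    + (P.proxObjective q.γ s.snd s.fst - P.moreau q.γ s.snd)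

/-- The gradient of the potential. -/
noncomputable def potentialGrad (P : Problem Ξf Ξg dx dy n) (q : Params) (k : ℕ)
    (s : JointState dx dy) : JointState dx dy :=
  js (P.proxGradθ q.γ s.snd s.fst)
    (P.gradPsi q.γ (q.μ k) s.snd + (P.proxGradZ q.γ s.snd s.fst - P.gradMoreau q.γ s.snd))

/-- The expected update direction of agent `i`. -/
noncomputable def meanDir (P : Problem Ξf Ξg dx dy n) (q : Params) (k : ℕ) (i : Fin n)
    (s : JointState dx dy) : JointState dx dy :=
  gradPart dx dy q.cl (q.μ k)
      (gradient (P.f i) s.snd, gradient (P.g i) s.snd, gradient (P.g i) (lowerPt s))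
    + proxPart dx dy q.γ q.cl s

/-- The stochastic update direction of agent `i`. -/
noncomputable def sampleDir (P : Problem Ξf Ξg dx dy n) (q : Params) (k : ℕ) (i : Fin n)
    (s : JointState dx dy) (ξ : Ξf × Ξg) : JointState dx dy :=
  gradPart dx dy q.cl (q.μ k)
      (P.sgradF i s.snd ξ.1, P.sgradG i s.snd ξ.2, P.sgradG i (lowerPt s) ξ.2)
    + proxPart dx dy q.γ q.cl s

variable {P : Problem Ξf Ξg dx dy n} {L1 L2 δf δg σf σg Flow : ℝ} {q : Params}

theorem hasGradientAt_Psi (hA : P.Assumptions L1 L2 δf δg σf σg Flow) {γ : ℝ}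
    (hS : P.SmoothLower L2 γ) (μ : ℝ) (z : Pair dx dy) :
    HasGradientAt (P.Psi γ μ) (P.gradPsi γ μ z) z := by
  have h1 := (hA.differentiable_F z).hasGradientAt.hasFDerivAt
  have h2 := (hA.differentiable_G z).hasGradientAt.hasFDerivAt
  have h3 := (hS.hasGradientAt_moreau z).hasFDerivAt
  rw [hasGradientAt_iff_hasFDerivAt]
  refine HasFDerivAt.congr_fderiv (f := P.Psi γ μ) (((h1.const_mul μ).add h2).sub h3) ?_
  simp [gradPsi]

theorem mean_prod_three {E : Type*} [AddCommGroup E] [Module ℝ E] (a b c : Fin n → E) :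
    mean (fun i => (a i, b i, c i)) = (mean a, mean b, mean c) := by
  have h1 := mean_map (LinearMap.fst ℝ E (E × E)) fun i => (a i, b i, c i)
  have h2 := mean_map (LinearMap.fst ℝ E E ∘ₗ LinearMap.snd ℝ E (E × E)) fun i => (a i, b i, c i)
  have h3 := mean_map (LinearMap.snd ℝ E E ∘ₗ LinearMap.snd ℝ E (E × E)) fun i => (a i, b i, c i)
  exact Prod.ext h1.symm (Prod.ext h2.symm h3.symm)

theorem mean_meanDir (hA : P.Assumptions L1 L2 δf δg σf σg Flow) (hn : 0 < n) (k : ℕ)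
    (s : JointState dx dy) :
    mean (fun i => P.meanDir q k i s) =
      gradPart dx dy q.cl (q.μ k) (gradient P.F s.snd, gradient P.G s.snd, gradient P.G (lowerPt s))
        + proxPart dx dy q.γ q.cl s := by
  simp only [meanDir]
  rw [mean_add, mean_const hn, mean_map, mean_prod_three, (hA.hasGradientAt_F _).gradient,
    (hA.hasGradientAt_G _).gradient, (hA.hasGradientAt_G _).gradient]

/-- The form needed for alignment: `p - w` here faces `p + w` in `potentialGrad`. -/
theorem mean_meanDir_eq_js (hA : P.Assumptions L1 L2 δf δg σf σg Flow) (hn : 0 < n) (k : ℕ)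
    (s : JointState dx dy) :
    mean (fun i => P.meanDir q k i s) = js (P.proxGradθ q.γ s.snd s.fst)
      (q.cl • (P.gradPsi q.γ (q.μ k) s.snd
        - (P.proxGradZ q.γ s.snd s.fst - P.gradMoreau q.γ s.snd))) := by
  rw [mean_meanDir hA hn]
  refine WithLp.ofLp_injective 2 (Prod.ext rfl ?_)
  set c := gradient P.G (lowerPt s) with hc
  have h1 : P.proxGradZ q.γ s.snd s.fst
      = pt c.fst 0 - pt 0 ((1 / q.γ) • (s.fst - s.snd.snd)) := by
    rw [pt_sub, sub_zero, zero_sub, ← smul_neg, neg_sub]; rfl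
  change q.cl • (q.μ k • gradient P.F s.snd + gradient P.G s.snd - pt c.fst 0)
    + q.cl • pt 0 ((1 / q.γ) • (s.fst - s.snd.snd)) = q.cl • _
  rw [← smul_add, h1, gradPsi]
  congr 1
  abel

theorem norm_meanDir_sub_le (hA : P.Assumptions L1 L2 δf δg σf σg Flow) (hμ : 0 < q.μ0)
    (hp : 0 < q.p) (k : ℕ) (i : Fin n) (s t : JointState dx dy) :
    ‖P.meanDir q k i s - P.meanDir q k i t‖ ≤ q.flowLip L1 L2 * ‖s - t‖ := by
  have hμk := Params.μ_le hμ hp k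
  have hμk0 := (Params.μ_pos hμ k).le
  have h1 : P.meanDir q k i s - P.meanDir q k i t = gradPart dx dy q.cl (q.μ k)
      (gradient (P.f i) s.snd - gradient (P.f i) t.snd,
        gradient (P.g i) s.snd - gradient (P.g i) t.snd,
        gradient (P.g i) (lowerPt s) - gradient (P.g i) (lowerPt t))
      + proxPart dx dy q.γ q.cl (s - t) := by
    simp only [meanDir]
    rw [add_sub_add_comm, ← map_sub, ← map_sub]
    rfl
  have hb : ∀ {L : ℝ} {a : Pair dx dy} {c : ℝ}, ‖a‖ ≤ L * c → c ≤ ‖s - t‖ → 0 ≤ c →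
      ‖a‖ ^ 2 ≤ L ^ 2 * ‖s - t‖ ^ 2 := by
    intro L a c h2 h3 h4
    calc ‖a‖ ^ 2 ≤ (L * c) ^ 2 := pow_le_pow_left₀ (norm_nonneg _) h2 2
      _ = L ^ 2 * c ^ 2 := mul_pow _ _ _
      _ ≤ _ := by gcongr
  have hsnd : ‖s.snd - t.snd‖ ≤ ‖s - t‖ := norm_joint_snd_le (s - t)
  have ha := hb (hA.smoothF i s.snd t.snd) hsnd (norm_nonneg _)
  have hb' := hb (hA.smoothG i s.snd t.snd) hsnd (norm_nonneg _)
  have hc := hb (hA.smoothG i (lowerPt s) (lowerPt t)) (norm_lowerPt_sub_le s t) (norm_nonneg _)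
  rw [← sq_le_sq₀ (norm_nonneg _) (by unfold Params.flowLip; positivity), mul_pow, h1,
    Params.flowLip, Real.sq_sqrt (by positivity)]
  refine (norm_add_sq_le_two _ _).trans ?_
  have h2 := norm_gradPart_sq_le q.cl (q.μ k) (gradient (P.f i) s.snd - gradient (P.f i) t.snd)
    (gradient (P.g i) s.snd - gradient (P.g i) t.snd)
    (gradient (P.g i) (lowerPt s) - gradient (P.g i) (lowerPt t))
  have h3 := norm_proxPart_sq_le q.γ q.cl (s - t)
  calc _ ≤ 2 * ((L2 ^ 2 * ‖s - t‖ ^ 2 + 3 * q.cl ^ 2 * (q.μ0 ^ 2 * (L1 ^ 2 * ‖s - t‖ ^ 2)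
        + L2 ^ 2 * ‖s - t‖ ^ 2 + L2 ^ 2 * ‖s - t‖ ^ 2))
        + 2 * (1 + q.cl ^ 2) / q.γ ^ 2 * ‖s - t‖ ^ 2) := by
        gcongr
        exact h2.trans (by gcongr)
    _ = _ := by ring

/-- At a common state the proximal part is the same for all agents and cancels. The dissimilarity of
`g` is used at both `(x, y)` and `(x, θ)`. -/
theorem mean_norm_meanDir_sub_sq_le (hA : P.Assumptions L1 L2 δf δg σf σg Flow) (hn : 0 < n)
    (hμ : 0 < q.μ0) (hp : 0 < q.p) (k : ℕ) (s : JointState dx dy) :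
    mean (fun i => ‖P.meanDir q k i s - mean fun j => P.meanDir q k j s‖ ^ 2) ≤
      q.flowσ * (σf ^ 2 + σg ^ 2) := by
  have hμk := Params.μ_le hμ hp k
  have hμk0 := (Params.μ_pos hμ k).le
  rw [mean_meanDir hA hn]
  have h1 : ∀ i, ‖P.meanDir q k i s - (gradPart dx dy q.cl (q.μ k)
      (gradient P.F s.snd, gradient P.G s.snd, gradient P.G (lowerPt s))
        + proxPart dx dy q.γ q.cl s)‖ ^ 2 ≤
      (1 : ℝ) • ‖gradient (P.g i) (lowerPt s) - gradient P.G (lowerPt s)‖ ^ 2 + (3 * q.cl ^ 2) •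
      (q.μ0 ^ 2 • ‖gradient (P.f i) s.snd - gradient P.F s.snd‖ ^ 2
        + ‖gradient (P.g i) s.snd - gradient P.G s.snd‖ ^ 2
        + ‖gradient (P.g i) (lowerPt s) - gradient P.G (lowerPt s)‖ ^ 2) := fun i => by
    rw [meanDir, add_sub_add_right_eq_sub, ← map_sub]
    refine (norm_gradPart_sq_le q.cl (q.μ k) (gradient (P.f i) s.snd - gradient P.F s.snd)
      (gradient (P.g i) s.snd - gradient P.G s.snd)
      (gradient (P.g i) (lowerPt s) - gradient P.G (lowerPt s))).trans ?_
    simp only [smul_eq_mul, one_mul]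
    gcongr
  refine (mean_mono h1).trans ?_
  rw [mean_add, mean_smul, mean_smul, mean_add, mean_add, mean_smul]
  simp only [smul_eq_mul, one_mul]
  have hf := hA.dissimF s.snd
  have hg := hA.dissimG s.snd
  have hl := hA.dissimG (lowerPt s)
  calc _ ≤ σg ^ 2 + 3 * q.cl ^ 2 * (q.μ0 ^ 2 * σf ^ 2 + σg ^ 2 + σg ^ 2) := by gcongr
    _ ≤ _ := by
      rw [Params.flowσ]
      have h2 : 0 ≤ q.cl ^ 2 * σf ^ 2 := by positivity
      have h3 : 0 ≤ q.cl ^ 2 * q.μ0 ^ 2 * σg ^ 2 := by positivity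
      have h4 : 0 ≤ σf ^ 2 := by positivity
      nlinarith

theorem continuous_potential (hA : P.Assumptions L1 L2 δf δg σf σg Flow)
    (hS : P.SmoothLower L2 q.γ) (k : ℕ) : Continuous (P.potential q Flow k) := by
  have h1 : Continuous fun s : JointState dx dy => s.snd :=
    continuous_snd.comp (WithLp.prod_continuous_ofLp 2 _ _)
  have h2 : Continuous fun s : JointState dx dy => s.fst :=
    continuous_fst.comp (WithLp.prod_continuous_ofLp 2 _ _)
  have h3 : Continuous fun z : Pair dx dy => z.fst :=
    continuous_fst.comp (WithLp.prod_continuous_ofLp 2 _ _)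
  have h4 : Continuous fun z : Pair dx dy => z.snd :=
    continuous_snd.comp (WithLp.prod_continuous_ofLp 2 _ _)
  have hl : Continuous fun s : JointState dx dy => lowerPt s :=
    (WithLp.prod_continuous_toLp 2 _ _).comp ((h3.comp h1).prodMk h2)
  have hF := continuous_of_differentiable hA.differentiable_F
  have hG := continuous_of_differentiable hA.differentiable_G
  have hV : Continuous (P.moreau q.γ) := continuous_of_differentiable
    fun z => (hS.hasGradientAt_moreau z).hasFDerivAt.differentiableAt
  have hprox : Continuous fun s : JointState dx dy => P.proxObjective q.γ s.snd s.fst :=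
    (hG.comp hl).add (continuous_const.mul ((h2.sub (h4.comp h1)).norm.pow 2))
  exact ((continuous_const.mul ((hF.comp h1).sub continuous_const)).add
    ((hG.comp h1).sub (hV.comp h1))).add (hprox.sub (hV.comp h1))

/-- The envelope enters with a minus sign, so only its lower Taylor bound is needed. The `L2`-part
of `flowL / 2` is `1/2` from `G`, `2` from the two copies of `V_γ` and `1/2` from `H`; the coupling
square adds `1 / γ`. -/
theorem potential_add_le (hA : P.Assumptions L1 L2 δf δg σf σg Flow) (hn : 0 < n)
    (hS : P.SmoothLower L2 q.γ) (hL1 : 0 ≤ L1) (hμ : 0 < q.μ0) (hp : 0 < q.p) (k : ℕ)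
    (s h : JointState dx dy) :
    P.potential q Flow k (s + h) ≤ P.potential q Flow k s + ⟪P.potentialGrad q k s, h⟫_ℝ
      + q.flowL L1 L2 / 2 * ‖h‖ ^ 2 := by
  have hμk := Params.μ_le hμ hp k
  have hμk0 := (Params.μ_pos hμ k).le
  have hγ := hS.γ_pos
  have hL2 := hS.L2_pos
  have hF := (abs_le.1 (abs_sub_sub_inner_gradient_le hA.differentiable_F
    (hA.smooth_mean_F hn) s.snd h.snd)).2
  have hG := (abs_le.1 (abs_sub_sub_inner_gradient_le hA.differentiable_G
    (hA.smooth_mean_G hn) s.snd h.snd)).2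
  have hV := (hS.abs_moreau_taylor_le s.snd h.snd).1
  have hH := hS.prox_taylor_le s.snd h.snd s.fst h.fst
  have hF' := mul_le_mul_of_nonneg_left hF hμk0
  have h1 : 1 / (2 * q.γ) * ‖h.fst - h.snd.snd‖ ^ 2 ≤ 1 / q.γ * ‖h‖ ^ 2 := by
    have h2 := norm_add_sq_le_two h.fst (-h.snd.snd)
    rw [← sub_eq_add_neg, norm_neg] at h2
    have h3 : ‖h.fst - h.snd.snd‖ ^ 2 ≤ 2 * ‖h‖ ^ 2 := by
      rw [norm_joint_sq, norm_pair_sq h.snd]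
      nlinarith [sq_nonneg ‖h.snd.fst‖]
    calc _ ≤ 1 / (2 * q.γ) * (2 * ‖h‖ ^ 2) := by gcongr
      _ = _ := by field_simp
  have h2 : ‖h.snd.fst‖ ^ 2 + ‖h.fst‖ ^ 2 ≤ ‖h‖ ^ 2 := by
    rw [norm_joint_sq, norm_pair_sq h.snd]
    nlinarith [sq_nonneg ‖h.snd.snd‖]
  have h3 : ‖h.snd‖ ^ 2 ≤ ‖h‖ ^ 2 := by
    rw [norm_joint_sq]
    nlinarith [sq_nonneg ‖h.fst‖]
  have h4 : q.μ k * (L1 / 2 * ‖h.snd‖ ^ 2) ≤ q.μ0 * (L1 / 2 * ‖h‖ ^ 2) := by gcongr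
  have h5 : L2 * ‖h.snd‖ ^ 2 ≤ L2 * ‖h‖ ^ 2 := by gcongr
  have h6 : L2 / 2 * (‖h.snd.fst‖ ^ 2 + ‖h.fst‖ ^ 2) ≤ L2 / 2 * ‖h‖ ^ 2 := by gcongr
  have h7 : ⟪P.potentialGrad q k s, h⟫_ℝ = ⟪P.proxGradθ q.γ s.snd s.fst, h.fst⟫_ℝ
      + (q.μ k * ⟪gradient P.F s.snd, h.snd⟫_ℝ + ⟪gradient P.G s.snd, h.snd⟫_ℝ
      - 2 * ⟪P.gradMoreau q.γ s.snd, h.snd⟫_ℝ + ⟪P.proxGradZ q.γ s.snd s.fst, h.snd⟫_ℝ) := by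
    rw [potentialGrad, inner_joint, js_fst, js_snd, gradPsi, inner_add_left, inner_sub_left,
      inner_sub_left, inner_add_left, real_inner_smul_left]
    ring
  have h8 : q.flowL L1 L2 / 2 * ‖h‖ ^ 2 = q.μ0 * (L1 / 2 * ‖h‖ ^ 2) + 3 * (L2 * ‖h‖ ^ 2)
      + 1 / q.γ * ‖h‖ ^ 2 := by
    rw [Params.flowL]; ring
  rw [h7, h8]
  simp only [potential, WithLp.add_snd, WithLp.add_fst]
  linarith

theorem potential_nonneg (hA : P.Assumptions L1 L2 δf δg σf σg Flow)
    (hS : P.SmoothLower L2 q.γ) (hμ : 0 < q.μ0) (k : ℕ) (s : JointState dx dy) :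
    0 ≤ P.potential q Flow k s :=
  add_nonneg (add_nonneg
    (mul_nonneg (Params.μ_pos hμ k).le (sub_nonneg.2 (hA.lowerBound _)))
    (sub_nonneg.2 (hS.moreau_le _))) (sub_nonneg.2 (hS.moreau_le_prox _ _))

/-- Since `⟪p + w, p - w⟫ = ‖p‖² - ‖w‖²`, the inner product is `A = ‖u‖² + cl (‖p‖² - ‖w‖²)`. With
`cl ‖w‖² ≤ ‖u‖² / 4` this yields `‖u‖² ≤ 4A/3`, `‖p‖² ≤ A/cl` and `‖w‖² ≤ A/(3 cl)`, and `flowC`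
covers the resulting combinations. -/
theorem align_ge (hA : P.Assumptions L1 L2 δf δg σf σg Flow) (hn : 0 < n)
    (hS : P.SmoothLower L2 q.γ) (hcl : 0 < q.cl)
    (hr : ∀ v : Vec dy, q.cl * ((L2 ^ 2 + 1 / q.γ ^ 2) * ‖v‖ ^ 2) ≤
      (1 / q.γ - L2) ^ 2 * ‖v‖ ^ 2 / 4) (k : ℕ) (s : JointState dx dy) :
    ‖P.potentialGrad q k s‖ ^ 2 ≤
        q.flowC * ⟪P.potentialGrad q k s, mean fun i => P.meanDir q k i s⟫_ℝ ∧
      ‖mean fun i => P.meanDir q k i s‖ ^ 2 ≤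
        q.flowC * ⟪P.potentialGrad q k s, mean fun i => P.meanDir q k i s⟫_ℝ ∧
      ‖P.gradPsi q.γ (q.μ k) s.snd‖ ^ 2 ≤
        q.flowC * ⟪P.potentialGrad q k s, mean fun i => P.meanDir q k i s⟫_ℝ := by
  rw [mean_meanDir_eq_js hA hn, potentialGrad]
  have hw := hS.norm_proxGradZ_sub_sq_le s.snd s.fst (P.thetaStar q.γ s.snd)
  have hu := hS.norm_proxGradθ_sq_ge s.snd s.fst
  have hr' := hr (s.fst - P.thetaStar q.γ s.snd)
  rw [← gradMoreau] at hw
  set e := ‖s.fst - P.thetaStar q.γ s.snd‖ ^ 2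
  set u := P.proxGradθ q.γ s.snd s.fst
  set w := P.proxGradZ q.γ s.snd s.fst - P.gradMoreau q.γ s.snd
  set p := P.gradPsi q.γ (q.μ k) s.snd
  have hin : ⟪js u (p + w), js u (q.cl • (p - w))⟫_ℝ = ‖u‖ ^ 2 + q.cl * (‖p‖ ^ 2 - ‖w‖ ^ 2) := by
    rw [inner_joint, js_fst, js_snd, js_fst, js_snd, real_inner_self_eq_norm_sq, inner_smul_right,
      inner_sub_right, inner_add_left, inner_add_left, real_inner_self_eq_norm_sq,
      real_inner_self_eq_norm_sq, real_inner_comm w p]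
    ring
  rw [hin, norm_js_sq, norm_js_sq, norm_smul, mul_pow, Real.norm_eq_abs, sq_abs]
  set A := ‖u‖ ^ 2 + q.cl * (‖p‖ ^ 2 - ‖w‖ ^ 2) with hAdef
  have hwu : q.cl * ‖w‖ ^ 2 ≤ ‖u‖ ^ 2 / 4 :=
    (mul_le_mul_of_nonneg_left hw hcl.le).trans (hr'.trans (by linarith))
  have hp0 : 0 ≤ q.cl * ‖p‖ ^ 2 := by positivity
  have hu0 : 0 ≤ ‖u‖ ^ 2 := by positivity
  have huA : ‖u‖ ^ 2 ≤ 4 / 3 * A := by rw [hAdef]; linarith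
  have hA0 : 0 ≤ A := by linarith
  have hpA : ‖p‖ ^ 2 ≤ A / q.cl := by
    rw [le_div_iff₀ hcl, hAdef]; linarith
  have hwA : ‖w‖ ^ 2 ≤ A / q.cl / 3 := by
    rw [div_div, le_div_iff₀ (by positivity)]; linarith
  have h1 := norm_add_sq_le_two p w
  have h2 := norm_add_sq_le_two p (-w)
  rw [← sub_eq_add_neg, norm_neg] at h2
  have hC : q.flowC * A = 2 * A + 3 * (A / q.cl) + 3 * (q.cl * A) := by
    rw [Params.flowC]; ring
  have hAc : 0 ≤ A / q.cl := by positivity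
  have hcA : 0 ≤ q.cl * A := by positivity
  rw [hC]
  refine ⟨by linarith, ?_, by linarith⟩
  have h3 : q.cl ^ 2 * ‖p - w‖ ^ 2 ≤ q.cl ^ 2 * (2 * (A / q.cl + A / q.cl / 3)) := by
    gcongr; linarith
  have h4 : q.cl ^ 2 * (2 * (A / q.cl + A / q.cl / 3)) = 8 / 3 * (q.cl * A) := by
    field_simp; ring
  linarith

theorem potentialFlow (hA : P.Assumptions L1 L2 δf δg σf σg Flow) (hn : 0 < n)
    (hS : P.SmoothLower L2 q.γ) (hL1 : 0 ≤ L1) (hμ : 0 < q.μ0) (hp : 0 < q.p) (hcl : 0 < q.cl)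
    (hr : ∀ v : Vec dy, q.cl * ((L2 ^ 2 + 1 / q.γ ^ 2) * ‖v‖ ^ 2) ≤
      (1 / q.γ - L2) ^ 2 * ‖v‖ ^ 2 / 4) :
    PotentialFlow (P.potential q Flow) (P.potentialGrad q) (P.meanDir q)
      (q.flowL L1 L2) q.flowC (q.flowLip L1 L2) (q.flowσ * (σf ^ 2 + σg ^ 2)) where
  L_nonneg := by have := hS.γ_pos; have := hS.L2_pos; unfold Params.flowL; positivity
  one_le_C := by
    unfold Params.flowC
    have : 0 ≤ 3 / q.cl + 3 * q.cl := by positivity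
    linarith
  l_nonneg := Real.sqrt_nonneg _
  σ2_nonneg := by unfold Params.flowσ; positivity
  nonneg := potential_nonneg hA hS hμ
  anti k s := by
    unfold potential
    have := hA.lowerBound s.snd
    gcongr
    exact Params.μ_anti hμ hp k
  smooth := potential_add_le hA hn hS hL1 hμ hp
  lip := norm_meanDir_sub_le hA hμ hp
  dissim := mean_norm_meanDir_sub_sq_le hA hn hμ hp
  align_q k s := (align_ge hA hn hS hcl hr k s).1
  align_d k s := (align_ge hA hn hS hcl hr k s).2.1

end Problem

/-! ### The algorithm as stochastic descent on the joint variable -/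

theorem LinearMap.integral_comp_of_finiteDimensional {Ω M F : Type*} [MeasurableSpace Ω]
    {P : Measure Ω} [NormedAddCommGroup M] [NormedSpace ℝ M] [FiniteDimensional ℝ M]
    [NormedAddCommGroup F] [NormedSpace ℝ F] [CompleteSpace F] (T : M →ₗ[ℝ] F) {X : Ω → M}
    (hX : Integrable X P) :
    Integrable (fun ω => T (X ω)) P ∧ ∫ ω, T (X ω) ∂P = T (∫ ω, X ω ∂P) := by
  have : CompleteSpace M := FiniteDimensional.complete ℝ M
  exact ⟨T.toContinuousLinearMap.integrable_comp hX, T.toContinuousLinearMap.integral_comp_comm hX⟩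

theorem LinearMap.measurable_of_finiteDimensional {M F : Type*} [NormedAddCommGroup M]
    [NormedSpace ℝ M] [FiniteDimensional ℝ M] [MeasurableSpace M] [BorelSpace M]
    [NormedAddCommGroup F] [NormedSpace ℝ F] [MeasurableSpace F] [BorelSpace F]
    (T : M →ₗ[ℝ] F) : Measurable T :=
  T.continuous_of_finiteDimensional.measurable

section Oracle

variable {Ω α : Type*} [MeasurableSpace Ω] [MeasurableSpace α] {E : Type*}
  [NormedAddCommGroup E] [InnerProductSpace ℝ E] [FiniteDimensional ℝ E] [MeasurableSpace E]
  [BorelSpace E]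

/-- Integrability, mean and variance of an oracle evaluated at a random sample. -/
theorem oracle_comp {P : Measure Ω} {X : Ω → α} {ν : Measure α} {φ : α → E} {m : E} {v : ℝ}
    [IsProbabilityMeasure P]
    (hX : Measurable X) (hν : P.map X = ν) (hφ : Measurable φ) (hm : ∫ x, φ x ∂ν = m)
    (hv : ∫⁻ x, ‖m - φ x‖ₑ ^ 2 ∂ν ≤ ENNReal.ofReal v) :
    Integrable (fun ω => φ (X ω)) P ∧ ∫ ω, φ (X ω) ∂P = m ∧
      ∫⁻ ω, ENNReal.ofReal (‖φ (X ω) - m‖ ^ 2) ∂P ≤ ENNReal.ofReal v := by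
  subst hν
  have hvar : ∫⁻ ω, ‖m - φ (X ω)‖ₑ ^ 2 ∂P ≤ ENNReal.ofReal v := by
    rwa [lintegral_map (f := fun x => ‖m - φ x‖ₑ ^ 2)
      ((measurable_const.sub hφ).enorm.pow_const 2) hX] at hv
  -- Integrability comes from the variance bound, since the value of a Bochner integral alone does
  -- not imply it.
  have hint : Integrable (fun ω => m - φ (X ω)) P :=
    (memLp_two_of_lintegral_le
      (measurable_const.sub (hφ.comp hX)).aestronglyMeasurable hvar).integrable one_le_two
  refine ⟨((integrable_const m).sub hint).congr
    (Filter.Eventually.of_forall fun ω => sub_sub_cancel m _), ?_, ?_⟩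
  · rw [← hm, integral_map hX.aemeasurable hφ.aestronglyMeasurable]
  · refine (lintegral_mono fun ω => ?_).trans hvar
    rw [ENNReal.ofReal_pow (norm_nonneg _), ofReal_norm, ← enorm_neg, neg_sub]

end Oracle

namespace Run

variable {Ω Ξf Ξg : Type*} [MeasurableSpace Ω] [MeasurableSpace Ξf]
  [MeasurableSpace Ξg] {dx dy n : ℕ} {R : Run Ω Ξf Ξg dx dy n}
  {L1 L2 δf δg σf σg Flow : ℝ} {q : Params}

/-- The pair of samples drawn by an agent in an iteration. -/
def sample (R : Run Ω Ξf Ξg dx dy n) (a : ℕ × Fin n) (ω : Ω) : Ξf × Ξg :=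
  (R.ξf a.1 a.2 ω, R.ξg a.1 a.2 ω)

/-- The same sample of `g` serves at `(x, y)` and `(x, θ)`, and the two samples of one agent may be
dependent. Unbiasedness needs only linearity, and the variance bound uses a triangle inequality
instead of independence. -/
theorem stochasticOracle (hA : R.prob.Assumptions L1 L2 δf δg σf σg Flow)
    (hI : R.IndependentSampling) (hμ : 0 < q.μ0) (hp : 0 < q.p) :
    StochasticOracle R.measure R.sample (R.prob.sampleDir q) (R.prob.meanDir q)
      (q.flowVar δf δg) := by
  have hprob := hI.isProb
  have hF : ∀ k i (z : Pair dx dy),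
      Integrable (fun ω => R.prob.sgradF i z (R.ξf k i ω)) R.measure ∧
      ∫ ω, R.prob.sgradF i z (R.ξf k i ω) ∂(R.measure) = gradient (R.prob.f i) z ∧
      ∫⁻ ω, ENNReal.ofReal (‖R.prob.sgradF i z (R.ξf k i ω) - gradient (R.prob.f i) z‖ ^ 2)
        ∂(R.measure) ≤ ENNReal.ofReal (δf ^ 2) := fun k i z =>
    oracle_comp (hI.measurableF k i) (hI.lawF k i) ((hA.measurableF i).comp measurable_prodMk_left)
      (hA.unbiasedF i z) (hA.varianceF i z)
  have hG : ∀ k i (z : Pair dx dy),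
      Integrable (fun ω => R.prob.sgradG i z (R.ξg k i ω)) R.measure ∧
      ∫ ω, R.prob.sgradG i z (R.ξg k i ω) ∂(R.measure) = gradient (R.prob.g i) z ∧
      ∫⁻ ω, ENNReal.ofReal (‖R.prob.sgradG i z (R.ξg k i ω) - gradient (R.prob.g i) z‖ ^ 2)
        ∂(R.measure) ≤ ENNReal.ofReal (δg ^ 2) := fun k i z =>
    oracle_comp (hI.measurableG k i) (hI.lawG k i) ((hA.measurableG i).comp measurable_prodMk_left)
      (hA.unbiasedG i z) (hA.varianceG i z)
  have hint : ∀ k i (s : JointState dx dy), Integrable (fun ω =>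
      (R.prob.sgradF i s.snd (R.ξf k i ω), R.prob.sgradG i s.snd (R.ξg k i ω),
        R.prob.sgradG i (lowerPt s) (R.ξg k i ω))) R.measure := fun k i s =>
    (hF k i s.snd).1.prodMk ((hG k i s.snd).1.prodMk (hG k i (lowerPt s)).1)
  have hgint : ∀ k i (s : JointState dx dy), Integrable (fun ω =>
      gradPart dx dy q.cl (q.μ k) (R.prob.sgradF i s.snd (R.ξf k i ω),
        R.prob.sgradG i s.snd (R.ξg k i ω), R.prob.sgradG i (lowerPt s) (R.ξg k i ω)))
      R.measure := fun k i s =>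
    (LinearMap.integral_comp_of_finiteDimensional (gradPart dx dy q.cl (q.μ k)) (hint k i s)).1
  have hlower : Measurable fun s : JointState dx dy => lowerPt s := by
    refine Continuous.measurable ?_
    refine LipschitzWith.continuous (K := 1) (LipschitzWith.of_dist_le_mul fun s t => ?_)
    rw [dist_eq_norm, dist_eq_norm, NNReal.coe_one, one_mul]
    exact norm_lowerPt_sub_le s t
  have hsnd : Measurable fun s : JointState dx dy => s.snd :=
    (continuous_snd.comp (WithLp.prod_continuous_ofLp 2 _ _)).measurable
  refine ⟨hprob, by unfold Params.flowVar; positivity,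
    fun a => (hI.measurableF a.1 a.2).prodMk (hI.measurableG a.1 a.2), hI.indep, fun k i => ?_,
    fun k i s => ?_, fun k i s => ?_, fun k i s => ?_⟩
  · have h1 : Measurable fun p : JointState dx dy × (Ξf × Ξg) =>
        R.prob.sgradF i p.1.snd p.2.1 :=
      (hA.measurableF i).comp ((hsnd.comp measurable_fst).prodMk
        (measurable_fst.comp measurable_snd))
    have h2 : Measurable fun p : JointState dx dy × (Ξf × Ξg) =>
        R.prob.sgradG i p.1.snd p.2.2 :=
      (hA.measurableG i).comp ((hsnd.comp measurable_fst).prodMk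
        (measurable_snd.comp measurable_snd))
    have h3 : Measurable fun p : JointState dx dy × (Ξf × Ξg) =>
        R.prob.sgradG i (lowerPt p.1) p.2.2 :=
      (hA.measurableG i).comp ((hlower.comp measurable_fst).prodMk
        (measurable_snd.comp measurable_snd))
    have h4 : Measurable (gradPart dx dy q.cl (q.μ k)) :=
      LinearMap.measurable_of_finiteDimensional _
    have h5 : Measurable (proxPart dx dy q.γ q.cl) :=
      LinearMap.measurable_of_finiteDimensional _
    exact (h4.comp (h1.prodMk (h2.prodMk h3))).add (h5.comp measurable_fst)
  · exact (hgint k i s).add (integrable_const _)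
  · have h1 :=
      (LinearMap.integral_comp_of_finiteDimensional (gradPart dx dy q.cl (q.μ k)) (hint k i s)).2
    have h2 := integral_pair (hF k i s.snd).1 ((hG k i s.snd).1.prodMk (hG k i (lowerPt s)).1)
    have h3 := integral_pair (hG k i s.snd).1 (hG k i (lowerPt s)).1
    rw [h3, (hF k i s.snd).2.1, (hG k i s.snd).2.1, (hG k i (lowerPt s)).2.1] at h2
    rw [h2] at h1
    simp only [Problem.sampleDir, sample]
    rw [integral_add (hgint k i s) (integrable_const _)]
    simp only [integral_const, probReal_univ, one_smul]
    rw [Problem.meanDir]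
    exact congrArg (· + proxPart dx dy q.γ q.cl s) h1
  · have hμk := Params.μ_le hμ hp k
    have hμk0 := (Params.μ_pos hμ k).le
    set a : Ω → ℝ := fun ω =>
      ‖R.prob.sgradF i s.snd (R.ξf k i ω) - gradient (R.prob.f i) s.snd‖ ^ 2 with ha
    set b : Ω → ℝ := fun ω =>
      ‖R.prob.sgradG i s.snd (R.ξg k i ω) - gradient (R.prob.g i) s.snd‖ ^ 2 with hb
    set c : Ω → ℝ := fun ω =>
      ‖R.prob.sgradG i (lowerPt s) (R.ξg k i ω) - gradient (R.prob.g i) (lowerPt s)‖ ^ 2 with hc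
    have hle : ∀ ω, ‖R.prob.sampleDir q k i s (R.sample (k, i) ω) - R.prob.meanDir q k i s‖ₑ ^ 2 ≤
        ENNReal.ofReal (c ω) + ENNReal.ofReal (3 * q.cl ^ 2) *
          (ENNReal.ofReal (q.μ0 ^ 2) * ENNReal.ofReal (a ω) + ENNReal.ofReal (b ω)
            + ENNReal.ofReal (c ω)) := fun ω => by
      rw [← ENNReal.ofReal_mul (by positivity), ← ENNReal.ofReal_add (by positivity) (by positivity),
        ← ENNReal.ofReal_add (by positivity) (by positivity), ← ENNReal.ofReal_mul (by positivity),
        ← ENNReal.ofReal_add (by positivity) (by positivity), ← ofReal_norm,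
        ← ENNReal.ofReal_pow (norm_nonneg _)]
      refine ENNReal.ofReal_le_ofReal ?_
      rw [Problem.sampleDir, Problem.meanDir, add_sub_add_right_eq_sub, ← map_sub]
      refine (norm_gradPart_sq_le q.cl (q.μ k)
        (R.prob.sgradF i s.snd (R.ξf k i ω) - gradient (R.prob.f i) s.snd)
        (R.prob.sgradG i s.snd (R.ξg k i ω) - gradient (R.prob.g i) s.snd)
        (R.prob.sgradG i (lowerPt s) (R.ξg k i ω) - gradient (R.prob.g i) (lowerPt s))).trans ?_
      simp only [ha, hb, hc]
      gcongr
    have ma : AEMeasurable (fun ω => ENNReal.ofReal (a ω)) R.measure :=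
      (((hF k i s.snd).1.sub (integrable_const _)).aestronglyMeasurable.norm.pow
        2).aemeasurable.ennreal_ofReal
    have mb : AEMeasurable (fun ω => ENNReal.ofReal (b ω)) R.measure :=
      (((hG k i s.snd).1.sub (integrable_const _)).aestronglyMeasurable.norm.pow
        2).aemeasurable.ennreal_ofReal
    have mc : AEMeasurable (fun ω => ENNReal.ofReal (c ω)) R.measure :=
      (((hG k i (lowerPt s)).1.sub (integrable_const _)).aestronglyMeasurable.norm.pow
        2).aemeasurable.ennreal_ofReal
    refine (lintegral_mono hle).trans ?_
    rw [lintegral_add_left' mc, lintegral_const_mul' _ _ ENNReal.ofReal_ne_top,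
      lintegral_add_right' _ mc, lintegral_add_right' _ mb,
      lintegral_const_mul' _ _ ENNReal.ofReal_ne_top]
    have h1 := (hF k i s.snd).2.2
    have h2 := (hG k i s.snd).2.2
    have h3 := (hG k i (lowerPt s)).2.2
    rw [Params.flowVar]
    rw [ENNReal.ofReal_add (p := δg ^ 2) (by positivity) (by positivity),
      ENNReal.ofReal_mul (p := 3 * q.cl ^ 2) (by positivity),
      ENNReal.ofReal_add (q := δg ^ 2) (by positivity) (by positivity),
      ENNReal.ofReal_add (q := δg ^ 2) (by positivity) (by positivity),
      ENNReal.ofReal_mul (p := q.μ0 ^ 2) (by positivity)]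
    gcongr

/-- The joint variables of all agents in iteration `k`. -/
noncomputable def jointIterate (R : Run Ω Ξf Ξg dx dy n) (q : Params) (K k : ℕ) (ω : Ω) (i : Fin n) :
    JointState dx dy :=
  toJoint dx dy (R.iterate q K k ω i)

/-- The ratio `c_λ` is moved from the step size into the direction, so that all variables share the
single step `λ_θ`. -/
theorem toJoint_step (c cl : ℝ) (s D : AgentState dx dy) :
    toJoint dx dy (s.1 - c • D.1, s.2.1 - (cl * c) • D.2.1, s.2.2 - (cl * c) • D.2.2) =
      toJoint dx dy s - c • js D.1 (cl • pt D.2.1 D.2.2) := by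
  refine WithLp.ofLp_injective 2 (Prod.ext rfl (WithLp.ofLp_injective 2 (Prod.ext ?_ ?_)))
  · change s.2.1 - (cl * c) • D.2.1 = s.2.1 - c • cl • D.2.1
    rw [smul_smul, mul_comm]
  · change s.2.2 - (cl * c) • D.2.2 = s.2.2 - c • cl • D.2.2
    rw [smul_smul, mul_comm]

theorem sampleDir_eq_direction (k : ℕ) (i : Fin n) (s : AgentState dx dy) (ξ : Ξf) (ζ : Ξg) :
    R.prob.sampleDir q k i (toJoint dx dy s) (ξ, ζ) =
      js (R.direction q.γ (q.μ k) i s ξ ζ).1 (q.cl •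
        pt (R.direction q.γ (q.μ k) i s ξ ζ).2.1 (R.direction q.γ (q.μ k) i s ξ ζ).2.2) := by
  refine WithLp.ofLp_injective 2 (Prod.ext rfl ?_)
  set a := R.prob.sgradF i (pt s.2.1 s.2.2) ξ with ha
  set b := R.prob.sgradG i (pt s.2.1 s.2.2) ζ with hb
  set c := R.prob.sgradG i (pt s.2.1 s.1) ζ with hc
  change q.cl • (q.μ k • a + b - pt c.fst 0) + q.cl • pt 0 ((1 / q.γ) • (s.1 - s.2.2)) =
    q.cl • pt (q.μ k • a.fst + b.fst - c.fst) (q.μ k • a.snd + b.snd - (1 / q.γ) • (s.2.2 - s.1))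
  rw [← smul_add]
  congr 1
  refine WithLp.ofLp_injective 2 (Prod.ext ?_ ?_)
  · change q.μ k • a.fst + b.fst - c.fst + 0 = _
    rw [add_zero]; rfl
  · change q.μ k • a.snd + b.snd - 0 + (1 / q.γ) • (s.1 - s.2.2) =
      q.μ k • a.snd + b.snd - (1 / q.γ) • (s.2.2 - s.1)
    rw [sub_zero, ← neg_sub s.1 s.2.2, smul_neg, sub_neg_eq_add]

theorem jointIterate_succ (K k : ℕ) (ω : Ω) :
    R.jointIterate q K (k + 1) ω = mixStep R.W (q.stepθ n K) (R.jointIterate q K k ω)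
      fun i => R.prob.sampleDir q k i (R.jointIterate q K k ω i) (R.sample (k, i) ω) := by
  funext i
  simp only [jointIterate, iterate, mixStep]
  rw [map_sum]
  refine Finset.sum_congr rfl fun j _ => ?_
  rw [map_smul]
  congr 1
  rw [sample, sampleDir_eq_direction, ← toJoint_step]
  rfl

theorem mean_jointIterate_snd (K k : ℕ) (ω : Ω) :
    (mean (R.jointIterate q K k ω)).snd = R.meanPoint q K k ω := by
  have h : mean (R.jointIterate q K k ω) = toJoint dx dy (mean (R.iterate q K k ω)) :=
    mean_map (toJoint dx dy) (R.iterate q K k ω)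
  have h1 := mean_map (LinearMap.fst ℝ (Vec dx) (Vec dy) ∘ₗ
    LinearMap.snd ℝ (Vec dy) (Vec dx × Vec dy)) (R.iterate q K k ω)
  have h2 := mean_map (LinearMap.snd ℝ (Vec dx) (Vec dy) ∘ₗ
    LinearMap.snd ℝ (Vec dy) (Vec dx × Vec dy)) (R.iterate q K k ω)
  rw [h, meanPoint]
  simp only [LinearMap.comp_apply, LinearMap.fst_apply, LinearMap.snd_apply] at h1 h2
  rw [h1, h2]
  rfl

/-- The condition on `c_λ`, combined with the lower bound for Lipschitz constants of `θ*_γ`. -/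
theorem RatioCondition.mul_le (hR : R.RatioCondition q L2) (hS : R.prob.SmoothLower L2 q.γ)
    (v : Vec dy) : q.cl * ((L2 ^ 2 + 1 / q.γ ^ 2) * ‖v‖ ^ 2) ≤
      (1 / q.γ - L2) ^ 2 * ‖v‖ ^ 2 / 4 := by
  -- The lower bound on Lipschitz constants of `θ*` needs a nonzero vector; for `dy = 0` the claim
  -- is trivial.
  rcases Nat.eq_zero_or_pos dy with rfl | hdy
  · have : v = 0 := Subsingleton.elim _ _
    simp [this]
  have : NeZero dy := ⟨hdy.ne'⟩
  obtain ⟨K, hK, hlip, hcl⟩ := hR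
  have h1 := hS.one_le_mul_lipschitz hlip
  have hγ := hS.γ_pos
  have hL := hS.L2_pos
  have hlt := hS.γ_lt
  rw [← one_div_pow] at hcl ⊢
  set a := 1 / q.γ with ha
  have ha0 : 0 < a := by positivity
  set M := √(L2 ^ 2 + a ^ 2) with hM
  have hM2 : M ^ 2 = L2 ^ 2 + a ^ 2 := Real.sq_sqrt (by positivity)
  have hM0 : 0 < M := Real.sqrt_pos.2 (by positivity)
  have hη : 0 < a - L2 := by linarith
  have hγL : q.γ * L2 < 1 / 2 := by
    rw [ha, lt_div_iff₀ hγ] at hlt; linarith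
  -- From `1 ≤ (1 + γ L2) K` and `γ L2 < 1 / 2`.
  have hK2 : 1 ≤ 3 / 2 * K := h1.trans (by gcongr; linarith)
  have hcl' : q.cl * (16 * M * K) ≤ a - L2 := by
    have e : 32 * (M / (2 * K)) * K ^ 2 = 16 * M * K := by field_simp; ring
    rwa [e, le_div_iff₀ (by positivity)] at hcl
  -- Because `a > 2 * L2`, one has `(a - L2)² ≥ a² / 4`, whereas `M² ≤ 5 a² / 4`.
  have hM1 : M * (3 / 8) ≤ a - L2 := by
    rw [← sq_le_sq₀ (by positivity) hη.le, mul_pow, hM2]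
    nlinarith
  have hkey : q.cl * M ^ 2 ≤ (a - L2) ^ 2 / 4 := by
    rcases le_or_gt q.cl 0 with h0 | h0
    · exact (mul_nonpos_of_nonpos_of_nonneg h0 (sq_nonneg _)).trans (by positivity)
    · have h2 : q.cl * M ≤ 3 / 32 * (a - L2) := by
        have h3 : q.cl * M * 1 ≤ q.cl * M * (3 / 2 * K) := by gcongr
        linarith
      calc q.cl * M ^ 2 = (q.cl * M) * M := by ring
        _ ≤ (3 / 32 * (a - L2)) * (8 / 3 * (a - L2)) := by gcongr; linarith
        _ = _ := by ring
  rw [hM2] at hkey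
  calc q.cl * ((L2 ^ 2 + a ^ 2) * ‖v‖ ^ 2) = (q.cl * (L2 ^ 2 + a ^ 2)) * ‖v‖ ^ 2 := by ring
    _ ≤ (a - L2) ^ 2 / 4 * ‖v‖ ^ 2 := by gcongr
    _ = _ := by ring

end Run

/-! ### Transient order and the linear-speedup rate -/

theorem one_le_inv_one_sub_pow {ρ : ℝ} (h0 : 0 ≤ ρ) (h1 : ρ < 1) (m : ℕ) :
    1 ≤ 1 / (1 - ρ) ^ m := by
  have h : 0 < 1 - ρ := by linarith
  rw [le_div_iff₀ (by positivity), one_mul]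
  exact pow_le_one₀ h.le (by linarith)

theorem one_le_transientOrder {n : ℕ} (hn : 0 < n) {ρ : ℝ} (h0 : 0 ≤ ρ) (h1 : ρ < 1)
    (σf σg : ℝ) : 1 ≤ transientOrder n ρ σf σg := by
  refine le_max_of_le_left ?_
  have hn' : (1 : ℝ) ≤ n := by exact_mod_cast hn
  rw [div_eq_mul_one_div]
  exact one_le_mul_of_one_le_of_one_le (one_le_pow₀ hn') (one_le_inv_one_sub_pow h0 h1 4)

/-- A run longer than the transient order has `√K ≥ n^{3/2} (1-ρ)⁻² max {1, σ_f² + σ_g²}`. -/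
theorem le_sqrt_of_transientOrder_le {n K : ℕ} {ρ σf σg : ℝ} (h1 : ρ < 1)
    (hK : transientOrder n ρ σf σg ≤ K) :
    √(n : ℝ) ^ 3 / (1 - ρ) ^ 2 ≤ √(K : ℝ) ∧
      √(n : ℝ) ^ 3 * (σf ^ 2 + σg ^ 2) / (1 - ρ) ^ 2 ≤ √(K : ℝ) := by
  have h : 0 < 1 - ρ := by linarith
  have hs : (n : ℝ) ^ 3 = (√(n : ℝ) ^ 2) ^ 3 := by rw [Real.sq_sqrt (by positivity)]
  have e1 : (√(n : ℝ) ^ 3 / (1 - ρ) ^ 2) ^ 2 = (n : ℝ) ^ 3 / (1 - ρ) ^ 4 := by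
    rw [hs]; generalize 1 - ρ = r; ring
  have e2 : (√(n : ℝ) ^ 3 * (σf ^ 2 + σg ^ 2) / (1 - ρ) ^ 2) ^ 2
      = (n : ℝ) ^ 3 * (σf ^ 2 + σg ^ 2) ^ 2 / (1 - ρ) ^ 4 := by
    rw [hs]; generalize 1 - ρ = r; ring
  constructor
  · refine Real.le_sqrt_of_sq_le ?_
    rw [e1]
    exact (le_max_left _ _).trans hK
  · refine Real.le_sqrt_of_sq_le ?_
    rw [e2]
    exact (le_max_right _ _).trans hK

namespace Params

/-- The constant of the linear-speedup rate. -/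
noncomputable def rateConst (q : Params) (L1 L2 δf δg B : ℝ) : ℝ :=
  2 * q.flowC * (1 + L2 + 1 / q.γ) * |B| / q.cθ + 8 * q.flowC ^ 2 * q.flowLip L1 L2 ^ 2 * |B|
    + 16 * q.flowC ^ 2 * q.flowLip L1 L2 ^ 2 * q.flowσ * q.cθ ^ 2
    + 3 * q.flowC * q.flowL L1 L2 * q.flowVar δf δg * q.cθ
    + 8 * q.flowC ^ 2 * q.flowLip L1 L2 ^ 2 * q.cθ ^ 2 * q.flowVar δf δg + 1

/-- The constant of the transient stage. -/
noncomputable def transientConst (q : Params) (L1 L2 : ℝ) : ℝ :=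
  1 + (q.cθ * (6 * q.flowL L1 L2 * q.flowC + 2 * q.flowLip L1 L2)) ^ 2

end Params

/-- The terms of the convergence estimate are dominated by the linear-speedup rate. -/
theorem rate_le {x y r S lam cθ C L l cs v b B : ℝ} (hx : 0 < x) (hy : 1 ≤ y) (hr : 0 < r)
    (hr1 : r ≤ 1) (hcθ : 0 < cθ) (hcs : 0 ≤ cs)
    (hv : 0 ≤ v) (hB : 0 ≤ B) (hlam : lam = cθ * (y / x)) (h1 : y ^ 3 / r ^ 2 ≤ x)
    (h2 : y ^ 3 * S / r ^ 2 ≤ x) :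
    2 * C / lam * ((b * B + 4 * C * l ^ 2 * lam / r * B) / x ^ 2
      + (8 * C * l ^ 2 * lam ^ 3 * (cs * S) / r ^ 2 + 3 / 2 * L * lam ^ 2 * (v / y ^ 2)
        + 4 * C * l ^ 2 * lam ^ 3 / r * v)) ≤
      (2 * C * b * B / cθ + 8 * C ^ 2 * l ^ 2 * B + 16 * C ^ 2 * l ^ 2 * cs * cθ ^ 2
        + 3 * C * L * v * cθ + 8 * C ^ 2 * l ^ 2 * cθ ^ 2 * v) / (x * y) := by
  have hy0 : 0 < y := by linarith
  subst hlam
  -- Here `x = √K`, `y = √n`, `r = 1 - ρ`. With `1 / (x * y)` factored out, each term is a constant,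
  -- possibly times a ratio that `h1` or `h2` bounds by one.
  have e : 2 * C / (cθ * (y / x)) * ((b * B + 4 * C * l ^ 2 * (cθ * (y / x)) / r * B) / x ^ 2
      + (8 * C * l ^ 2 * (cθ * (y / x)) ^ 3 * (cs * S) / r ^ 2
        + 3 / 2 * L * (cθ * (y / x)) ^ 2 * (v / y ^ 2)
        + 4 * C * l ^ 2 * (cθ * (y / x)) ^ 3 / r * v)) =
      (2 * C * b * B / cθ + 8 * C ^ 2 * l ^ 2 * B * (y / r / x)
        + 16 * C ^ 2 * l ^ 2 * cs * cθ ^ 2 * (y ^ 3 * S / r ^ 2 / x)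
        + 3 * C * L * v * cθ + 8 * C ^ 2 * l ^ 2 * cθ ^ 2 * v * (y ^ 3 / r / x)) / (x * y) := by
    field_simp
    ring
  rw [e]
  have h4 : y ^ 3 / r ≤ y ^ 3 / r ^ 2 := by
    gcongr
    nlinarith
  have h5 : y / r ≤ y ^ 3 / r := by
    gcongr
    exact le_self_pow₀ hy (by norm_num)
  have g1 : y / r / x ≤ 1 := (div_le_one hx).2 (h5.trans (h4.trans h1))
  have g2 : y ^ 3 * S / r ^ 2 / x ≤ 1 := (div_le_one hx).2 h2
  have g3 : y ^ 3 / r / x ≤ 1 := (div_le_one hx).2 (h4.trans h1)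
  gcongr ?_ / (x * y)
  have k1 := mul_le_of_le_one_right (a := 8 * C ^ 2 * l ^ 2 * B) (by positivity) g1
  have k2 := mul_le_of_le_one_right (a := 16 * C ^ 2 * l ^ 2 * cs * cθ ^ 2) (by positivity) g2
  have k3 := mul_le_of_le_one_right (a := 8 * C ^ 2 * l ^ 2 * cθ ^ 2 * v) (by positivity) g3
  linarith

namespace Run

variable {Ω Ξf Ξg : Type*} [MeasurableSpace Ω] [MeasurableSpace Ξf]
  [MeasurableSpace Ξg] {dx dy n : ℕ} {R : Run Ω Ξf Ξg dx dy n}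
  {L1 L2 δf δg σf σg Flow B : ℝ} {q : Params}

/-- All summands of the initial error are non-negative, so `B ≥ 0`. The optimality gap of `θ` is at
most `(L2 + 1 / γ) / 2` times the squared distance to the minimizer. -/
theorem lyapunov_init_le (hA : R.prob.Assumptions L1 L2 δf δg σf σg Flow)
    (hS : R.prob.SmoothLower L2 q.γ) (hμ : 0 < q.μ0)
    (hB : R.initialError q Flow ≤ B) {w : ℝ} (hw : 0 ≤ w) :
    0 ≤ B ∧ PotentialFlow.lyapunov (R.prob.potential q Flow) w 0
      (fun i => toJoint dx dy (R.init i)) ≤ (1 + L2 + 1 / q.γ) * B + w * B := by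
  have hm : mean (fun i => toJoint dx dy (R.init i)) = js (mean fun i => (R.init i).1)
      (pt (mean fun i => (R.init i).2.1) (mean fun i => (R.init i).2.2)) := by
    have h0 := mean_map (LinearMap.fst ℝ (Vec dy) (Vec dx × Vec dy)) R.init
    have h1 := mean_map (LinearMap.fst ℝ (Vec dx) (Vec dy) ∘ₗ
      LinearMap.snd ℝ (Vec dy) (Vec dx × Vec dy)) R.init
    have h2 := mean_map (LinearMap.snd ℝ (Vec dx) (Vec dy) ∘ₗ
      LinearMap.snd ℝ (Vec dy) (Vec dx × Vec dy)) R.init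
    rw [mean_map]
    simp only [LinearMap.comp_apply, LinearMap.fst_apply, LinearMap.snd_apply] at h0 h1 h2
    rw [h0, h1, h2]
    rfl
  unfold initialError at hB
  unfold PotentialFlow.lyapunov dispersion
  rw [hm]
  simp only at hB
  set θ := mean fun i => (R.init i).1
  set x := mean fun i => (R.init i).2.1
  set y := mean fun i => (R.init i).2.2
  have hd : ∀ i, ‖toJoint dx dy (R.init i) - js θ (pt x y)‖ ^ 2 =
      ‖(R.init i).2.1 - x‖ ^ 2 + ‖(R.init i).2.2 - y‖ ^ 2 + ‖(R.init i).1 - θ‖ ^ 2 := fun i => by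
    change ‖js ((R.init i).1 - θ) (pt ((R.init i).2.1 - x) ((R.init i).2.2 - y))‖ ^ 2 = _
    rw [norm_js_sq, norm_pt_sq]; ring
  simp_rw [hd]
  have hdis : 0 ≤ mean fun i => ‖(R.init i).2.1 - x‖ ^ 2 + ‖(R.init i).2.2 - y‖ ^ 2
      + ‖(R.init i).1 - θ‖ ^ 2 := mean_nonneg fun i => by positivity
  have h1 : 0 ≤ q.μ0 * (R.prob.F (pt x y) - Flow) :=
    mul_nonneg hμ.le (sub_nonneg.2 (hA.lowerBound _))
  have h2 := hS.moreau_le (pt x y)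
  have h3 := hS.prox_sub_moreau_le (pt x y) θ
  have h4 : 0 ≤ ‖θ - R.prob.thetaStar q.γ (pt x y)‖ ^ 2 := by positivity
  have hB0 : 0 ≤ B := by linarith
  have hc : 0 ≤ L2 + 1 / q.γ := by have := hS.L2_pos; have := hS.γ_pos; positivity
  refine ⟨hB0, add_le_add ?_ (mul_le_mul_of_nonneg_left (by linarith) hw)⟩
  have h5 : (L2 + 1 / q.γ) / 2 * ‖θ - R.prob.thetaStar q.γ (pt x y)‖ ^ 2 ≤
      (L2 + 1 / q.γ) / 2 * B := by gcongr; linarith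
  have h6 : 0 ≤ (L2 + 1 / q.γ) * B := by positivity
  simp only [Problem.potential, js_fst, js_snd, Params.μ_zero]
  linarith

theorem averageStationarity_le (hL1 : 0 ≤ L1) (hL2 : 0 < L2)
    (hγ : 0 < q.γ) (hγL : q.γ < 1 / (2 * L2)) (hμ : 0 < q.μ0) (hp : 0 < q.p)
    (hcθ : 0 < q.cθ) (hcl : 0 < q.cl) (hW : R.W.IsHermitian) (hn : 0 < n)
    (hA : R.prob.Assumptions L1 L2 δf δg σf σg Flow) (hD : R.W ∈ doublyStochastic ℝ (Fin n))
    (hρ : connectivity hW < 1) (hI : R.IndependentSampling) (hR : R.RatioCondition q L2)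
    (hB : R.initialError q Flow ≤ B) {K : ℕ}
    (hK : q.transientConst L1 L2 * transientOrder n (connectivity hW) σf σg ≤ K) :
    R.averageStationarity q K ≤
      ENNReal.ofReal (q.rateConst L1 L2 δf δg B / √((n : ℝ) * K)) := by
  have hS := hA.smoothLower hn hL2 hγ hγL
  have hr := hR.mul_le hS
  have hflow := Problem.potentialFlow hA hn hS hL1 hμ hp hcl hr
  have horacle := stochasticOracle (R := R) hA hI hμ hp
  have hρ0 := connectivity_nonneg hW
  have hT1 := one_le_transientOrder hn hρ0 hρ σf σg
  set ρ := connectivity hW with hρdef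
  set T := transientOrder n ρ σf σg with hTdef
  have hC0 : 1 ≤ q.transientConst L1 L2 := by
    exact le_add_of_nonneg_right (sq_nonneg _)
  have hKT : T ≤ K := le_trans (le_mul_of_one_le_left (by linarith) hC0) hK
  have hK1 : (1 : ℝ) ≤ K := hT1.trans hKT
  obtain ⟨hx1, hx2⟩ := le_sqrt_of_transientOrder_le hρ hKT
  have hr0 : 0 < 1 - ρ := by linarith
  have hn1 : (1 : ℝ) ≤ n := by exact_mod_cast hn
  have hx : 0 < √(K : ℝ) := Real.sqrt_pos.2 (by linarith)
  have hy : 1 ≤ √(n : ℝ) := Real.one_le_sqrt.2 hn1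
  set lam := q.stepθ n K with hlamdef
  have hlam : lam = q.cθ * (√(n : ℝ) / √(K : ℝ)) := rfl
  have hlam0 : 0 < lam := by rw [hlam]; positivity
  have hC := hflow.one_le_C
  have hl := hflow.l_nonneg
  have hL := hflow.L_nonneg
  set c := 6 * q.flowL L1 L2 * q.flowC + 2 * q.flowLip L1 L2 with hc
  have hc0 : 0 ≤ c := by positivity
  -- Both step-size restrictions in one: it suffices that `K ≥ (cθ c)² n / (1 - ρ)²`, which the
  -- square in `transientConst` secures.
  have hstep : c * lam ≤ 1 - ρ := by
    have h1 : c * lam * √(K : ℝ) = q.cθ * c * √(n : ℝ) := by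
      rw [hlam]; field_simp
    have h2 : (q.cθ * c) ^ 2 * ((n : ℝ) ^ 3 / (1 - ρ) ^ 4) ≤ K := by
      refine le_trans ?_ hK
      have : (n : ℝ) ^ 3 / (1 - ρ) ^ 4 ≤ T := le_max_left _ _
      gcongr
      unfold Params.transientConst
      linarith
    have h3 : q.cθ * c * (√(n : ℝ) / (1 - ρ)) ≤ √(K : ℝ) := by
      refine Real.le_sqrt_of_sq_le (le_trans ?_ h2)
      rw [mul_pow, div_pow, Real.sq_sqrt (by positivity)]
      gcongr ?_ * (?_ / ?_)
      · exact le_self_pow₀ hn1 (by norm_num)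
      · exact pow_le_pow_of_le_one hr0.le (by linarith) (by norm_num)
    have h4 : c * lam * √(K : ℝ) ≤ (1 - ρ) * √(K : ℝ) := by
      rw [h1]
      calc q.cθ * c * √(n : ℝ) = (1 - ρ) * (q.cθ * c * (√(n : ℝ) / (1 - ρ))) := by field_simp
        _ ≤ _ := by gcongr
    exact le_of_mul_le_mul_right h4 hx
  have hlam1 : 6 * q.flowL L1 L2 * q.flowC * lam ≤ 1 := by
    have : 0 ≤ 2 * q.flowLip L1 L2 * lam := by positivity
    rw [hc] at hstep
    linarith
  have hlam2 : 2 * q.flowLip L1 L2 * lam ≤ 1 - ρ := by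
    have : 0 ≤ 6 * q.flowL L1 L2 * q.flowC * lam := by positivity
    rw [hc] at hstep
    linarith
  have hmain := sum_lintegral_align_le hflow horacle
    (fun k => (Problem.continuous_potential hA hS k).measurable) hn hW hD hρ hlam0.le hlam1 hlam2
    (S := R.jointIterate q K) (s0 := fun i => toJoint dx dy (R.init i)) (fun ω => rfl)
    (fun k ω => jointIterate_succ K k ω) K
  obtain ⟨hB0, hinit⟩ := lyapunov_init_le hA hS hμ hB
    (w := 4 * q.flowC * q.flowLip L1 L2 ^ 2 * lam / (1 - ρ)) (by positivity)
  set w := 4 * q.flowC * q.flowLip L1 L2 ^ 2 * lam / (1 - ρ) with hw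
  set N := noiseLevel n ρ lam (q.flowL L1 L2) q.flowC (q.flowLip L1 L2)
    (q.flowσ * (σf ^ 2 + σg ^ 2)) (q.flowVar δf δg) with hN
  have hσ2 := hflow.σ2_nonneg
  have hv0 := horacle.v_nonneg
  have hN0 : 0 ≤ N := by rw [hN]; unfold noiseLevel; positivity
  set I := (1 + L2 + 1 / q.γ) * B + w * B with hIdef
  have hI0 : 0 ≤ I := by positivity
  -- The third estimate of `align_ge`: the alignment dominates `‖∇Ψ‖² / flowC`.
  have hstat : ∀ k, R.stationarity q K k ≤ ENNReal.ofReal (2 * q.flowC / lam) *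
      ∫⁻ ω, ENNReal.ofReal (lam / 2 * ⟪R.prob.potentialGrad q k (mean (R.jointIterate q K k ω)),
        mean fun i => R.prob.meanDir q k i (mean (R.jointIterate q K k ω))⟫_ℝ) ∂(R.measure) := by
    intro k
    rw [← lintegral_const_mul' _ _ ENNReal.ofReal_ne_top]
    refine lintegral_mono fun ω => ?_
    rw [← ENNReal.ofReal_mul (by positivity), (Problem.hasGradientAt_Psi hA hS _ _).gradient,
      ← ofReal_norm, ← ENNReal.ofReal_pow (norm_nonneg _), ← mean_jointIterate_snd]
    refine ENNReal.ofReal_le_ofReal ?_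
    refine (Problem.align_ge hA hn hS hcl hr k (mean (R.jointIterate q K k ω))).2.2.trans
      (le_of_eq ?_)
    field_simp
  have hKr : (K : ℝ≥0∞)⁻¹ = ENNReal.ofReal ((K : ℝ)⁻¹) := by
    rw [ENNReal.ofReal_inv_of_pos (by linarith), ENNReal.ofReal_natCast]
  calc R.averageStationarity q K
      ≤ (K : ℝ≥0∞)⁻¹ * (ENNReal.ofReal (2 * q.flowC / lam) *
          (ENNReal.ofReal I + K * ENNReal.ofReal N)) := by
        unfold averageStationarity
        gcongr
        refine (Finset.sum_le_sum fun k _ => hstat k).trans ?_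
        rw [← Finset.mul_sum]
        gcongr
        exact hmain.trans (by gcongr)
    _ = ENNReal.ofReal (2 * q.flowC / lam * (I / √(K : ℝ) ^ 2 + N)) := by
        rw [hKr, ← ENNReal.ofReal_natCast, ← ENNReal.ofReal_mul (by positivity),
          ← ENNReal.ofReal_add hI0 (by positivity), ← ENNReal.ofReal_mul (by positivity),
          ← ENNReal.ofReal_mul (by positivity), Real.sq_sqrt (by positivity)]
        congr 1
        field_simp
    _ ≤ _ := by
        refine ENNReal.ofReal_le_ofReal ?_
        have h := rate_le (L := q.flowL L1 L2) (l := q.flowLip L1 L2) (cs := q.flowσ)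
          (b := 1 + L2 + 1 / q.γ) hx hy hr0 (by linarith)
          (S := σf ^ 2 + σg ^ 2) (C := q.flowC) hcθ (by unfold Params.flowσ; positivity) hv0 hB0 hlam hx1 hx2
        rw [Real.sq_sqrt (Nat.cast_nonneg n)] at h
        refine h.trans ?_
        rw [mul_comm (√(K : ℝ)), ← Real.sqrt_mul (by positivity), Params.rateConst,
          abs_of_nonneg hB0]
        exact div_le_div_of_nonneg_right (by linarith) (by positivity)

theorem toENNReal_iInf_mem_le {s : Set ℕ} {f : ℕ → ℕ} {K : ℕ} (hK : K ∈ s) {c : ℝ}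
    (hc : (f K : ℝ) ≤ c) : ((⨅ k ∈ s, (f k : ℕ∞) : ℕ∞) : ℝ≥0∞) ≤ ENNReal.ofReal c := by
  refine (ENat.toENNReal_mono (iInf₂_le K hK)).trans ?_
  rw [ENat.toENNReal_coe, ← ENNReal.ofReal_natCast]
  exact ENNReal.ofReal_le_ofReal hc

/-- Some term is at most the average. -/
theorem exists_stationarity_le_average {K : ℕ} (hK : 0 < K) :
    ∃ k < K, R.stationarity q K k ≤ R.averageStationarity q K := by
  by_contra! h
  have hK' : (K : ℝ≥0∞) ≠ 0 := by exact_mod_cast hK.ne'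
  have htop : R.averageStationarity q K ≠ ⊤ := ((h 0 hK).trans_le le_top).ne
  have h1 : ∑ k ∈ Finset.range K, R.averageStationarity q K <
      ∑ k ∈ Finset.range K, R.stationarity q K k := by
    refine ENNReal.sum_lt_sum_of_nonempty ⟨0, Finset.mem_range.2 hK⟩ fun k hk => ?_
    exact h k (Finset.mem_range.1 hk)
  have h2 : ∑ k ∈ Finset.range K, R.averageStationarity q K =
      ∑ k ∈ Finset.range K, R.stationarity q K k := by
    rw [Finset.sum_const, Finset.card_range, nsmul_eq_mul, averageStationarity, ← mul_assoc,
      ENNReal.mul_inv_cancel hK' (ENNReal.natCast_ne_top K), one_mul]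
  exact h1.ne h2

end Run

end SunDSBO

/-! ### The two complexities -/

theorem mainTheorem3
    (L1 L2 δf δg B : ℝ) (q : SunDSBO.Params)
    (hL1 : 0 ≤ L1) (hL2 : 0 < L2) (hδf : 0 ≤ δf) (hδg : 0 ≤ δg)
    (hγ : 0 < q.γ) (hγL : q.γ < 1 / (2 * L2))
    (hμ : 0 < q.μ0) (hp : 0 < q.p) (hp' : q.p < 1 / 4)
    (hcθ : 0 < q.cθ) (hcl : 0 < q.cl) :
    ∃ A C : ℝ, 0 < A ∧ 0 < C ∧
      ∀ (Ω Ξf Ξg : Type*) [MeasurableSpace Ω] [MeasurableSpace Ξf] [MeasurableSpace Ξg]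
        (dx dy n : ℕ) (R : SunDSBO.Run Ω Ξf Ξg dx dy n) (σf σg Flow : ℝ)
        (hW : R.W.IsHermitian),
        0 < n → 0 ≤ σf → 0 ≤ σg →
        R.prob.Assumptions L1 L2 δf δg σf σg Flow →
        R.W ∈ doublyStochastic ℝ (Fin n) →
        SunDSBO.connectivity hW < 1 →
        R.IndependentSampling →
        R.RatioCondition q L2 →
        R.initialError q Flow ≤ B →
        (∀ μ : ℝ, 0 < μ → Differentiable ℝ (R.prob.Psi q.γ μ)) ∧
        (∀ ε : ℝ, 0 < ε →
          ε ^ 2 * (n * SunDSBO.transientOrder n (SunDSBO.connectivity hW) σf σg) ≤ 1 →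
          (R.sampleComplexity q ε : ℝ≥0∞) ≤ ENNReal.ofReal (C / ε ^ 2)) ∧
        (R.transientComplexity q A : ℝ≥0∞) ≤
          ENNReal.ofReal (C * SunDSBO.transientOrder n (SunDSBO.connectivity hW) σf σg) := by
  set A := q.rateConst L1 L2 δf δg B with hAdef
  set C0 := q.transientConst L1 L2 with hC0def
  -- `A` is fixed before anything is known about the sign of `B`; `|B|` and the summand `1` in
  -- `rateConst` keep it positive.
  have hA1 : 0 < A := by
    rw [hAdef]
    unfold SunDSBO.Params.rateConst SunDSBO.Params.flowC SunDSBO.Params.flowσ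
      SunDSBO.Params.flowL SunDSBO.Params.flowVar
    positivity
  have hC0 : 0 < C0 := by
    rw [hC0def]
    unfold SunDSBO.Params.transientConst
    positivity
  -- Three gradients per agent and iteration: `C0` pays for the transient stage, `A ^ 2` for
  -- reaching accuracy `ε` at the speedup rate, and `1` for rounding up. This also exceeds the `C0 +
  -- 1` needed for the transient complexity.
  refine ⟨A, 3 * (C0 + 1) + 3 * A ^ 2, hA1, by positivity, ?_⟩
  intro Ω Ξf Ξg _ _ _ dx dy n R σf σg Flow hW hn _ _ hA hD hρ hI hR hB
  have hT1 := SunDSBO.one_le_transientOrder hn (SunDSBO.connectivity_nonneg hW) hρ σf σg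
  have hrate : ∀ K : ℕ, C0 * SunDSBO.transientOrder n (SunDSBO.connectivity hW) σf σg ≤ K →
      R.averageStationarity q K ≤ ENNReal.ofReal (A / √((n : ℝ) * K)) := fun K hK =>
    SunDSBO.Run.averageStationarity_le hL1 hL2 hγ hγL hμ hp hcθ hcl hW hn hA hD hρ hI hR hB hK
  set T := SunDSBO.transientOrder n (SunDSBO.connectivity hW) σf σg
  have hn' : (0 : ℝ) < n := by exact_mod_cast hn
  have hn1 : (1 : ℝ) ≤ n := by exact_mod_cast hn
  refine ⟨fun μ _ z => (SunDSBO.Problem.hasGradientAt_Psi hA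
    (hA.smoothLower hn hL2 hγ hγL) μ z).hasFDerivAt.differentiableAt, fun ε hε hεT => ?_, ?_⟩
  -- The first summand makes the rate valid; the second makes `A / √(n K') ≤ ε` for all `K' ≥ K`.
  · set K := ⌈C0 * T + A ^ 2 / (n * ε ^ 2)⌉₊ with hKdef
    have hKle : C0 * T + A ^ 2 / (n * ε ^ 2) ≤ K := Nat.le_ceil _
    have hKge : (K : ℝ) < C0 * T + A ^ 2 / (n * ε ^ 2) + 1 := Nat.ceil_lt_add_one (by positivity)
    refine SunDSBO.Run.toENNReal_iInf_mem_le (K := K) ?_ ?_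
    · intro K' hK'
      have hK'r : (K : ℝ) ≤ K' := by exact_mod_cast hK'
      have hq : 0 ≤ A ^ 2 / (n * ε ^ 2) := by positivity
      have hCT : 0 < C0 * T := by positivity
      have hK0 : 0 < K' := by
        have : (0 : ℝ) < K' := by linarith
        exact_mod_cast this
      obtain ⟨k, hk, hle⟩ := SunDSBO.Run.exists_stationarity_le_average (R := R) (q := q) hK0
      refine ⟨k, hk, hle.trans ((hrate K' (by linarith)).trans (ENNReal.ofReal_le_ofReal ?_))⟩
      have hpos : 0 < (n : ℝ) * K' := by positivity
      rw [div_le_iff₀ (Real.sqrt_pos.2 hpos), ← div_le_iff₀' hε]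
      refine Real.le_sqrt_of_sq_le ?_
      have h1 : A ^ 2 / (n * ε ^ 2) ≤ K' := by linarith
      rw [div_le_iff₀ (by positivity)] at h1
      rw [div_pow, div_le_iff₀ (by positivity)]
      linarith
    · have hε2 : 0 < ε ^ 2 := by positivity
      rw [le_div_iff₀ hε2, SunDSBO.Run.gradientEvaluations]
      push_cast
      have h2 : (3 * n * K : ℝ) * ε ^ 2 ≤
          3 * n * (C0 * T + A ^ 2 / (n * ε ^ 2) + 1) * ε ^ 2 := by gcongr
      have h3 : 3 * n * (C0 * T + A ^ 2 / (n * ε ^ 2) + 1) * ε ^ 2 =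
          3 * C0 * (ε ^ 2 * (n * T)) + 3 * A ^ 2 + 3 * (ε ^ 2 * (n * 1)) := by
        field_simp
      have h4 : 3 * C0 * (ε ^ 2 * (n * T)) ≤ 3 * C0 * 1 := by gcongr
      -- The rounding error costs `3 n ε²`, at most `3` because `T ≥ 1` and `ε² n T ≤ 1`.
      have h5 : ε ^ 2 * (n * 1) ≤ ε ^ 2 * (n * T) := by gcongr
      linarith
  · set K := ⌈C0 * T⌉₊ with hKdef
    have hKle : C0 * T ≤ K := Nat.le_ceil _
    have hKge : (K : ℝ) < C0 * T + 1 := Nat.ceil_lt_add_one (by positivity)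
    refine SunDSBO.Run.toENNReal_iInf_mem_le (f := fun K => K) (K := K) ?_ ?_
    · intro K' hK'
      have hK'r : (K : ℝ) ≤ K' := by exact_mod_cast hK'
      exact hrate K' (hKle.trans hK'r)
    · have : 0 ≤ (2 * C0 + 3 * A ^ 2 + 2) * T := by positivity
      linarith
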